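/- Let $K$ be a field of characteristic $0$, $\Gamma$ an abelian group, $n\ge 2$, and $\varepsilon:\Gamma\times\Gamma\to K\setminus\{0\}$ a bicharacter: $\varepsilon(a,b)\varepsilon(b,a)=1$, and $\varepsilon$ is multiplicative in each argument. For homogeneous elements (or maps) $x,y$ of degrees $a,b$ write $\varepsilon(x,y)=\varepsilon(a,b)$; a sum such as $x+y$ inside $\varepsilon$ stands for the sum of the degrees, and a tuple $X=(x_1,\dots,x_k)$ stands for the sum of the degrees of its entries. A multilinear map is $\varepsilon$-skew-symmetric if interchanging two adjacent homogeneous arguments $x_i,x_{i+1}$ multiplies its value by $-\varepsilon(x_i,x_{i+1})$. Let $(\mathfrak g,[\cdot,\dots,\cdot],\varepsilon,\alpha)$ be a multiplicative $n$-Hom-Lie color algebra: $\mathfrak g=\bigoplus_{\gamma\in\Gamma}\mathfrak g_\gamma$ is a graded vector space, $[\cdot,\dots,\cdot]:\mathfrak g^n\to\mathfrak g$ is $n$-linear, of degree $0$ and $\varepsilon$-skew-symmetric, $\alpha:\mathfrak g\to\mathfrak g$ is linear of degree $0$ with $\alpha[x_1,\dots,x_n]=[\alpha x_1,\dots,\alpha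 x_n]$, and, writing $\mathrm{ad}_X y=[x_1,\dots,x_{n-1},y]$ and $\tilde\alpha(X)=(\alpha x_1,\dots,\alpha x_{n-1})$ for $X=(x_1,\dots,x_{n-1})$, $$\mathrm{ad}_{\tilde\alpha(X)}[y_1,\dots,y_n]=\sum_{i=1}^n\varepsilon(X,y_1+\dots+y_{i-1})[\alpha y_1,\dots,\alpha y_{i-1},\mathrm{ad}_Xy_i,\alpha y_{i+1},\dots,\alpha y_n]$$ for homogeneous entries. Let $\mathcal L=\bigwedge^{n-1}\mathfrak g$ (the $\varepsilon$-exterior power), so that linear maps on $\mathcal L$ are $\varepsilon$-skew-symmetric $(n-1)$-linear maps on $\mathfrak g$, and put $[X,Y]_\alpha=\sum_{i=1}^{n-1}\varepsilon(X,y_1+\dots+y_{i-1})\,\alpha y_1\wedge\dots\wedge\alpha y_{i-1}\wedge\mathrm{ad}_Xy_i\wedge\alpha y_{i+1}\wedge\dots\wedge\alpha y_{n-1}$. Let $(M,\rho,\mu)$ be a representation: $M=\bigoplus_\gamma M_\gamma$ is a graded vector space, $\rho:\mathcal L\to\mathrm{End}(M)$ is linear of degree $0$, $\mu\in\mathrm{End}(M)$,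 and for all homogeneous entries $$\rho(\tilde\alpha X)\mu=\mu\rho(X),\qquad \rho(\tilde\alpha X)\rho(Y)-\varepsilon(X,Y)\rho(\tilde\alpha Y)\rho(X)=\rho([X,Y]_\alpha)\mu,$$ $$\rho([x_1,\dots,x_n],\alpha y_1,\dots,\alpha y_{n-2})\mu=\sum_{i=1}^n(-1)^{n-i}\varepsilon(x_i,x_{i+1}+\dots+x_n)\rho(\alpha x_1,\dots,\widehat{\alpha x_i},\dots,\alpha x_n)\rho(x_i,y_1,\dots,y_{n-2}).$$ For $p\ge1$, a $p$-cochain of degree $\xi\in\Gamma$ is a multilinear map $\varphi(X_1,\dots,X_{p-1},z)\in M$, with $X_i=(x_i^1,\dots,x_i^{n-1})\in\mathfrak g^{n-1}$ and $z\in\mathfrak g$, which is homogeneous of degree $\xi$, is $\varepsilon$-skew-symmetric in the entries of each $X_i$ and, if $p\ge2$, in the last $n$ variables $x_{p-1}^1,\dots,x_{p-1}^{n-1},z$ (that is, a map $\mathcal L^{\otimes(p-1)}\wedge\mathfrak g\to M$), and satisfies $\mu\varphi(X_1,\dots,X_{p-1},z)=\varphi(\tilde\alpha X_1,\dots,\tilde\alpha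 X_{p-1},\alpha z)$. Let $C^p_{\alpha,\mu}(\mathfrak g,M)$ be the direct sum over $\xi$ of the spaces of $p$-cochains of degree $\xi$. Let $\delta^p$ be the linear operator which sends a homogeneous $p$-cochain $\varphi$ to the multilinear map that is given on homogeneous arguments by $$\begin{aligned}\delta^p\varphi(X_1,\dots,X_p,z)={}&\sum_{1\le i<j\le p}(-1)^i\varepsilon(X_i,X_{i+1}+\dots+X_{j-1})\,\varphi(\tilde\alpha X_1,\dots,\widehat{\tilde\alpha X_i},\dots,\tilde\alpha X_{j-1},[X_i,X_j]_\alpha,\tilde\alpha X_{j+1},\dots,\tilde\alpha X_p,\alpha z)\\&+\sum_{i=1}^p(-1)^i\varepsilon(X_i,X_{i+1}+\dots+X_p)\,\varphi(\tilde\alpha X_1,\dots,\widehat{\tilde\alpha X_i},\dots,\tilde\alpha X_p,\mathrm{ad}_{X_i}z)\\&+\sum_{i=1}^p(-1)^{i+1}\varepsilon(\varphi+X_1+\dots+X_{i-1},X_i)\,\rho(\tilde\alpha^{p-1}X_i)\,\varphi(X_1,\dots,\widehat{X_i},\dots,X_p,z)\\&+(-1)^{p+1}\sum_{k=1}^{n-1}(-1)^{n-k}\varepsilon(\varphi+X_1+\dots+X_{p-1},\,x_p^1+\dots+\widehat{x_p^k}+\dots+x_p^{n-1}+z)\,\varepsilon(x_p^k,\,x_p^{k+1}+\dots+x_p^{n-1}+z)\\&\qquad\cdot\rho(\alpha^{p-1}x_p^1,\dots,\widehat{\alpha^{p-1}x_p^k},\dots,\alpha^{p-1}x_p^{n-1},\alpha^{p-1}z)\,\varphi(X_1,\dots,X_{p-1},x_p^k).\end{aligned}$$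 Then, for every $p\ge1$, $\delta^p$ maps $C^p_{\alpha,\mu}(\mathfrak g,M)$ into $C^{p+1}_{\alpha,\mu}(\mathfrak g,M)$ (preserving the degree), and $\delta^{p+1}(\delta^p\varphi)=0$ for all $\varphi\in C^p_{\alpha,\mu}(\mathfrak g,M)$. Consequently, with $Z^p=\{\varphi\in C^p_{\alpha,\mu}(\mathfrak g,M):\delta^p\varphi=0\}$, $B^1=0$ and $B^p=\delta^{p-1}(C^{p-1}_{\alpha,\mu}(\mathfrak g,M))$ for $p\ge2$, one has $B^p\subseteq Z^p$, so that the cohomology $H^p_{\alpha,\mu}(\mathfrak g,M)=Z^p/B^p$ is defined. -/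

import Mathlib

open scoped DirectSum

/-- A bicharacter (commutation factor) on the abelian group `Γ` with values in `K \ {0}`. -/
structure Bicharacter (Γ K : Type*) [AddCommGroup Γ] [Field K] where
  /-- the underlying map `Γ × Γ → K \ {0}` -/
  toFun : Γ → Γ → Kˣ
  mul_swap : ∀ a b, toFun a b * toFun b a = 1
  map_add_right : ∀ a b c, toFun a (b + c) = toFun a b * toFun a c
  map_add_left : ∀ a b c, toFun (a + b) c = toFun a c * toFun b c

instance {Γ K : Type*} [AddCommGroup Γ] [Field K] :
    CoeFun (Bicharacter Γ K) (fun _ => Γ → Γ → K) :=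
  ⟨fun ε a b => ((ε.toFun a b : Kˣ) : K)⟩

/-- `ε`-skew-symmetry of a map in `k` variables from a graded space: interchanging two adjacent
homogeneous arguments `x_i, x_j` (`j = i + 1`) multiplies the value by `-ε(x_i, x_j)`. -/
def IsColorSkew {Γ K g N : Type*} [AddCommGroup Γ] [Field K] [AddCommGroup g] [Module K g]
    [AddCommGroup N] [Module K N] (ε : Bicharacter Γ K) (𝒢 : Γ → Submodule K g) {k : ℕ}
    (f : (Fin k → g) → N) : Prop :=
  ∀ i j : Fin k, (j : ℕ) = (i : ℕ) + 1 →
    ∀ (d : Fin k → Γ) (x : Fin k → g), (∀ t, x t ∈ 𝒢 (d t)) →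
      f x = -(ε (d i) (d j) • f (x ∘ Equiv.swap i j))

/-- An `n`-Hom-Lie color algebra with `n = r + 2`, on the `Γ`-graded vector space `g = ⨁ 𝒢 γ`. -/
structure NHomLieColorAlgebra {Γ : Type*} (K : Type*) {g : Type*} [AddCommGroup Γ] [Field K]
    [AddCommGroup g] [Module K g] (𝒢 : Γ → Submodule K g) (r : ℕ) where
  /-- the bicharacter -/
  ε : Bicharacter Γ K
  /-- the `n`-ary bracket -/
  bracket : MultilinearMap K (fun _ : Fin (r + 2) => g) g
  /-- the twist map -/
  α : g →ₗ[K] g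
  bracket_mem : ∀ (d : Fin (r + 2) → Γ) (x : Fin (r + 2) → g), (∀ t, x t ∈ 𝒢 (d t)) →
    bracket x ∈ 𝒢 (∑ t, d t)
  α_mem : ∀ (γ : Γ) (x : g), x ∈ 𝒢 γ → α x ∈ 𝒢 γ
  skew : IsColorSkew ε 𝒢 (fun x => bracket x)
  /-- the `ε`-`n`-Hom-Jacobi identity -/
  jacobi : ∀ (d : Fin (r + 1) → Γ) (e : Fin (r + 2) → Γ)
    (x : Fin (r + 1) → g) (y : Fin (r + 2) → g),
    (∀ t, x t ∈ 𝒢 (d t)) → (∀ t, y t ∈ 𝒢 (e t)) →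
      bracket (Fin.snoc (fun t => α (x t)) (bracket y)) =
        ∑ i, ε (∑ t, d t) (∑ t ∈ Finset.Iio i, e t) •
          bracket (Function.update (fun t => α (y t)) i (bracket (Fin.snoc x (y i))))

namespace NHomLieColorAlgebra

variable {Γ K g M : Type*} [AddCommGroup Γ] [Field K] [AddCommGroup g] [Module K g]
  [AddCommGroup M] [Module K M] {𝒢 : Γ → Submodule K g} {r : ℕ}

/-- Multiplicativity: the twist map is a morphism of the bracket. -/
def IsMultiplicative (A : NHomLieColorAlgebra K 𝒢 r) : Prop :=
  ∀ x : Fin (r + 2) → g, A.α (A.bracket x) = A.bracket (fun t => A.α (x t))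

/-- The adjoint map `ad_X y = [x_1, …, x_{n-1}, y]` of `X = x_1 ∧ ⋯ ∧ x_{n-1}`. -/
def ad (A : NHomLieColorAlgebra K 𝒢 r) (X : Fin (r + 1) → g) (y : g) : g :=
  A.bracket (Fin.snoc X y)

/-- The map `α̃ (x_1 ∧ ⋯ ∧ x_{n-1}) = α x_1 ∧ ⋯ ∧ α x_{n-1}`. -/
def tw (A : NHomLieColorAlgebra K 𝒢 r) (X : Fin (r + 1) → g) : Fin (r + 1) → g :=
  fun t => A.α (X t)

/-- The value `f([X, Y]_α)` of an `ε`-skew-symmetric multilinear map `f` (a linear map on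
`⋀^{n-1} g`) at the bracket of fundamental objects
`[X, Y]_α = ∑_k ε(X, y_1 + ⋯ + y_{k-1}) α y_1 ∧ ⋯ ∧ α y_{k-1} ∧ ad_X y_k ∧ α y_{k+1} ∧ ⋯`,
where `X` and `Y` have homogeneous entries of degrees `d` and `e`. -/
def evalBracket (A : NHomLieColorAlgebra K 𝒢 r) (f : (Fin (r + 1) → g) → M)
    (d e : Fin (r + 1) → Γ) (X Y : Fin (r + 1) → g) : M :=
  ∑ k, A.ε (∑ t, d t) (∑ t ∈ Finset.Iio k, e t) • f (Function.update (A.tw Y) k (A.ad X (Y k)))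

end NHomLieColorAlgebra

/-- A representation `(M, ρ, μ)` of an `n`-Hom-Lie color algebra (`n = r + 2`) on the graded
space `M = ⨁ ℳ γ`. -/
structure NHomLieColorAlgebra.Representation {Γ K g M : Type*} [AddCommGroup Γ] [Field K]
    [AddCommGroup g] [Module K g] [AddCommGroup M] [Module K M] {𝒢 : Γ → Submodule K g} {r : ℕ}
    (A : NHomLieColorAlgebra K 𝒢 r) (ℳ : Γ → Submodule K M) where
  /-- the action of fundamental objects -/
  ρ : MultilinearMap K (fun _ : Fin (r + 1) => g) (Module.End K M)
  /-- the twist of `M` -/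
  μ : Module.End K M
  ρ_mem : ∀ (d : Fin (r + 1) → Γ) (X : Fin (r + 1) → g) (γ : Γ) (m : M),
    (∀ t, X t ∈ 𝒢 (d t)) → m ∈ ℳ γ → ρ X m ∈ ℳ (∑ t, d t + γ)
  skew : IsColorSkew A.ε 𝒢 (fun X => ρ X)
  twist : ∀ X : Fin (r + 1) → g, ρ (A.tw X) ∘ₗ μ = μ ∘ₗ ρ X
  rep_one : ∀ (d e : Fin (r + 1) → Γ) (X Y : Fin (r + 1) → g),
    (∀ t, X t ∈ 𝒢 (d t)) → (∀ t, Y t ∈ 𝒢 (e t)) →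
      ρ (A.tw X) ∘ₗ ρ Y - A.ε (∑ t, d t) (∑ t, e t) • (ρ (A.tw Y) ∘ₗ ρ X) =
        A.evalBracket (fun Z => ρ Z) d e X Y ∘ₗ μ
  /-- Here `x = (x_1, …, x_n)`, `y = (y_1, …, y_{n-2})`, and the sign `(-1)^{n-i}` is
  `(-1)^(r + 1 - i)` for the index `i` starting from `0`. -/
  rep_two : ∀ (d : Fin (r + 2) → Γ) (e : Fin r → Γ) (x : Fin (r + 2) → g) (y : Fin r → g),
    (∀ t, x t ∈ 𝒢 (d t)) → (∀ t, y t ∈ 𝒢 (e t)) →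
      ρ (Fin.cons (A.bracket x) (fun t => A.α (y t))) ∘ₗ μ =
        ∑ i : Fin (r + 2), ((-1 : K) ^ (r + 1 - (i : ℕ)) *
            A.ε (d i) (∑ t ∈ Finset.Ioi i, d t)) •
          (ρ (i.removeNth (fun t => A.α (x t))) ∘ₗ ρ (Fin.cons (x i) y))

namespace NHomLieColorAlgebra

variable {Γ K g M : Type*} [AddCommGroup Γ] [Field K] [AddCommGroup g] [Module K g]
  [AddCommGroup M] [Module K M] {𝒢 : Γ → Submodule K g} {ℳ : Γ → Submodule K M} {r : ℕ}
  {A : NHomLieColorAlgebra K 𝒢 r}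

/-- `Pre g M r q` is the space of all maps `φ(X_1, …, X_q, z)` with values in `M`, where each
`X_i = (x_i^1, …, x_i^{n-1})`, `n = r + 2`, and `z` is an element of `g`. The `p`-cochains live
in `Pre g M r (p - 1)`. -/
abbrev Pre (g M : Type*) (r q : ℕ) : Type _ := (Fin q → Fin (r + 1) → g) → g → M

/-- `φ` is a `(q+1)`-cochain, homogeneous of degree `ξ`. Being `ε`-skew-symmetric on
`L(g)^{⊗ q} ∧ g`, `L(g) = ⋀^{n-1} g`, means skew-symmetry in the entries of every `X_i`, and in
the `n` last variables, the entries of `X_q` together with `z`. -/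
structure IsCochain (R : A.Representation ℳ) (q : ℕ) (ξ : Γ) (φ : Pre g M r q) : Prop where
  linear_block : ∀ (X : Fin q → Fin (r + 1) → g) (i : Fin q) (j : Fin (r + 1)) (z : g),
    IsLinearMap K fun x : g => φ (Function.update X i (Function.update (X i) j x)) z
  linear_last : ∀ X : Fin q → Fin (r + 1) → g, IsLinearMap K (φ X)
  degree : ∀ (D : Fin q → Fin (r + 1) → Γ) (e : Γ) (X : Fin q → Fin (r + 1) → g) (z : g),
    (∀ i t, X i t ∈ 𝒢 (D i t)) → z ∈ 𝒢 e → φ X z ∈ ℳ (ξ + ∑ i, ∑ t, D i t + e)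
  skew_block : ∀ (X : Fin q → Fin (r + 1) → g) (i : Fin q) (z : g),
    IsColorSkew A.ε 𝒢 fun Y : Fin (r + 1) → g => φ (Function.update X i Y) z
  skew_last : ∀ (X : Fin q → Fin (r + 1) → g) (i : Fin q), (i : ℕ) + 1 = q →
    IsColorSkew A.ε 𝒢 fun y : Fin (r + 2) → g =>
      φ (Function.update X i (Fin.init y)) (y (Fin.last (r + 1)))
  compat : ∀ (X : Fin q → Fin (r + 1) → g) (z : g),
    R.μ (φ X z) = φ (fun i => A.tw (X i)) (A.α z)

/-- The space of `(q+1)`-cochains that are homogeneous of degree `ξ`. -/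
def homCochains (R : A.Representation ℳ) (q : ℕ) (ξ : Γ) : Submodule K (Pre g M r q) where
  carrier := {φ | IsCochain R q ξ φ}
  zero_mem' :=
    { linear_block := fun _ _ _ _ => ⟨fun _ _ => by simp, fun _ _ => by simp⟩
      linear_last := fun _ => ⟨fun _ _ => by simp, fun _ _ => by simp⟩
      degree := fun _ _ _ _ _ _ => by simp
      skew_block := fun _ _ _ _ _ _ _ _ _ => by simp
      skew_last := fun _ _ _ _ _ _ _ _ _ => by simp
      compat := fun _ _ => by simp }
  add_mem' := fun {φ ψ} h h' =>
    { linear_block := fun X i j z =>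
        ⟨fun a b => by
          simp only [Pi.add_apply, (h.linear_block X i j z).map_add,
            (h'.linear_block X i j z).map_add]; abel,
         fun c a => by
          simp only [Pi.add_apply, (h.linear_block X i j z).map_smul,
            (h'.linear_block X i j z).map_smul, smul_add]⟩
      linear_last := fun X =>
        ⟨fun a b => by
          simp only [Pi.add_apply, (h.linear_last X).map_add, (h'.linear_last X).map_add]; abel,
         fun c a => by
          simp only [Pi.add_apply, (h.linear_last X).map_smul, (h'.linear_last X).map_smul,
            smul_add]⟩
      degree := fun D e X z hX hz => add_mem (h.degree D e X z hX hz) (h'.degree D e X z hX hz)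
      skew_block := fun X i z a b hab d x hx => by
        have h1 := h.skew_block X i z a b hab d x hx
        have h2 := h'.skew_block X i z a b hab d x hx
        simp only [Pi.add_apply, smul_add, neg_add] at h1 h2 ⊢
        rw [h1, h2]
      skew_last := fun X i hi a b hab d x hx => by
        have h1 := h.skew_last X i hi a b hab d x hx
        have h2 := h'.skew_last X i hi a b hab d x hx
        simp only [Pi.add_apply, smul_add, neg_add] at h1 h2 ⊢
        rw [h1, h2]
      compat := fun X z => by
        simp only [Pi.add_apply, map_add, h.compat X z, h'.compat X z] }
  smul_mem' := fun c φ h =>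
    { linear_block := fun X i j z =>
        ⟨fun a b => by
          simp only [Pi.smul_apply, (h.linear_block X i j z).map_add, smul_add],
         fun c' a => by
          simp only [Pi.smul_apply, (h.linear_block X i j z).map_smul, smul_comm c c']⟩
      linear_last := fun X =>
        ⟨fun a b => by simp only [Pi.smul_apply, (h.linear_last X).map_add, smul_add],
         fun c' a => by
          simp only [Pi.smul_apply, (h.linear_last X).map_smul, smul_comm c c']⟩
      degree := fun D e X z hX hz => Submodule.smul_mem _ _ (h.degree D e X z hX hz)
      skew_block := fun X i z a b hab d x hx => by
        have h1 := h.skew_block X i z a b hab d x hx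
        simp only [Pi.smul_apply] at h1 ⊢
        rw [h1, smul_neg, smul_comm]
      skew_last := fun X i hi a b hab d x hx => by
        have h1 := h.skew_last X i hi a b hab d x hx
        simp only [Pi.smul_apply] at h1 ⊢
        rw [h1, smul_neg, smul_comm]
      compat := fun X z => by simp only [Pi.smul_apply, map_smul, h.compat X z] }

/-- The graded space `⨁_ξ C_ξ` of all `(q+1)`-cochains, as the space of the finitely supported
families `(φ_ξ)` with `φ_ξ` a cochain of degree `ξ`. -/
def cochains (R : A.Representation ℳ) (q : ℕ) : Submodule K (⨁ _ξ : Γ, Pre g M r q) where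
  carrier := {φ | ∀ ξ, φ ξ ∈ homCochains R q ξ}
  zero_mem' := fun ξ => (homCochains R q ξ).zero_mem
  add_mem' := fun h h' ξ => (homCochains R q ξ).add_mem (h ξ) (h' ξ)
  smul_mem' := fun c _ h ξ => (homCochains R q ξ).smul_mem c (h ξ)

/-- The defining formula of `(δ^p φ)(X_1, …, X_p, z)`, `p = q + 1`, for `φ` of degree `ξ`, for
`X_i` with homogeneous entries of degrees `D i t` and `z` homogeneous of degree `e`.
All indices start from `0`, so that the index `i` here is `i + 1` in the usual formula.
In the last sum, `(-1)^{p+1} (-1)^{n-k}` becomes `(-1)^q (-1)^(r + 1 - k)`, and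
`Fin.snoc (k.removeNth X_p) z` is `(x_p^1, …, x_p^k omitted, …, x_p^{n-1}, z)`. -/
def coboundaryFormula (R : A.Representation ℳ) (q : ℕ) (ξ : Γ) (φ : Pre g M r q)
    (D : Fin (q + 1) → Fin (r + 1) → Γ) (e : Γ)
    (X : Fin (q + 1) → Fin (r + 1) → g) (z : g) : M :=
  (∑ i : Fin (q + 1), ∑ j ∈ Finset.Ioi i,
      ((-1 : K) ^ ((i : ℕ) + 1) *
          A.ε (∑ t, D i t) (∑ k ∈ Finset.Ioo i j, ∑ t, D k t)) •
        A.evalBracket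
          (fun Z => φ (i.removeNth (Function.update (fun k => A.tw (X k)) j Z)) (A.α z))
          (D i) (D j) (X i) (X j))
  + (∑ i : Fin (q + 1),
      ((-1 : K) ^ ((i : ℕ) + 1) *
          A.ε (∑ t, D i t) (∑ k ∈ Finset.Ioi i, ∑ t, D k t)) •
        φ (i.removeNth (fun k => A.tw (X k))) (A.ad (X i) z))
  + (∑ i : Fin (q + 1),
      ((-1 : K) ^ (i : ℕ) *
          A.ε (ξ + ∑ k ∈ Finset.Iio i, ∑ t, D k t) (∑ t, D i t)) •
        R.ρ (A.tw^[q] (X i)) (φ (i.removeNth X) z))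
  + (-1 : K) ^ q • ∑ k : Fin (r + 1),
      ((-1 : K) ^ (r + 1 - (k : ℕ)) *
          A.ε (ξ + ∑ i : Fin q, ∑ t, D i.castSucc t)
            (∑ t ∈ Finset.univ.erase k, D (Fin.last q) t + e) *
          A.ε (D (Fin.last q) k) (∑ t ∈ Finset.Ioi k, D (Fin.last q) t + e)) •
        R.ρ (A.tw^[q] (Fin.snoc (k.removeNth (X (Fin.last q))) z))
          (φ (Fin.init X) (X (Fin.last q) k))

section

variable [DecidableEq Γ] [DirectSum.Decomposition 𝒢]

/-- The homogeneous component of degree `γ` of `x`. -/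
def comp (𝒢 : Γ → Submodule K g) [DirectSum.Decomposition 𝒢] (γ : Γ) (x : g) : g :=
  (DirectSum.decompose 𝒢 x γ : g)

open Classical in
/-- The finite set of the degrees of the nonzero homogeneous components of `x`. -/
noncomputable def degrees (𝒢 : Γ → Submodule K g) [DirectSum.Decomposition 𝒢] (x : g) :
    Finset Γ :=
  (DirectSum.decompose 𝒢 x).support

/-- The operator `δ^p`, `p = q + 1`, on maps of degree `ξ`: it is given by `coboundaryFormula`
on homogeneous arguments, and on arbitrary ones by expanding every argument into its homogeneous
components. -/
noncomputable def homCoboundary (R : A.Representation ℳ) (q : ℕ) (ξ : Γ) :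
    Pre g M r q →ₗ[K] Pre g M r (q + 1) where
  toFun φ X z :=
    ∑ D ∈ Fintype.piFinset fun i => Fintype.piFinset fun t => degrees 𝒢 (X i t),
      ∑ e ∈ degrees 𝒢 z,
        coboundaryFormula R q ξ φ D e (fun i t => comp 𝒢 (D i t) (X i t)) (comp 𝒢 e z)
  map_add' φ ψ := by
    funext X z
    simp only [Pi.add_apply, ← Finset.sum_add_distrib]
    refine Finset.sum_congr rfl fun D _ => Finset.sum_congr rfl fun e _ => ?_
    simp only [coboundaryFormula, evalBracket, Pi.add_apply, map_add, smul_add,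
      Finset.sum_add_distrib]
    abel
  map_smul' c φ := by
    funext X z
    simp only [Pi.smul_apply, Finset.smul_sum, RingHom.id_apply]
    refine Finset.sum_congr rfl fun D _ => Finset.sum_congr rfl fun e _ => ?_
    simp only [coboundaryFormula, evalBracket, Pi.smul_apply, map_smul, smul_add,
      Finset.smul_sum, smul_comm c]

/-- The coboundary operator `δ^p`, `p = q + 1`, on `⨁_ξ`, acting degree by degree. -/
noncomputable def coboundary (R : A.Representation ℳ) (q : ℕ) :
    (⨁ _ξ : Γ, Pre g M r q) →ₗ[K] (⨁ _ξ : Γ, Pre g M r (q + 1)) :=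
  DirectSum.lmap fun ξ => homCoboundary R q ξ

/-- The space `Z^p` of `p`-cocycles, `p = q + 1`. -/
noncomputable def cocycles (R : A.Representation ℳ) (q : ℕ) :
    Submodule K (⨁ _ξ : Γ, Pre g M r q) :=
  cochains R q ⊓ LinearMap.ker (coboundary R q)

/-- The space `B^p = δ^{p-1}(C^{p-1})` of `p`-coboundaries, `p = q + 1`; there are no cochains
below `p = 1`, so `B^1 = 0`. -/
noncomputable def coboundaries (R : A.Representation ℳ) :
    (q : ℕ) → Submodule K (⨁ _ξ : Γ, Pre g M r q)
  | 0 => ⊥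
  | q + 1 => (cochains R q).map (coboundary R q)

end

end NHomLieColorAlgebra

/-!
The idea is to write the coboundary by Cartan's formula, so that `δ ∘ δ = 0` becomes a formal
consequence of two commutation rules, instead of a cancellation of many kinds of terms.

*Words.* On homogeneous arguments a cochain `φ(X_1, …, X_q, z)` is a function of a word, the list of
the entries of `X_1, …, X_q, z`. A fundamental object `X = (x_1, …, x_{n-1})` acts on words as a
twisted `ε`-derivation (`der`), applying `ad_X` to one letter and `α` to all the others. The
`n`-Hom-Jacobi identity says that these derivations satisfy a twisted Leibniz identity
(`IsMultiplicative.der_der`).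

*Sequences.* The contraction `ι_X φ = φ(X, ⋯)` of a cochain is no longer compatible with the twist
maps, since `μ (φ(X, w)) = φ(α̃ X, α w)`. Therefore the objects are sequences `F_0, F_1, …` of maps
on words with `μ (F_k w) = F_{k+1} (α w)` (`IsTwistedSeq`); a cochain is a constant sequence, and
`(ι_X F)_k = F_k (α̃^k X, ⋯)`. The Lie derivative of a sequence of degree `ξ` is
`L_X F (w) = ε(ξ, X) ρ(α̃^a X) F_0(w) - (X · F_1)(w)`, and the coboundary `cobd` is defined by
recursion on the number of blocks by `ι_X d F = L_X F - d ι_X F`. By `coboundaryFormula_eq_cobd`,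
this is the given formula when all the arguments are homogeneous.

*Square zero.* The first identity of a representation and the Leibniz identity give the commutation
of Lie derivatives (`lie_lieSeq`), and then that of `L_X` with `d` (`lie_cobdSeq`), by induction on
the number of blocks. Hence `ι_X d d F = L_X d F - d L_X F + d d ι_X F = d d ι_X F`, and induction
reduces `d d = 0` (`cobd_cobdSeq`) to maps in one variable. For those, `ι_X d F` is `L_X F` plus
summands `ρ(x_1, …, x̂_i, …, x_{n-1}, z) F(x_i)`, and `d` kills these by the second identity of a
representation (`cobd_tailSeq`).

*Cochains.* Multilinearity, degree, compatibility with the twists and skew-symmetry of `δφ` on words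
follow by induction from the recursion. On arbitrary arguments `δφ` is the sum of its values at the
homogeneous components, so that it is multilinear, and identities between multilinear maps extend
from homogeneous to arbitrary arguments (`pre_induction`).
-/

/-! ### Bicharacters, words of homogeneous elements -/

namespace Bicharacter

variable {Γ K : Type*} [AddCommGroup Γ] [Field K] (ε : Bicharacter Γ K)

/-- The value of a bicharacter as an element of `K`. -/
def app (a b : Γ) : K := (ε.toFun a b : Kˣ)

theorem add_left (a b c : Γ) : ε.app (a + b) c = ε.app a c * ε.app b c := by
  simp only [app, ε.map_add_left, Units.val_mul]

theorem add_right (a b c : Γ) : ε.app a (b + c) = ε.app a b * ε.app a c := by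
  simp only [app, ε.map_add_right, Units.val_mul]

theorem app_ne_zero (a b : Γ) : ε.app a b ≠ 0 := (ε.toFun a b).ne_zero

theorem swap_mul (a b : Γ) : ε.app a b * ε.app b a = 1 := by
  simp only [app, ← Units.val_mul, ε.mul_swap, Units.val_one]

theorem zero_right (a : Γ) : ε.app a 0 = 1 := by
  have h := ε.add_right a 0 0
  rw [add_zero] at h
  exact (mul_eq_left₀ (ε.app_ne_zero a 0)).1 h.symm

theorem zero_left (a : Γ) : ε.app 0 a = 1 := by
  have h := ε.add_left 0 0 a
  rw [add_zero] at h
  exact (mul_eq_left₀ (ε.app_ne_zero 0 a)).1 h.symm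

end Bicharacter

/-- A homogeneous element of the graded space `⨁ 𝒢 γ`, together with a chosen degree (so that `0`
occurs once in every degree). -/
@[ext]
structure HomElt {Γ K g : Type*} [Field K] [AddCommGroup g] [Module K g]
    (𝒢 : Γ → Submodule K g) where
  /-- the degree -/
  deg : Γ
  /-- the underlying element -/
  val : g
  mem : val ∈ 𝒢 deg

namespace HomElt

variable {Γ K g : Type*} [AddCommGroup Γ] [Field K] [AddCommGroup g] [Module K g]
  {𝒢 : Γ → Submodule K g}

instance : Inhabited (HomElt 𝒢) := ⟨⟨0, 0, zero_mem _⟩⟩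

/-- The total degree of a tuple of homogeneous elements. -/
def tdeg {m : ℕ} (X : Fin m → HomElt 𝒢) : Γ := ∑ t, (X t).deg

/-- The underlying tuple of elements. -/
def vals {m : ℕ} (X : Fin m → HomElt 𝒢) (t : Fin m) : g := (X t).val

/-- The total degree of a word of homogeneous elements. -/
def wdeg (w : List (HomElt 𝒢)) : Γ := (w.map HomElt.deg).sum

@[simp] theorem wdeg_nil : wdeg ([] : List (HomElt 𝒢)) = 0 := rfl

@[simp] theorem wdeg_cons (y : HomElt 𝒢) (w : List (HomElt 𝒢)) :
    wdeg (y :: w) = y.deg + wdeg w := by simp [wdeg]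

@[simp] theorem wdeg_append (u w : List (HomElt 𝒢)) : wdeg (u ++ w) = wdeg u + wdeg w := by
  simp [wdeg]

@[simp] theorem wdeg_ofFn {m : ℕ} (X : Fin m → HomElt 𝒢) : wdeg (List.ofFn X) = tdeg X := by
  simp [wdeg, tdeg, List.sum_ofFn, List.map_ofFn]

/-- The tuple of the first `m` letters of a word, padded by `0` if the word is shorter. -/
def tup (m : ℕ) (w : List (HomElt 𝒢)) : Fin m → HomElt 𝒢 := fun i => w.getD i default

theorem tup_append {m : ℕ} (X : Fin m → HomElt 𝒢) (w : List (HomElt 𝒢)) :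
    tup m (List.ofFn X ++ w) = X := by
  funext i
  rw [tup, List.getD_append _ _ _ _ (by simp)]
  simp

theorem tup_ofFn {m : ℕ} (X : Fin m → HomElt 𝒢) : tup m (List.ofFn X) = X := by
  simpa using tup_append X []

omit [AddCommGroup Γ] in
theorem drop_ofFn_append {m : ℕ} (X : Fin m → HomElt 𝒢) (w : List (HomElt 𝒢)) :
    (List.ofFn X ++ w).drop m = w := by
  simp

omit [AddCommGroup Γ] in
theorem exists_ofFn_append {m : ℕ} (w : List (HomElt 𝒢)) (h : m ≤ w.length) :
    ∃ X : Fin m → HomElt 𝒢, ∃ w', w = List.ofFn X ++ w' := by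
  refine ⟨fun i => w[i], w.drop m, ?_⟩
  apply List.ext_getElem
  · simp; omega
  · intro i h1 h2
    by_cases hi : i < m
    · rw [List.getElem_append_left (by simpa using hi)]; simp
    · rw [List.getElem_append_right (by simpa using hi)]; simp
      congr 1; omega

omit [AddCommGroup Γ] in
theorem exists_ofFn {m : ℕ} (w : List (HomElt 𝒢)) (h : w.length = m) :
    ∃ X : Fin m → HomElt 𝒢, w = List.ofFn X := by
  obtain ⟨X, w', rfl⟩ := exists_ofFn_append w h.ge
  have : w' = [] := by simpa using h
  exact ⟨X, by simp [this]⟩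

end HomElt

/-! ### Maps on words that are linear in every letter -/

/-- `F` is linear in every letter of a word of length `N`, among the letters of one degree. -/
structure WordLinear {Γ K g M : Type*} [Field K] [AddCommGroup g] [Module K g]
    [AddCommGroup M] [Module K M] {𝒢 : Γ → Submodule K g} (N : ℕ)
    (F : List (HomElt 𝒢) → M) : Prop where
  add : ∀ (u v : List (HomElt 𝒢)) (a b c : HomElt 𝒢), u.length + v.length + 1 = N →
    a.deg = c.deg → b.deg = c.deg → c.val = a.val + b.val →
    F (u ++ c :: v) = F (u ++ a :: v) + F (u ++ b :: v)
  smul : ∀ (u v : List (HomElt 𝒢)) (k : K) (a c : HomElt 𝒢), u.length + v.length + 1 = N →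
    a.deg = c.deg → c.val = k • a.val → F (u ++ c :: v) = k • F (u ++ a :: v)

namespace WordLinear

variable {Γ K g M : Type*} [Field K] [AddCommGroup g] [Module K g]
    [AddCommGroup M] [Module K M] {𝒢 : Γ → Submodule K g} {N : ℕ} {F : List (HomElt 𝒢) → M}

theorem eq_zero (hF : WordLinear N F) (u v : List (HomElt 𝒢)) (c : HomElt 𝒢)
    (hl : u.length + v.length + 1 = N) (hc : c.val = 0) : F (u ++ c :: v) = 0 := by
  rw [hF.smul u v 0 c c hl rfl (by simp [hc]), zero_smul]

/-- Expansion of a letter into a linear combination of letters of the same degree. -/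
theorem sum (hF : WordLinear N F) (u v : List (HomElt 𝒢)) (hl : u.length + v.length + 1 = N)
    {ι : Type*} (s : Finset ι) (k : ι → K) (h : ι → HomElt 𝒢) (c : HomElt 𝒢)
    (hd : ∀ i ∈ s, (h i).deg = c.deg) (hc : c.val = ∑ i ∈ s, k i • (h i).val) :
    F (u ++ c :: v) = ∑ i ∈ s, k i • F (u ++ h i :: v) := by
  classical
  induction s using Finset.induction_on generalizing c with
  | empty => simpa using hF.eq_zero u v c hl (by simpa using hc)
  | insert i s hi ih =>
    have hd' : ∀ j ∈ s, (h j).deg = c.deg := fun j hj => hd j (Finset.mem_insert_of_mem hj)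
    have hm : ∑ j ∈ s, k j • (h j).val ∈ 𝒢 c.deg :=
      Submodule.sum_mem _ fun j hj => Submodule.smul_mem _ _ (hd' j hj ▸ (h j).mem)
    have hi' : (h i).deg = c.deg := hd i (Finset.mem_insert_self _ _)
    have hm' : k i • (h i).val ∈ 𝒢 c.deg := Submodule.smul_mem _ _ (hi' ▸ (h i).mem)
    rw [Finset.sum_insert hi] at hc ⊢
    rw [hF.add u v ⟨c.deg, _, hm'⟩ ⟨c.deg, _, hm⟩ c hl rfl rfl hc,
      ih ⟨c.deg, _, hm⟩ hd' rfl, hF.smul u v (k i) (h i) ⟨c.deg, _, hm'⟩ hl hi' rfl]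

theorem append {X : List (HomElt 𝒢)} (hF : WordLinear (X.length + N) F) :
    WordLinear N fun w => F (X ++ w) where
  add u v a b c hl h1 h2 h3 := by
    simpa using hF.add (X ++ u) v a b c (by simp; omega) h1 h2 h3
  smul u v k a c hl h1 h2 := by
    simpa using hF.smul (X ++ u) v k a c (by simp; omega) h1 h2

theorem comb (hF : WordLinear N F) (u v : List (HomElt 𝒢))
    (hl : u.length + v.length + 1 = N) (s t : K) (a b c : HomElt 𝒢) (ha : a.deg = c.deg)
    (hb : b.deg = c.deg) (hc : c.val = s • a.val + t • b.val) :
    F (u ++ c :: v) = s • F (u ++ a :: v) + t • F (u ++ b :: v) := by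
  have h := hF.sum u v hl Finset.univ ![s, t] ![a, b] c
    (by intro i _; fin_cases i <;> simp [ha, hb]) (by simp [hc])
  simpa using h

theorem of_comb (h : ∀ (u v : List (HomElt 𝒢)) (s t : K) (a b c : HomElt 𝒢),
    u.length + v.length + 1 = N → a.deg = c.deg → b.deg = c.deg →
    c.val = s • a.val + t • b.val →
    F (u ++ c :: v) = s • F (u ++ a :: v) + t • F (u ++ b :: v)) : WordLinear N F where
  add u v a b c hl ha hb hc := by
    simpa using h u v 1 1 a b c hl ha hb (by simpa using hc)
  smul u v k a c hl ha hc := by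
    simpa using h u v k 0 a a c hl ha ha (by simpa using hc)

end WordLinear

namespace NHomLieColorAlgebra

open HomElt

section

variable {Γ K g M : Type*} [AddCommGroup Γ] [Field K] [AddCommGroup g] [Module K g]
  [AddCommGroup M] [Module K M] {𝒢 : Γ → Submodule K g} {ℳ : Γ → Submodule K M} {r : ℕ}

/-! ### Fundamental objects acting on words -/

/-- The twist map on homogeneous elements. -/
def twElt (A : NHomLieColorAlgebra K 𝒢 r) (y : HomElt 𝒢) : HomElt 𝒢 :=
  ⟨y.deg, A.α y.val, A.α_mem _ _ y.mem⟩

/-- The `k`-th power of the twist map on tuples of homogeneous elements. -/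
def twTup (A : NHomLieColorAlgebra K 𝒢 r) (k : ℕ) {m : ℕ} (X : Fin m → HomElt 𝒢) :
    Fin m → HomElt 𝒢 := fun t => A.twElt^[k] (X t)

/-- The bracket of homogeneous elements. -/
def brElt (A : NHomLieColorAlgebra K 𝒢 r) (y : Fin (r + 2) → HomElt 𝒢) : HomElt 𝒢 :=
  ⟨tdeg y, A.bracket (vals y), A.bracket_mem _ _ fun t => (y t).mem⟩

/-- The adjoint map `ad_X` on homogeneous elements. -/
def adElt (A : NHomLieColorAlgebra K 𝒢 r) (X : Fin (r + 1) → HomElt 𝒢) (y : HomElt 𝒢) :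
    HomElt 𝒢 :=
  ⟨tdeg X + y.deg, A.ad (vals X) y.val, by
    have h := (A.brElt (Fin.snoc X y)).mem
    have h1 : (A.brElt (Fin.snoc X y)).deg = tdeg X + y.deg := by
      simp [brElt, tdeg, Fin.sum_univ_castSucc]
    have h2 : vals (Fin.snoc X y : Fin (r + 2) → HomElt 𝒢) = Fin.snoc (vals X) y.val := by
      funext t
      refine Fin.lastCases ?_ (fun i => ?_) t <;> simp [vals]
    rw [h1] at h
    simp only [brElt, h2] at h
    exact h⟩

/-- The `k`-th summand of the action of `X` on the tuple `Y`:
`(α y_1, …, α y_{k-1}, ad_X y_k, α y_{k+1}, …)`. -/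
def act (A : NHomLieColorAlgebra K 𝒢 r) (X : Fin (r + 1) → HomElt 𝒢) {m : ℕ}
    (Y : Fin m → HomElt 𝒢) (k : Fin m) : Fin m → HomElt 𝒢 :=
  Function.update (fun t => A.twElt (Y t)) k (A.adElt X (Y k))

/-- The value of `G` at the action of `X` on the tuple `Y`. -/
def evalAct (A : NHomLieColorAlgebra K 𝒢 r) (X : Fin (r + 1) → HomElt 𝒢) {m : ℕ}
    (Y : Fin m → HomElt 𝒢) (G : (Fin m → HomElt 𝒢) → M) : M :=
  ∑ k, A.ε.app (tdeg X) (∑ t ∈ Finset.Iio k, (Y t).deg) • G (A.act X Y k)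

/-- The value of `G` at the action of `X` on the word `w`, where `X` acts as a twisted
`ε`-derivation. -/
def der (A : NHomLieColorAlgebra K 𝒢 r) (M : Type*) [AddCommGroup M] [Module K M]
    (X : Fin (r + 1) → HomElt 𝒢) :
    List (HomElt 𝒢) → ((List (HomElt 𝒢) → M) →ₗ[K] M)
  | [] => 0
  | y :: w => LinearMap.proj (A.adElt X y :: w.map A.twElt) +
      A.ε.app (tdeg X) y.deg • (der A M X w ∘ₗ LinearMap.funLeft K M (fun w' => A.twElt y :: w'))

variable (A : NHomLieColorAlgebra K 𝒢 r)

@[simp] theorem twElt_deg (y : HomElt 𝒢) : (A.twElt y).deg = y.deg := rfl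

@[simp] theorem twElt_val (y : HomElt 𝒢) : (A.twElt y).val = A.α y.val := rfl

@[simp] theorem adElt_deg (X : Fin (r + 1) → HomElt 𝒢) (y : HomElt 𝒢) :
    (A.adElt X y).deg = tdeg X + y.deg := rfl

@[simp] theorem adElt_val (X : Fin (r + 1) → HomElt 𝒢) (y : HomElt 𝒢) :
    (A.adElt X y).val = A.ad (vals X) y.val := rfl

@[simp] theorem brElt_deg (y : Fin (r + 2) → HomElt 𝒢) : (A.brElt y).deg = tdeg y := rfl

@[simp] theorem brElt_val (y : Fin (r + 2) → HomElt 𝒢) :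
    (A.brElt y).val = A.bracket (vals y) := rfl

@[simp] theorem twElt_iterate_deg (k : ℕ) (y : HomElt 𝒢) : (A.twElt^[k] y).deg = y.deg := by
  induction k with
  | zero => rfl
  | succ k ih => rw [Function.iterate_succ_apply', twElt_deg, ih]

@[simp] theorem twTup_apply_deg (k : ℕ) {m : ℕ} (X : Fin m → HomElt 𝒢) (t : Fin m) :
    (A.twTup k X t).deg = (X t).deg := A.twElt_iterate_deg k (X t)

@[simp] theorem tdeg_twTup (k : ℕ) {m : ℕ} (X : Fin m → HomElt 𝒢) :
    tdeg (A.twTup k X) = tdeg X := by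
  simp [tdeg]

theorem twTup_zero {m : ℕ} (X : Fin m → HomElt 𝒢) : A.twTup 0 X = X := rfl

theorem twTup_twTup (k l : ℕ) {m : ℕ} (X : Fin m → HomElt 𝒢) :
    A.twTup k (A.twTup l X) = A.twTup (k + l) X := by
  funext t
  simp [twTup, Function.iterate_add_apply]

theorem twTup_one {m : ℕ} (X : Fin m → HomElt 𝒢) : A.twTup 1 X = fun t => A.twElt (X t) := rfl

theorem map_twElt_ofFn {m : ℕ} (X : Fin m → HomElt 𝒢) :
    (List.ofFn X).map A.twElt = List.ofFn (A.twTup 1 X) := by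
  rw [List.map_ofFn]
  rfl

@[simp] theorem wdeg_map_twElt (w : List (HomElt 𝒢)) : wdeg (w.map A.twElt) = wdeg w := by
  induction w with
  | nil => rfl
  | cons y w ih => simp [ih]

theorem vals_twTup (k : ℕ) (X : Fin (r + 1) → HomElt 𝒢) :
    vals (A.twTup k X) = A.tw^[k] (vals X) := by
  induction k with
  | zero => rfl
  | succ k ih =>
    rw [Function.iterate_succ_apply', ← ih]
    funext t
    simp [vals, twTup, tw, Function.iterate_succ_apply']

theorem act_same (X : Fin (r + 1) → HomElt 𝒢) {m : ℕ} (Y : Fin m → HomElt 𝒢) (k : Fin m) :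
    A.act X Y k k = A.adElt X (Y k) := by simp [act]

theorem act_of_ne (X : Fin (r + 1) → HomElt 𝒢) {m : ℕ} (Y : Fin m → HomElt 𝒢) {k t : Fin m}
    (h : t ≠ k) : A.act X Y k t = A.twElt (Y t) := by simp [act, h]

@[simp] theorem tdeg_act (X : Fin (r + 1) → HomElt 𝒢) {m : ℕ} (Y : Fin m → HomElt 𝒢)
    (k : Fin m) : tdeg (A.act X Y k) = tdeg X + tdeg Y := by
  have h1 : ∀ t, (A.act X Y k t).deg = (if t = k then tdeg X else 0) + (Y t).deg := by
    intro t
    by_cases h : t = k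
    · subst h; simp [act_same]
    · simp [act_of_ne _ _ _ h, h]
  simp only [tdeg] at h1 ⊢
  simp [h1, Finset.sum_add_distrib]

theorem der_nil (X : Fin (r + 1) → HomElt 𝒢) (G : List (HomElt 𝒢) → M) :
    A.der M X [] G = 0 := rfl

theorem der_cons (X : Fin (r + 1) → HomElt 𝒢) (y : HomElt 𝒢) (w : List (HomElt 𝒢))
    (G : List (HomElt 𝒢) → M) :
    A.der M X (y :: w) G = G (A.adElt X y :: w.map A.twElt) +
      A.ε.app (tdeg X) y.deg • A.der M X w (fun w' => G (A.twElt y :: w')) := rfl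

theorem der_append (X : Fin (r + 1) → HomElt 𝒢) (u v : List (HomElt 𝒢))
    (G : List (HomElt 𝒢) → M) :
    A.der M X (u ++ v) G = A.der M X u (fun u' => G (u' ++ v.map A.twElt)) +
      A.ε.app (tdeg X) (wdeg u) • A.der M X v (fun v' => G (u.map A.twElt ++ v')) := by
  induction u generalizing G with
  | nil => simp [der_nil, Bicharacter.zero_right]
  | cons y u ih =>
    simp only [List.cons_append, der_cons, ih, List.map_append, List.map_cons, wdeg_cons,
      Bicharacter.add_right, smul_add, mul_smul]
    abel

theorem Iio_succ_eq {q : ℕ} (i : Fin q) :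
    Finset.Iio i.succ = Finset.cons 0 ((Finset.Iio i).map (Fin.succEmb q)) (by simp) := by
  ext t
  refine Fin.cases ?_ (fun i => ?_) t <;> simp

theorem evalAct_cons (X : Fin (r + 1) → HomElt 𝒢) {m : ℕ} (Y : Fin (m + 1) → HomElt 𝒢)
    (G : (Fin (m + 1) → HomElt 𝒢) → M) :
    A.evalAct X Y G = G (Fin.cons (A.adElt X (Y 0)) (A.twTup 1 (Fin.tail Y))) +
      A.ε.app (tdeg X) (Y 0).deg •
        A.evalAct X (Fin.tail Y) (fun U => G (Fin.cons (A.twElt (Y 0)) U)) := by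
  rw [evalAct, Fin.sum_univ_succ, evalAct, Finset.smul_sum]
  congr 1
  · have h1 : A.act X Y 0 = Fin.cons (A.adElt X (Y 0)) (A.twTup 1 (Fin.tail Y)) := by
      funext t
      refine Fin.cases ?_ (fun i => ?_) t
      · simp [act]
      · simp [act, twTup_one, Fin.tail]
    rw [h1, show (Finset.Iio (0 : Fin (m + 1))) = ∅ from by ext; simp]
    simp [Bicharacter.zero_right]
  · refine Finset.sum_congr rfl fun k _ => ?_
    have h1 : A.act X Y k.succ = Fin.cons (A.twElt (Y 0)) (A.act X (Fin.tail Y) k) := by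
      funext t
      refine Fin.cases ?_ (fun i => ?_) t
      · simp [act, (Fin.succ_ne_zero k).symm]
      · by_cases h : i = k
        · subst h; simp [act, Fin.tail]
        · simp [act, Fin.tail, h]
    rw [h1, Iio_succ_eq, Finset.sum_cons, Finset.sum_map, Bicharacter.add_right, mul_smul]
    rfl

theorem der_ofFn (X : Fin (r + 1) → HomElt 𝒢) {m : ℕ} (Y : Fin m → HomElt 𝒢)
    (G : List (HomElt 𝒢) → M) :
    A.der M X (List.ofFn Y) G = A.evalAct X Y (fun U => G (List.ofFn U)) := by
  induction m generalizing G with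
  | zero => simp [evalAct, der_nil]
  | succ m ih =>
    have ih' := ih (Fin.tail Y) (fun w' => G (A.twElt (Y 0) :: w'))
    rw [evalAct_cons, List.ofFn_succ, der_cons]
    simp only [List.ofFn_cons]
    rw [show (fun i : Fin m => Y i.succ) = Fin.tail Y from rfl, ih', map_twElt_ofFn]

theorem der_comp (X : Fin (r + 1) → HomElt 𝒢) (w : List (HomElt 𝒢)) (T : M →ₗ[K] M)
    (G : List (HomElt 𝒢) → M) : A.der M X w (fun w' => T (G w')) = T (A.der M X w G) := by
  induction w generalizing G with
  | nil => simp [der_nil]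
  | cons y w ih => simp only [der_cons, map_add, map_smul, ih]

theorem der_congr (X : Fin (r + 1) → HomElt 𝒢) (w : List (HomElt 𝒢))
    (G G' : List (HomElt 𝒢) → M) (h : ∀ w', w'.length = w.length → G w' = G' w') :
    A.der M X w G = A.der M X w G' := by
  induction w generalizing G G' with
  | nil => simp [der_nil]
  | cons y w ih =>
    rw [der_cons, der_cons, h _ (by simp), ih _ (fun w' => G' (A.twElt y :: w'))]
    intro w' hw'
    exact h _ (by simp [hw'])

/-! ### The identities of the algebra and of the representation on homogeneous elements -/

omit [AddCommGroup Γ] in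
theorem vals_snoc {m : ℕ} (X : Fin m → HomElt 𝒢) (y : HomElt 𝒢) :
    vals (Fin.snoc X y : Fin (m + 1) → HomElt 𝒢) = Fin.snoc (vals X) y.val := by
  funext t
  refine Fin.lastCases ?_ (fun i => ?_) t <;> simp [vals]

theorem tdeg_snoc {m : ℕ} (X : Fin m → HomElt 𝒢) (y : HomElt 𝒢) :
    tdeg (Fin.snoc X y : Fin (m + 1) → HomElt 𝒢) = tdeg X + y.deg := by
  simp [tdeg, Fin.sum_univ_castSucc]

theorem tdeg_eq_add_removeNth {m : ℕ} (k : Fin (m + 1)) (y : Fin (m + 1) → HomElt 𝒢) :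
    tdeg y = (y k).deg + tdeg (k.removeNth y) := by
  simp [tdeg, Fin.sum_univ_succAbove _ k, Fin.removeNth]

theorem brElt_snoc (X : Fin (r + 1) → HomElt 𝒢) (y : HomElt 𝒢) :
    A.brElt (Fin.snoc X y) = A.adElt X y := by
  ext
  · exact tdeg_snoc X y
  · rw [brElt_val, adElt_val, vals_snoc, ad]

section evalAct

variable (X : Fin (r + 1) → HomElt 𝒢) {m : ℕ} (Y : Fin m → HomElt 𝒢)
  (G G' : (Fin m → HomElt 𝒢) → M)

theorem evalAct_add : A.evalAct X Y (fun U => G U + G' U) = A.evalAct X Y G + A.evalAct X Y G' := by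
  simp [evalAct, Finset.sum_add_distrib]

theorem evalAct_sub : A.evalAct X Y (fun U => G U - G' U) = A.evalAct X Y G - A.evalAct X Y G' := by
  simp [evalAct, smul_sub]

theorem evalAct_neg : A.evalAct X Y (fun U => -G U) = -A.evalAct X Y G := by
  simp [evalAct]

theorem evalAct_map {M' : Type*} [AddCommGroup M'] [Module K M'] (T : M →ₗ[K] M') :
    A.evalAct X Y (fun U => T (G U)) = T (A.evalAct X Y G) := by
  simp [evalAct]

theorem evalAct_smul (c : K) : A.evalAct X Y (fun U => c • G U) = c • A.evalAct X Y G := by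
  simp [evalAct, Finset.smul_sum, smul_comm c]

theorem evalAct_congr (h : ∀ k, G (A.act X Y k) = G' (A.act X Y k)) :
    A.evalAct X Y G = A.evalAct X Y G' := by
  simp [evalAct, h]

theorem evalAct_snoc (z : HomElt 𝒢) (G : (Fin (m + 1) → HomElt 𝒢) → M) :
    A.evalAct X (Fin.snoc Y z) G = A.evalAct X Y (fun U => G (Fin.snoc U (A.twElt z))) +
      A.ε.app (tdeg X) (tdeg Y) • G (Fin.snoc (A.twTup 1 Y) (A.adElt X z)) := by
  rw [evalAct, Fin.sum_univ_castSucc, evalAct]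
  congr 1
  · refine Finset.sum_congr rfl fun k _ => ?_
    have h1 : A.act X (Fin.snoc Y z : Fin (m + 1) → HomElt 𝒢) k.castSucc =
        Fin.snoc (A.act X Y k) (A.twElt z) := by
      funext t
      refine Fin.lastCases ?_ (fun i => ?_) t
      · simp [act, (Fin.castSucc_lt_last k).ne']
      · by_cases h : i = k
        · subst h; simp [act]
        · simp [act, h]
    have h2 : Finset.Iio k.castSucc = (Finset.Iio k).map Fin.castSuccEmb := by
      ext t
      refine Fin.lastCases ?_ (fun i => ?_) t
      · simp
      · simp
    rw [h1, h2, Finset.sum_map]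
    simp
  · have h1 : A.act X (Fin.snoc Y z : Fin (m + 1) → HomElt 𝒢) (Fin.last m) =
        Fin.snoc (A.twTup 1 Y) (A.adElt X z) := by
      funext t
      refine Fin.lastCases ?_ (fun i => ?_) t
      · simp [act]
      · simp [act, (Fin.castSucc_lt_last i).ne, twTup_one]
    have h2 : Finset.Iio (Fin.last m) = Finset.univ.map Fin.castSuccEmb := by
      ext t
      refine Fin.lastCases ?_ (fun i => ?_) t
      · simp
      · simp
    rw [h1, h2, Finset.sum_map]
    simp [tdeg]

end evalAct

/-- On homogeneous entries, `f([X, Y]_α)` is the value of `f` at the action of `X` on `Y`. -/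
theorem evalBracket_vals (f : (Fin (r + 1) → g) → M) (X Y : Fin (r + 1) → HomElt 𝒢) :
    A.evalBracket f (fun t => (X t).deg) (fun t => (Y t).deg) (vals X) (vals Y) =
      A.evalAct X Y (fun U => f (vals U)) := by
  rw [evalBracket, evalAct]
  refine Finset.sum_congr rfl fun k _ => ?_
  have h : vals (A.act X Y k) = Function.update (A.tw (vals Y)) k (A.ad (vals X) (vals Y k)) := by
    funext t
    by_cases h : t = k
    · subst h; simp [vals, act]
    · simp [vals, act, h, tw]
  rw [h]
  rfl

/-- The `n`-Hom-Jacobi identity for homogeneous elements. -/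
theorem bracket_jacobi (X : Fin (r + 1) → HomElt 𝒢) (y : Fin (r + 2) → HomElt 𝒢) :
    (A.adElt (A.twTup 1 X) (A.brElt y)).val = A.evalAct X y (fun U => (A.brElt U).val) := by
  have h := A.jacobi (fun t => (X t).deg) (fun t => (y t).deg) (vals X) (vals y)
    (fun t => (X t).mem) (fun t => (y t).mem)
  rw [adElt_val, brElt_val, vals_twTup, ad]
  refine h.trans (Finset.sum_congr rfl fun k _ => ?_)
  have h : vals (A.act X y k) = Function.update (fun t => A.α (vals y t)) k
      (A.bracket (Fin.snoc (vals X) (vals y k))) := by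
    funext t
    by_cases h : t = k
    · subst h; simp [vals, act, ad]
    · simp [vals, act, h]
  rw [← h]
  rfl

/-- The `n`-Hom-Jacobi identity in the form
`ad_{α̃ X} ad_Y = ad_{[X, Y]_α} α + ε(X, Y) ad_{α̃ Y} ad_X`. -/
theorem ad_jacobi (X Y : Fin (r + 1) → HomElt 𝒢) (z : HomElt 𝒢) :
    (A.adElt (A.twTup 1 X) (A.adElt Y z)).val =
      A.evalAct X Y (fun U => (A.adElt U (A.twElt z)).val) +
        A.ε.app (tdeg X) (tdeg Y) • (A.adElt (A.twTup 1 Y) (A.adElt X z)).val := by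
  have h := A.bracket_jacobi X (Fin.snoc Y z)
  rw [evalAct_snoc] at h
  simpa only [brElt_snoc] using h

section multiplicative

variable {A} (hA : A.IsMultiplicative)

include hA

theorem IsMultiplicative.twElt_brElt (y : Fin (r + 2) → HomElt 𝒢) :
    A.twElt (A.brElt y) = A.brElt (A.twTup 1 y) := by
  ext
  · simp
  · simp only [twElt_val, brElt_val, hA _]
    rfl

theorem IsMultiplicative.twElt_adElt (X : Fin (r + 1) → HomElt 𝒢) (y : HomElt 𝒢) :
    A.twElt (A.adElt X y) = A.adElt (A.twTup 1 X) (A.twElt y) := by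
  rw [← brElt_snoc, ← brElt_snoc, hA.twElt_brElt]
  congr 1
  funext t
  refine Fin.lastCases ?_ (fun i => ?_) t <;> simp [twTup_one]

theorem IsMultiplicative.twTup_act (a : ℕ) (X : Fin (r + 1) → HomElt 𝒢) {m : ℕ}
    (Y : Fin m → HomElt 𝒢) (k : Fin m) :
    A.twTup a (A.act X Y k) = A.act (A.twTup a X) (A.twTup a Y) k := by
  induction a with
  | zero => rfl
  | succ a ih =>
    rw [add_comm, ← twTup_twTup, ih, ← twTup_twTup, ← twTup_twTup]
    funext t
    by_cases h : t = k
    · subst h; simp [act, twTup_one, hA.twElt_adElt]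
    · simp [act, twTup_one, h]

theorem IsMultiplicative.evalAct_twTup (a : ℕ) (X : Fin (r + 1) → HomElt 𝒢) {m : ℕ}
    (Y : Fin m → HomElt 𝒢) (G : (Fin m → HomElt 𝒢) → M) :
    A.evalAct (A.twTup a X) (A.twTup a Y) G = A.evalAct X Y (fun U => G (A.twTup a U)) := by
  simp [evalAct, hA.twTup_act]

theorem IsMultiplicative.der_twTup (X : Fin (r + 1) → HomElt 𝒢) (w : List (HomElt 𝒢))
    (G : List (HomElt 𝒢) → M) :
    A.der M (A.twTup 1 X) (w.map A.twElt) G = A.der M X w (fun w' => G (w'.map A.twElt)) := by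
  induction w generalizing G with
  | nil => simp [der_nil]
  | cons y w ih =>
    simp only [List.map_cons, der_cons, hA.twElt_adElt, tdeg_twTup, twElt_deg, ih]

/-- The derivations of words satisfy the twisted `ε`-Leibniz identity of fundamental objects. -/
theorem IsMultiplicative.der_der (X Y : Fin (r + 1) → HomElt 𝒢) (w : List (HomElt 𝒢))
    (G : List (HomElt 𝒢) → M) (hG : WordLinear w.length G) :
    A.der M Y w (fun w' => A.der M (A.twTup 1 X) w' G) =
      A.evalAct X Y (fun U => A.der M U (w.map A.twElt) G) +
        A.ε.app (tdeg X) (tdeg Y) • A.der M X w (fun w' => A.der M (A.twTup 1 Y) w' G) := by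
  induction w generalizing G with
  | nil => simp [der_nil, evalAct]
  | cons y w ih =>
    have hG' : WordLinear w.length (fun w' => G ([A.twElt (A.twElt y)] ++ w')) :=
      WordLinear.append (by simpa [add_comm] using hG)
    -- the terms in which both `X` and `Y` act on the letter `y`
    have key : G (A.adElt (A.twTup 1 X) (A.adElt Y y) :: (w.map A.twElt).map A.twElt) =
        A.evalAct X Y (fun U => G (A.adElt U (A.twElt y) :: (w.map A.twElt).map A.twElt)) +
          A.ε.app (tdeg X) (tdeg Y) •
            G (A.adElt (A.twTup 1 Y) (A.adElt X y) :: (w.map A.twElt).map A.twElt) := by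
      have h := hG.sum [] ((w.map A.twElt).map A.twElt) (by simp)
        (Finset.univ : Finset (Option (Fin (r + 1))))
        (fun o => o.elim (A.ε.app (tdeg X) (tdeg Y))
          fun k => A.ε.app (tdeg X) (∑ t ∈ Finset.Iio k, (Y t).deg))
        (fun o => o.elim (A.adElt (A.twTup 1 Y) (A.adElt X y))
          fun k => A.adElt (A.act X Y k) (A.twElt y))
        (A.adElt (A.twTup 1 X) (A.adElt Y y))
        (by
          rintro (_ | k) -
          · simp only [Option.elim_none, adElt_deg, tdeg_twTup]; abel
          · simp only [Option.elim_some, adElt_deg, tdeg_twTup, tdeg_act, twElt_deg]; abel)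
        (by
          rw [ad_jacobi, Fintype.sum_option, add_comm]
          rfl)
      rw [Fintype.sum_option] at h
      exact h.trans (add_comm _ _)
    have e1 : A.der M Y (y :: w) (fun w' => A.der M (A.twTup 1 X) w' G) =
        G (A.adElt (A.twTup 1 X) (A.adElt Y y) :: (w.map A.twElt).map A.twElt) +
        (A.ε.app (tdeg X) (tdeg Y + y.deg)) • A.der M X w
          (fun w' => G (A.adElt (A.twTup 1 Y) (A.twElt y) :: w'.map A.twElt)) +
        A.ε.app (tdeg Y) y.deg • (A.der M Y w (fun w' =>
          G (A.adElt (A.twTup 1 X) (A.twElt y) :: w'.map A.twElt)) +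
          A.ε.app (tdeg X) y.deg • A.der M Y w (fun w' => A.der M (A.twTup 1 X) w'
            (fun w'' => G (A.twElt (A.twElt y) :: w'')))) := by
      simp only [der_cons, tdeg_twTup, adElt_deg, twElt_deg, hA.twElt_adElt]
      rw [hA.der_twTup X w (fun w' => G (A.adElt (A.twTup 1 Y) (A.twElt y) :: w'))]
      congr 2
      rw [← map_smul, ← map_add]
      rfl
    have e2 : A.der M X (y :: w) (fun w' => A.der M (A.twTup 1 Y) w' G) =
        G (A.adElt (A.twTup 1 Y) (A.adElt X y) :: (w.map A.twElt).map A.twElt) +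
        (A.ε.app (tdeg Y) (tdeg X + y.deg)) • A.der M Y w
          (fun w' => G (A.adElt (A.twTup 1 X) (A.twElt y) :: w'.map A.twElt)) +
        A.ε.app (tdeg X) y.deg • (A.der M X w (fun w' =>
          G (A.adElt (A.twTup 1 Y) (A.twElt y) :: w'.map A.twElt)) +
          A.ε.app (tdeg Y) y.deg • A.der M X w (fun w' => A.der M (A.twTup 1 Y) w'
            (fun w'' => G (A.twElt (A.twElt y) :: w'')))) := by
      simp only [der_cons, tdeg_twTup, adElt_deg, twElt_deg, hA.twElt_adElt]
      rw [hA.der_twTup Y w (fun w' => G (A.adElt (A.twTup 1 X) (A.twElt y) :: w'))]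
      congr 2
      rw [← map_smul, ← map_add]
      rfl
    have e3 : A.evalAct X Y (fun U => A.der M U ((y :: w).map A.twElt) G) =
        A.evalAct X Y (fun U => G (A.adElt U (A.twElt y) :: (w.map A.twElt).map A.twElt)) +
        (A.ε.app (tdeg X) y.deg * A.ε.app (tdeg Y) y.deg) •
          A.evalAct X Y (fun U => A.der M U (w.map A.twElt)
            (fun w'' => G (A.twElt (A.twElt y) :: w''))) := by
      rw [← evalAct_smul, ← evalAct_add]
      refine evalAct_congr _ _ _ _ _ fun k => ?_
      simp only [List.map_cons, der_cons, tdeg_act, Bicharacter.add_left, twElt_deg]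
    have ih' := ih _ hG'
    simp only [List.singleton_append] at ih'
    rw [e1, e2, e3, key, ih']
    simp only [Bicharacter.add_right]
    have h := A.ε.swap_mul (tdeg X) (tdeg Y)
    match_scalars <;> try ring1
    linear_combination (-A.ε.app (tdeg Y) y.deg) * h

end multiplicative

namespace Representation

variable {A} (R : A.Representation ℳ)

/-- The operator `ρ(α̃^a X)` of a tuple of homogeneous elements. -/
def rhoElt (a : ℕ) (X : Fin (r + 1) → HomElt 𝒢) : Module.End K M := R.ρ (A.tw^[a] (vals X))

theorem rhoElt_twTup (a k : ℕ) (X : Fin (r + 1) → HomElt 𝒢) :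
    R.rhoElt a (A.twTup k X) = R.rhoElt (a + k) X := by
  rw [rhoElt, vals_twTup, ← Function.iterate_add_apply, rhoElt]

theorem rhoElt_eq (a : ℕ) (X : Fin (r + 1) → HomElt 𝒢) :
    R.rhoElt a X = R.ρ (vals (A.twTup a X)) := by
  rw [rhoElt, vals_twTup]

theorem mu_rhoElt (a : ℕ) (X : Fin (r + 1) → HomElt 𝒢) (m : M) :
    R.μ (R.rhoElt a X m) = R.rhoElt (a + 1) X (R.μ m) := by
  have h := LinearMap.congr_fun (R.twist (A.tw^[a] (vals X))) m
  rw [rhoElt, rhoElt, Function.iterate_succ_apply']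
  exact h.symm

/-- The first identity of a representation, twisted by `α̃^a`. -/
theorem rhoElt_rhoElt (hA : A.IsMultiplicative) (a : ℕ) (X Y : Fin (r + 1) → HomElt 𝒢) (m : M) :
    R.rhoElt (a + 1) X (R.rhoElt a Y m) =
      A.evalAct X Y (fun U => R.rhoElt a U (R.μ m)) +
        A.ε.app (tdeg X) (tdeg Y) • R.rhoElt (a + 1) Y (R.rhoElt a X m) := by
  have h := R.rep_one (fun t => (A.twTup a X t).deg) (fun t => (A.twTup a Y t).deg)
    (vals (A.twTup a X)) (vals (A.twTup a Y)) (fun t => (A.twTup a X t).mem)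
    (fun t => (A.twTup a Y t).mem)
  rw [evalBracket_vals, hA.evalAct_twTup] at h
  have h' := LinearMap.congr_fun h m
  rw [LinearMap.sub_apply, LinearMap.smul_apply, sub_eq_iff_eq_add] at h'
  simp only [LinearMap.comp_apply, twTup_apply_deg] at h'
  have hs : ∀ Z, R.rhoElt (a + 1) Z = R.ρ (A.tw (vals (A.twTup a Z))) := fun Z => by
    rw [vals_twTup, ← Function.iterate_succ_apply' A.tw, rhoElt]
  have e : (A.evalAct X Y fun U => R.rhoElt a U (R.μ m)) =
      (A.evalAct X Y fun U => R.ρ (vals (A.twTup a U))) (R.μ m) := by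
    simp only [rhoElt_eq]
    exact A.evalAct_map X Y (fun U => R.ρ (vals (A.twTup a U))) (LinearMap.applyₗ (R.μ m))
  rw [e, hs, hs, rhoElt_eq, rhoElt_eq]
  exact h'

end Representation

end

variable {Γ K g M : Type*} [AddCommGroup Γ] [Field K] [AddCommGroup g] [Module K g]
  [AddCommGroup M] [Module K M] {𝒢 : Γ → Submodule K g} {ℳ : Γ → Submodule K M} {r : ℕ}
  {A : NHomLieColorAlgebra K 𝒢 r}

/-! ### Contraction, Lie derivative and coboundary -/

/-- The sequence `F` with its first `k` terms dropped. -/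
def shift (k : ℕ) (F : ℕ → List (HomElt 𝒢) → M) : ℕ → List (HomElt 𝒢) → M := fun l => F (k + l)

/-- Contraction of a sequence of maps on words with `X`. The `k`-th term is contracted with
`α̃^k X`, so that compatibility with the twist maps is preserved. -/
def contr (A : NHomLieColorAlgebra K 𝒢 r) (M : Type*) [AddCommGroup M] [Module K M]
    (X : Fin (r + 1) → HomElt 𝒢) :
    (ℕ → List (HomElt 𝒢) → M) →ₗ[K] (ℕ → List (HomElt 𝒢) → M) where
  toFun F k w := F k (List.ofFn (A.twTup k X) ++ w)
  map_add' _ _ := rfl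
  map_smul' _ _ := rfl

theorem contr_apply (X : Fin (r + 1) → HomElt 𝒢) (F : ℕ → List (HomElt 𝒢) → M) (k : ℕ)
    (w : List (HomElt 𝒢)) : A.contr M X F k w = F k (List.ofFn (A.twTup k X) ++ w) := rfl

namespace Representation

variable (R : A.Representation ℳ)

/-- The Lie derivative along `X` of a sequence `F` of degree `ξ`, evaluated at the word `w`. The
representation, twisted by `α̃^a`, is applied to `F_0`; the action on the word twists all the other
letters, and is applied to `F_1`. -/
def lie (a : ℕ) (ξ : Γ) (X : Fin (r + 1) → HomElt 𝒢) (w : List (HomElt 𝒢)) :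
    (ℕ → List (HomElt 𝒢) → M) →ₗ[K] M :=
  A.ε.app ξ (tdeg X) • (R.rhoElt a X ∘ₗ LinearMap.proj w ∘ₗ LinearMap.proj 0) -
    A.der M X w ∘ₗ LinearMap.proj 1

/-- The Lie derivative along `X` as a sequence of maps on words. -/
def lieSeq (a : ℕ) (ξ : Γ) (X : Fin (r + 1) → HomElt 𝒢) (F : ℕ → List (HomElt 𝒢) → M) :
    ℕ → List (HomElt 𝒢) → M :=
  fun k w => R.lie a ξ (A.twTup k X) w (shift k F)

/-- Evaluation of the `k`-th term of a sequence at the word `w`. -/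
def evalSeq (K M : Type*) {g Γ : Type*} [Field K] [AddCommGroup g] [Module K g]
    {𝒢 : Γ → Submodule K g} [AddCommGroup M] [Module K M] (k : ℕ) (w : List (HomElt 𝒢)) :
    (ℕ → List (HomElt 𝒢) → M) →ₗ[K] M where
  toFun F := F k w
  map_add' _ _ := rfl
  map_smul' _ _ := rfl

/-- The coefficient of the summand `ρ(y_1, …, ŷ_k, …, y_n) F(y_k)` of the coboundary of a map `F`
of degree `ξ` in one variable. Here `n = r + 2`, and the sign `(-1)^{n-k}` is `(-1)^(r + 1 - k)` for
`k` counted from `0`. -/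
def coef (A : NHomLieColorAlgebra K 𝒢 r) (ξ : Γ) (k : Fin (r + 2)) (y : Fin (r + 2) → HomElt 𝒢) :
    K :=
  (-1) ^ (r + 1 - (k : ℕ)) * A.ε.app ξ (tdeg (k.removeNth y)) *
    A.ε.app (y k).deg (∑ t ∈ Finset.Ioi k, (y t).deg)

/-- The coboundary of a sequence of maps of degree `ξ` in words of `q` blocks and a letter, at the
word `w` of `q + 1` blocks and a letter. It is defined by the recursion
`ι_X d F = L_X F - d (ι_X F)` of Cartan's formula. The representation is twisted by `α̃^a`. Words
that are too short are padded by `0`. -/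
def cobd (a : ℕ) : (q : ℕ) → (ξ : Γ) → (w : List (HomElt 𝒢)) →
    ((ℕ → List (HomElt 𝒢) → M) →ₗ[K] M)
  | 0, ξ, w =>
      -evalSeq K M 1 [A.brElt (tup (r + 2) w)] +
        ∑ k : Fin (r + 2), coef A ξ k (tup (r + 2) w) •
          (R.rhoElt a (k.removeNth (tup (r + 2) w)) ∘ₗ evalSeq K M 0 [tup (r + 2) w k])
  | q + 1, ξ, w => R.lie a ξ (tup (r + 1) w) (w.drop (r + 1)) -
      cobd a q (ξ + tdeg (tup (r + 1) w)) (w.drop (r + 1)) ∘ₗ A.contr M (tup (r + 1) w)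

/-- The coboundary as a sequence of maps on words. -/
def cobdSeq (a q : ℕ) (ξ : Γ) (F : ℕ → List (HomElt 𝒢) → M) : ℕ → List (HomElt 𝒢) → M :=
  fun k w => R.cobd a q ξ w (shift k F)

/-- The sequence `F` is linear in every letter of a word of length `N` and compatible with the
twist maps. -/
structure IsTwistedSeq (N : ℕ) (F : ℕ → List (HomElt 𝒢) → M) : Prop where
  linear : ∀ k, WordLinear N (F k)
  compat : ∀ k w, R.μ (F k w) = F (k + 1) (w.map A.twElt)

theorem lie_apply (a : ℕ) (ξ : Γ) (X : Fin (r + 1) → HomElt 𝒢) (w : List (HomElt 𝒢))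
    (F : ℕ → List (HomElt 𝒢) → M) :
    R.lie a ξ X w F = A.ε.app ξ (tdeg X) • R.rhoElt a X (F 0 w) - A.der M X w (F 1) := rfl

theorem lieSeq_apply (a : ℕ) (ξ : Γ) (X : Fin (r + 1) → HomElt 𝒢) (w : List (HomElt 𝒢))
    (F : ℕ → List (HomElt 𝒢) → M) (k : ℕ) :
    R.lieSeq a ξ X F k w = A.ε.app ξ (tdeg X) • R.rhoElt (a + k) X (F k w) -
      A.der M (A.twTup k X) w (F (k + 1)) := by
  rw [lieSeq, lie_apply, tdeg_twTup, rhoElt_twTup]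
  rfl

theorem cobd_zero_ofFn (a : ℕ) (ξ : Γ) (y : Fin (r + 2) → HomElt 𝒢)
    (F : ℕ → List (HomElt 𝒢) → M) :
    R.cobd a 0 ξ (List.ofFn y) F = -F 1 [A.brElt y] +
      ∑ k : Fin (r + 2), coef A ξ k y • R.rhoElt a (k.removeNth y) (F 0 [y k]) := by
  rw [cobd, tup_ofFn]
  simp [evalSeq]

theorem cobd_succ_append (a q : ℕ) (ξ : Γ) (X : Fin (r + 1) → HomElt 𝒢) (w : List (HomElt 𝒢))
    (F : ℕ → List (HomElt 𝒢) → M) :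
    R.cobd a (q + 1) ξ (List.ofFn X ++ w) F =
      R.lie a ξ X w F - R.cobd a q (ξ + tdeg X) w (A.contr M X F) := by
  rw [cobd, tup_append, drop_ofFn_append]
  rfl

/-- Cartan's formula. -/
theorem contr_cobdSeq_succ (a q : ℕ) (ξ : Γ) (X : Fin (r + 1) → HomElt 𝒢)
    (F : ℕ → List (HomElt 𝒢) → M) :
    A.contr M X (R.cobdSeq a (q + 1) ξ F) =
      R.lieSeq a ξ X F - R.cobdSeq a q (ξ + tdeg X) (A.contr M X F) := by
  funext k w
  rw [contr_apply, cobdSeq, cobd_succ_append, tdeg_twTup]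
  have : A.contr M (A.twTup k X) (shift k F) = shift k (A.contr M X F) := by
    funext l w
    simp only [contr_apply, shift, twTup_twTup, add_comm]
  rw [this]
  rfl

variable {R}

theorem IsTwistedSeq.contr {N : ℕ} {F : ℕ → List (HomElt 𝒢) → M}
    (hF : R.IsTwistedSeq (r + 1 + N) F) (X : Fin (r + 1) → HomElt 𝒢) :
    R.IsTwistedSeq N (A.contr M X F) where
  linear k := WordLinear.append (by simpa using hF.linear k)
  compat k w := by
    rw [contr_apply, hF.compat, List.map_append, map_twElt_ofFn, twTup_twTup, add_comm 1 k]
    rfl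

variable (R)

/-- The weights which occur when `X` acts on a letter other than the `k`-th one, compared with
those in the tuple without the `k`-th letter: the two factors from passing the `k`-th letter
cancel. -/
theorem app_act_succAbove (X : Fin (r + 1) → HomElt 𝒢) {m : ℕ} (y : Fin (m + 1) → HomElt 𝒢)
    (k : Fin (m + 1)) (j : Fin m) :
    A.ε.app (tdeg X) (∑ t ∈ Finset.Iio (k.succAbove j), (y t).deg) *
        A.ε.app (y k).deg (∑ t ∈ Finset.Ioi k, (A.act X y (k.succAbove j) t).deg) =
      A.ε.app (tdeg X) (∑ t ∈ Finset.Iio j, (k.removeNth y t).deg) *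
        A.ε.app (y k).deg (∑ t ∈ Finset.Ioi k, (y t).deg) := by
  have h1 : ∑ t ∈ Finset.Iio (k.succAbove j), (y t).deg =
      (if k < k.succAbove j then (y k).deg else 0) +
        ∑ t ∈ Finset.Iio j, (k.removeNth y t).deg := by
    have e1 : Finset.Iio (k.succAbove j) = Finset.univ.filter (· < k.succAbove j) := by ext; simp
    have e2 : Finset.Iio j = Finset.univ.filter (· < j) := by ext; simp
    rw [e1, e2, Finset.sum_filter, Finset.sum_filter, Fin.sum_univ_succAbove _ k]
    simp [Fin.removeNth]
  have h2 : ∑ t ∈ Finset.Ioi k, (A.act X y (k.succAbove j) t).deg =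
      (if k < k.succAbove j then tdeg X else 0) + ∑ t ∈ Finset.Ioi k, (y t).deg := by
    have e : ∀ t, (A.act X y (k.succAbove j) t).deg =
        (if t = k.succAbove j then tdeg X else 0) + (y t).deg := by
      intro t
      by_cases h : t = k.succAbove j
      · subst h; simp [act_same]
      · simp [act_of_ne _ _ _ h, h]
    simp only [e, Finset.sum_add_distrib, Finset.sum_ite_eq', Finset.mem_Ioi]
  rw [h1, h2]
  split_ifs with h
  · simp only [Bicharacter.add_right]
    have := A.ε.swap_mul (tdeg X) (y k).deg
    linear_combination (A.ε.app (tdeg X) (∑ t ∈ Finset.Iio j, (k.removeNth y t).deg) *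
        A.ε.app (y k).deg (∑ t ∈ Finset.Ioi k, (y t).deg)) * this
  · simp

theorem removeNth_act_self (X : Fin (r + 1) → HomElt 𝒢) {m : ℕ} (y : Fin (m + 1) → HomElt 𝒢)
    (k : Fin (m + 1)) : k.removeNth (A.act X y k) = A.twTup 1 (k.removeNth y) := by
  funext t
  simp [Fin.removeNth, act, twTup_one]

theorem removeNth_act_succAbove (X : Fin (r + 1) → HomElt 𝒢) {m : ℕ}
    (y : Fin (m + 1) → HomElt 𝒢) (k : Fin (m + 1)) (j : Fin m) :
    k.removeNth (A.act X y (k.succAbove j)) = A.act X (k.removeNth y) j := by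
  funext t
  by_cases h : t = j
  · subst h; simp [Fin.removeNth, act]
  · simp [Fin.removeNth, act, h]

theorem tdeg_removeNth {m : ℕ} (y : Fin (m + 1) → HomElt 𝒢) (k : Fin (m + 1)) :
    tdeg (k.removeNth y) =
      ∑ t ∈ Finset.Iio k, (y t).deg + ∑ t ∈ Finset.Ioi k, (y t).deg := by
  have h := tdeg_eq_add_removeNth k y
  have e1 : Finset.univ = Finset.cons k (Finset.Iio k ∪ Finset.Ioi k) (by simp) := by
    ext t
    simpa using (eq_or_ne t k).imp_right lt_or_gt_of_ne
  rw [tdeg, e1, Finset.sum_cons, Finset.sum_union] at h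
  · exact (add_left_cancel h).symm
  · rw [Finset.disjoint_left]
    intro t h1 h2
    exact lt_asymm (Finset.mem_Iio.1 h1) (Finset.mem_Ioi.1 h2)

/-- The Lie derivative commutes with the coboundary of maps in one variable. -/
theorem lie_cobdSeq_zero (hA : A.IsMultiplicative) (a : ℕ) (ξ : Γ) (X : Fin (r + 1) → HomElt 𝒢)
    (y : Fin (r + 2) → HomElt 𝒢) (F : ℕ → List (HomElt 𝒢) → M) (hF : R.IsTwistedSeq 1 F) :
    R.lie (a + 1) ξ X (List.ofFn y) (R.cobdSeq a 0 ξ F) =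
      R.cobd (a + 1) 0 (ξ + tdeg X) (List.ofFn y) (R.lieSeq a ξ X F) := by
  -- the Jacobi identity, under the linear map `F 2`
  have hlin : F 2 [A.adElt (A.twTup 1 X) (A.brElt y)] =
      A.evalAct X y (fun U => F 2 [A.brElt U]) := by
    refine (hF.linear 2).sum [] [] rfl Finset.univ
      (fun k => A.ε.app (tdeg X) (∑ t ∈ Finset.Iio k, (y t).deg))
      (fun k => A.brElt (A.act X y k)) _ (fun k _ => ?_) (A.bracket_jacobi X y)
    simp
  -- `X` acts either on the argument `y k` of `F`, or on one of the entries inside `ρ`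
  have hk : ∀ k : Fin (r + 2), A.evalAct X y
      (fun U => coef A ξ k U • R.rhoElt a (k.removeNth U) (F 1 [U k])) =
      coef A (ξ + tdeg X) k y • R.rhoElt (a + 1) (k.removeNth y) (F 1 [A.adElt X (y k)]) +
      (A.ε.app ξ (tdeg X) * coef A ξ k y) •
        A.evalAct X (k.removeNth y) (fun V => R.rhoElt a V (F 1 [A.twElt (y k)])) := by
    intro k
    rw [evalAct, Fin.sum_univ_succAbove _ k, evalAct, Finset.smul_sum]
    congr 1
    · rw [removeNth_act_self, rhoElt_twTup, act_same, smul_smul]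
      congr 1
      have e : ∑ t ∈ Finset.Ioi k, (A.act X y k t).deg = ∑ t ∈ Finset.Ioi k, (y t).deg :=
        Finset.sum_congr rfl fun t ht => by
          rw [act_of_ne _ _ _ (Finset.mem_Ioi.1 ht).ne', twElt_deg]
      rw [coef, coef, removeNth_act_self, tdeg_twTup, act_same, adElt_deg, e,
        Bicharacter.add_left, Bicharacter.add_left]
      have e' := congrArg (A.ε.app (tdeg X)) (tdeg_removeNth y k)
      rw [A.ε.add_right] at e'
      rw [e']
      ring
    · refine Finset.sum_congr rfl fun j _ => ?_
      rw [removeNth_act_succAbove, act_of_ne _ _ _ (Fin.succAbove_ne k j).symm, smul_smul,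
        smul_smul]
      congr 1
      rw [coef, coef, removeNth_act_succAbove, act_of_ne _ _ _ (Fin.succAbove_ne k j).symm,
        tdeg_act, twElt_deg, A.ε.add_right ξ]
      linear_combination ((-1) ^ (r + 1 - (k : ℕ)) * A.ε.app ξ (tdeg X) *
        A.ε.app ξ (tdeg (k.removeNth y))) * app_act_succAbove (A := A) X y k j
  have e1 : R.lie (a + 1) ξ X (List.ofFn y) (R.cobdSeq a 0 ξ F) =
      A.ε.app ξ (tdeg X) • R.rhoElt (a + 1) X (-F 1 [A.brElt y] +
        ∑ k : Fin (r + 2), coef A ξ k y • R.rhoElt a (k.removeNth y) (F 0 [y k])) -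
      (-F 2 [A.adElt (A.twTup 1 X) (A.brElt y)] + ∑ k : Fin (r + 2),
        A.evalAct X y (fun U => coef A ξ k U • R.rhoElt a (k.removeNth U) (F 1 [U k]))) := by
    rw [lie_apply, der_ofFn, hlin]
    simp only [cobdSeq, cobd_zero_ofFn, shift]
    rw [evalAct_add, evalAct_neg]
    congr 3
    simp only [evalAct, Finset.smul_sum]
    rw [Finset.sum_comm]
  have e2 : ∀ z : HomElt 𝒢, ∀ k, A.der M (A.twTup k X) [z] (F (k + 1)) =
      F (k + 1) [A.adElt (A.twTup k X) z] := by
    intro z k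
    simp [der_cons, der_nil]
  rw [e1, cobd_zero_ofFn]
  simp only [lieSeq_apply, e2, hk]
  rw [map_add, map_neg, map_sum, smul_add, Finset.smul_sum]
  have e4 : ∀ k : Fin (r + 2), R.rhoElt (a + 1) X (R.rhoElt a (k.removeNth y) (F 0 [y k])) = _ :=
    fun k => R.rhoElt_rhoElt hA a X (k.removeNth y) (F 0 [y k])
  simp only [map_smul, e4, hF.compat, List.map_cons, List.map_nil, map_sub,
    Finset.sum_add_distrib, smul_sub, smul_add, Finset.sum_sub_distrib]
  have e3 : ∀ k : Fin (r + 2), A.ε.app ξ (tdeg X) * (coef A ξ k y *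
      A.ε.app (tdeg X) (tdeg (k.removeNth y))) = coef A (ξ + tdeg X) k y * A.ε.app ξ (tdeg X) := by
    intro k
    rw [coef, coef, A.ε.add_left ξ]
    ring
  simp only [smul_smul, e3, twTup_zero, add_zero]
  module

end Representation

/-! ### The coboundary squares to zero -/

theorem colorSkew_vals {N : Type*} [AddCommGroup N] [Module K N] {ε : Bicharacter Γ K} {m : ℕ}
    {f : (Fin m → g) → N} (hf : IsColorSkew ε 𝒢 f) (X : Fin m → HomElt 𝒢) (i j : Fin m)
    (h : (j : ℕ) = i + 1) :
    f (vals X) = -(ε.app (X i).deg (X j).deg • f (vals (X ∘ Equiv.swap i j))) :=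
  hf i j h (fun t => (X t).deg) (vals X) fun t => (X t).mem

theorem swap_succAbove_succ {m : ℕ} (k i : Fin m) :
    Equiv.swap k.castSucc k.succ (k.succ.succAbove i) = k.castSucc.succAbove i := by
  simp only [Equiv.swap_apply_def, Fin.succAbove, Fin.lt_def, Fin.val_castSucc, Fin.val_succ]
  split_ifs with h1 h2 h3 <;> simp only [Fin.ext_iff, Fin.val_castSucc, Fin.val_succ] at * <;>
    omega

theorem removeNth_castSucc_snoc {α : Type*} {m : ℕ} (i : Fin (m + 1)) (W : Fin (m + 1) → α)
    (z : α) : i.castSucc.removeNth (Fin.snoc W z : Fin (m + 2) → α) =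
      Fin.snoc (i.removeNth W) z := by
  funext t
  refine Fin.lastCases ?_ (fun t => ?_) t
  · rw [Fin.removeNth_apply, Fin.succAbove_of_lt_succ _ _ (by simp)]
    simp
  · rw [Fin.removeNth_apply, Fin.castSucc_succAbove_castSucc]
    simp [Fin.removeNth]

theorem insertNth_succ_eq_comp_swap {α : Type*} {m : ℕ} (k : Fin m) (u : α) (V : Fin m → α) :
    (Fin.insertNth k.succ u V : Fin (m + 1) → α) =
      (Fin.insertNth k.castSucc u V : Fin (m + 1) → α) ∘ Equiv.swap k.castSucc k.succ := by
  rw [Fin.insertNth_eq_iff]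
  refine ⟨by simp, ?_⟩
  funext i
  rw [Fin.removeNth_apply, Function.comp_apply, swap_succAbove_succ,
    Fin.insertNth_apply_succAbove]

/-- Moving the last argument of an `ε`-skew-symmetric map to the front. -/
theorem colorSkew_snoc {N : Type*} [AddCommGroup N] [Module K N] {ε : Bicharacter Γ K} {m : ℕ}
    {f : (Fin (m + 1) → g) → N} (hf : IsColorSkew ε 𝒢 f) (V : Fin m → HomElt 𝒢) (u : HomElt 𝒢) :
    f (vals (Fin.snoc V u : Fin (m + 1) → HomElt 𝒢)) = ((-1) ^ m * ε.app (tdeg V) u.deg) •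
      f (vals (Fin.cons u V : Fin (m + 1) → HomElt 𝒢)) := by
  have key : ∀ k : Fin (m + 1), f (vals (Fin.insertNth k u V : Fin (m + 1) → HomElt 𝒢)) =
      ((-1) ^ (k : ℕ) * ε.app (∑ t : Fin m, if t.castSucc < k then (V t).deg else 0) u.deg) •
        f (vals (Fin.cons u V : Fin (m + 1) → HomElt 𝒢)) := by
    intro k
    induction k using Fin.induction with
    | zero => simp [Bicharacter.zero_left]
    | succ k ih =>
      have h := colorSkew_vals hf (Fin.insertNth k.succ u V : Fin (m + 1) → HomElt 𝒢)
        k.castSucc k.succ (by simp)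
      have e1 : (Fin.insertNth k.succ u V : Fin (m + 1) → HomElt 𝒢) ∘
          Equiv.swap k.castSucc k.succ = Fin.insertNth k.castSucc u V := by
        rw [insertNth_succ_eq_comp_swap]
        funext t
        simp
      have e2 : (Fin.insertNth k.succ u V : Fin (m + 1) → HomElt 𝒢) k.castSucc = V k := by
        rw [insertNth_succ_eq_comp_swap]
        simp only [Function.comp_apply, Equiv.swap_apply_left]
        have := Fin.insertNth_apply_succAbove (α := fun _ => HomElt 𝒢) k.castSucc u V k
        simpa using this
      have e3 : ∑ t : Fin m, (if t.castSucc < k.succ then (V t).deg else 0) =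
          ∑ t : Fin m, (if t.castSucc < k.castSucc then (V t).deg else 0) + (V k).deg := by
        have : ∀ t : Fin m, (if t.castSucc < k.succ then (V t).deg else 0) =
            (if t.castSucc < k.castSucc then (V t).deg else 0) +
              if t = k then (V t).deg else 0 := by
          intro t
          simp only [Fin.lt_def, Fin.val_castSucc, Fin.val_succ, Fin.ext_iff]
          split_ifs <;> first | omega | simp
        rw [Finset.sum_congr rfl fun t _ => this t, Finset.sum_add_distrib]
        simp
      rw [h, e1, e2, ih, e3, Bicharacter.add_left, Fin.insertNth_apply_same]
      simp only [Fin.val_castSucc, Fin.val_succ]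
      module
  have h := key (Fin.last m)
  rw [Fin.insertNth_last'] at h
  simpa [Fin.castSucc_lt_last, tdeg] using h

theorem sum_Ioi_castSucc_snoc {m : ℕ} (X : Fin m → HomElt 𝒢) (z : HomElt 𝒢) (i : Fin m) :
    ∑ t ∈ Finset.Ioi i.castSucc, ((Fin.snoc X z : Fin (m + 1) → HomElt 𝒢) t).deg =
      ∑ t ∈ Finset.Ioi i, (X t).deg + z.deg := by
  rw [show Finset.Ioi i.castSucc = Finset.univ.filter (i.castSucc < ·) from by ext; simp,
    show Finset.Ioi i = Finset.univ.filter (i < ·) from by ext; simp,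
    Finset.sum_filter, Finset.sum_filter, Fin.sum_univ_castSucc]
  simp [Fin.castSucc_lt_last]

omit [AddCommGroup Γ] in
theorem ofFn_append_singleton {m : ℕ} (X : Fin m → HomElt 𝒢) (z : HomElt 𝒢) :
    List.ofFn X ++ [z] = List.ofFn (Fin.snoc X z : Fin (m + 1) → HomElt 𝒢) := by
  rw [List.ofFn_succ_last (f := (Fin.snoc X z : Fin (m + 1) → HomElt 𝒢))]
  simp only [Fin.snoc_castSucc, Fin.snoc_last]

namespace Representation

theorem coef_last_snoc (ξ : Γ) (X : Fin (r + 1) → HomElt 𝒢) (z : HomElt 𝒢) :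
    coef A ξ (Fin.last (r + 1)) (Fin.snoc X z) = A.ε.app ξ (tdeg X) := by
  rw [coef, show Finset.Ioi (Fin.last (r + 1)) = ∅ from by ext; simp [Fin.le_last]]
  simp [Bicharacter.zero_right]

variable (R : A.Representation ℳ)

theorem cobd_congr (a q : ℕ) (ξ : Γ) (w : List (HomElt 𝒢)) (F F' : ℕ → List (HomElt 𝒢) → M)
    (hw : w.length = (q + 1) * (r + 1) + 1)
    (h : ∀ k w', w'.length = q * (r + 1) + 1 → F k w' = F' k w') :
    R.cobd a q ξ w F = R.cobd a q ξ w F' := by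
  induction q generalizing ξ w F F' with
  | zero =>
    obtain ⟨y, rfl⟩ := exists_ofFn (m := r + 2) w (by rw [hw]; ring)
    simp only [cobd_zero_ofFn]
    rw [h 1 _ (by simp)]
    simp only [h 0 [y _] (by simp)]
  | succ q ih =>
    obtain ⟨X, w, rfl⟩ := exists_ofFn_append (m := r + 1) w (by rw [hw]; nlinarith)
    have hw' : w.length = (q + 1) * (r + 1) + 1 := by
      simp only [List.length_append, List.length_ofFn] at hw
      linarith
    rw [cobd_succ_append, cobd_succ_append, lie_apply, lie_apply, h 0 w hw',
      A.der_congr X w (F 1) (F' 1) fun w' hw'' => h 1 w' (hw''.trans hw')]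
    congr 1
    refine ih _ _ _ _ hw' fun k w' hw' => h _ _ ?_
    simp only [List.length_append, List.length_ofFn, hw']
    ring

/-- Pulling back along the twist map raises the twist of the representation by one. -/
theorem cobd_map_twElt (hA : A.IsMultiplicative) (a q : ℕ) (ξ : Γ) (w : List (HomElt 𝒢))
    (F : ℕ → List (HomElt 𝒢) → M) (hw : w.length = (q + 1) * (r + 1) + 1) :
    R.cobd a q ξ (w.map A.twElt) F = R.cobd (a + 1) q ξ w (fun k w' => F k (w'.map A.twElt)) := by
  induction q generalizing ξ w F with
  | zero =>
    obtain ⟨y, rfl⟩ := exists_ofFn (m := r + 2) w (by rw [hw]; ring)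
    rw [map_twElt_ofFn, cobd_zero_ofFn, cobd_zero_ofFn]
    simp only [List.map_cons, List.map_nil, hA.twElt_brElt]
    rfl
  | succ q ih =>
    obtain ⟨X, w, rfl⟩ := exists_ofFn_append (m := r + 1) w (by rw [hw]; nlinarith)
    have hw' : w.length = (q + 1) * (r + 1) + 1 := by
      simp only [List.length_append, List.length_ofFn] at hw
      linarith
    rw [List.map_append, map_twElt_ofFn, cobd_succ_append, cobd_succ_append, lie_apply, lie_apply,
      tdeg_twTup, rhoElt_twTup, hA.der_twTup, ih _ _ _ hw']
    congr 2
    funext k w'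
    simp only [contr_apply, List.map_append, map_twElt_ofFn, twTup_twTup, add_comm]

/-- The second identity of a representation, with the new argument moved to the last place. -/
theorem rhoElt_snoc_brElt (a : ℕ) (V : Fin r → HomElt 𝒢) (hA : A.IsMultiplicative)
    (y : Fin (r + 2) → HomElt 𝒢) (m : M) :
    R.rhoElt a (Fin.snoc (A.twTup 1 V) (A.brElt y)) (R.μ m) =
      ∑ k : Fin (r + 2), coef A (tdeg V) k y •
        R.rhoElt (a + 1) (k.removeNth y) (R.rhoElt a (Fin.snoc V (y k)) m) := by
  -- the identity is given for the bracket in the first place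
  have hsnoc : ∀ (b : ℕ) (W : Fin r → HomElt 𝒢) (u : HomElt 𝒢) (m : M),
      R.rhoElt b (Fin.snoc W u) m =
        ((-1) ^ r * A.ε.app (tdeg W) u.deg) • R.rhoElt b (Fin.cons u W) m := by
    intro b W u m
    have e1 : A.twTup b (Fin.snoc W u : Fin (r + 1) → HomElt 𝒢) =
        Fin.snoc (A.twTup b W) (A.twElt^[b] u) := by
      funext t
      refine Fin.lastCases ?_ (fun i => ?_) t <;> simp [twTup]
    have e2 : A.twTup b (Fin.cons u W : Fin (r + 1) → HomElt 𝒢) =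
        Fin.cons (A.twElt^[b] u) (A.twTup b W) := by
      funext t
      refine Fin.cases ?_ (fun i => ?_) t <;> simp [twTup]
    rw [rhoElt_eq, rhoElt_eq, e1, e2]
    have h := LinearMap.congr_fun (colorSkew_snoc R.skew (A.twTup b W) (A.twElt^[b] u)) m
    rw [tdeg_twTup, twElt_iterate_deg] at h
    exact h
  have h2 : R.rhoElt a (Fin.cons (A.brElt y) (A.twTup 1 V)) (R.μ m) =
      ∑ k : Fin (r + 2), ((-1) ^ (r + 1 - (k : ℕ)) *
        A.ε.app (y k).deg (∑ t ∈ Finset.Ioi k, (y t).deg)) •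
        R.rhoElt (a + 1) (k.removeNth y) (R.rhoElt a (Fin.cons (y k) V) m) := by
    have h := R.rep_two (fun t => (A.twTup a y t).deg) (fun t => (A.twTup a V t).deg)
      (vals (A.twTup a y)) (vals (A.twTup a V)) (fun t => (A.twTup a y t).mem)
      (fun t => (A.twTup a V t).mem)
    have h' := LinearMap.congr_fun h m
    simp only [LinearMap.sum_apply, LinearMap.comp_apply, LinearMap.smul_apply,
      twTup_apply_deg] at h'
    have hbr : ∀ b, A.twElt^[b] (A.brElt y) = A.brElt (A.twTup b y) := by
      intro b
      induction b with
      | zero => rfl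
      | succ b ih =>
        rw [Function.iterate_succ_apply', ih, hA.twElt_brElt, twTup_twTup, add_comm 1 b]
    have e1 : (Fin.cons (A.bracket (vals (A.twTup a y))) (fun t => A.α (vals (A.twTup a V) t)) :
        Fin (r + 1) → g) = vals (A.twTup a (Fin.cons (A.brElt y) (A.twTup 1 V))) := by
      funext t
      refine Fin.cases ?_ (fun i => ?_) t
      · simp [vals, twTup, hbr]
      · simp only [Fin.cons_succ, vals, twTup, Function.iterate_one]
        rw [← Function.iterate_succ_apply A.twElt, Function.iterate_succ_apply', twElt_val]
    have e2 : ∀ k : Fin (r + 2), (k.removeNth (fun t => A.α (vals (A.twTup a y) t))) =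
        vals (A.twTup (a + 1) (k.removeNth y)) := by
      intro k
      funext t
      simp [Fin.removeNth, vals, twTup, Function.iterate_succ_apply']
    have e3 : ∀ k : Fin (r + 2), (Fin.cons (vals (A.twTup a y) k) (vals (A.twTup a V)) :
        Fin (r + 1) → g) = vals (A.twTup a (Fin.cons (y k) V)) := by
      intro k
      funext t
      refine Fin.cases ?_ (fun i => ?_) t <;> simp [vals, twTup]
    simp only [e1, e2, e3, ← rhoElt_eq] at h'
    exact h'
  rw [hsnoc, h2, Finset.smul_sum]
  refine Finset.sum_congr rfl fun k _ => ?_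
  rw [hsnoc, map_smul, smul_smul, smul_smul, tdeg_twTup, brElt_deg, coef,
    tdeg_eq_add_removeNth k y, A.ε.add_right]
  congr 1
  ring

/-- The part of the coboundary of a map in one variable at `(X, z)` that has the `i`-th entry of
`X` as the argument. -/
def tailSeq (a : ℕ) (ξ : Γ) (X : Fin (r + 1) → HomElt 𝒢) (i : Fin (r + 1))
    (F : ℕ → List (HomElt 𝒢) → M) : ℕ → List (HomElt 𝒢) → M := fun k w =>
  coef A ξ i.castSucc (Fin.snoc X (w.getD 0 default)) •
    R.rhoElt a (Fin.snoc (A.twTup k (i.removeNth X)) (w.getD 0 default)) (F k [A.twTup k X i])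

/-- Cartan's formula for a map in one variable: the contraction of its coboundary is the Lie
derivative, together with the summands in which an entry of `X` is the argument. -/
theorem contr_cobdSeq_zero (a : ℕ) (ξ : Γ) (X : Fin (r + 1) → HomElt 𝒢)
    (F : ℕ → List (HomElt 𝒢) → M) (k : ℕ) (z : HomElt 𝒢) :
    A.contr M X (R.cobdSeq a 0 ξ F) k [z] =
      R.lieSeq a ξ X F k [z] + ∑ i, R.tailSeq a ξ X i F k [z] := by
  have e1 : ∀ i : Fin (r + 1), i.castSucc.removeNth
      (Fin.snoc (A.twTup k X) z : Fin (r + 2) → HomElt 𝒢) =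
        Fin.snoc (A.twTup k (i.removeNth X)) z := fun i => by
    rw [removeNth_castSucc_snoc]
    rfl
  have e2 : (Fin.last (r + 1)).removeNth
      (Fin.snoc (A.twTup k X) z : Fin (r + 2) → HomElt 𝒢) = A.twTup k X := by
    simp
  have e3 : ∀ j, coef A ξ j (Fin.snoc (A.twTup k X) z) = coef A ξ j (Fin.snoc X z) := by
    have hd : ∀ t : Fin (r + 2), ((Fin.snoc (A.twTup k X) z : Fin (r + 2) → HomElt 𝒢) t).deg =
        ((Fin.snoc X z : Fin (r + 2) → HomElt 𝒢) t).deg := by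
      intro t
      refine Fin.lastCases ?_ (fun t => ?_) t <;> simp
    intro j
    simp only [coef, tdeg, Fin.removeNth, hd]
  rw [contr_apply, cobdSeq, ofFn_append_singleton, cobd_zero_ofFn, Fin.sum_univ_castSucc,
    lieSeq_apply]
  simp only [e1, e2, e3, coef_last_snoc, der_cons, der_nil, shift, tailSeq, brElt_snoc]
  simp only [Fin.snoc_castSucc, Fin.snoc_last, rhoElt_twTup]
  simp
  abel

/-- By the second identity of a representation, the coboundary kills the summands
`ρ(x_1, …, x̂_i, …, z) F(x_i)`. -/
theorem cobd_tailSeq (hA : A.IsMultiplicative) (a : ℕ) (ξ : Γ) (X : Fin (r + 1) → HomElt 𝒢)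
    (i : Fin (r + 1)) (F : ℕ → List (HomElt 𝒢) → M) (hF : R.IsTwistedSeq 1 F)
    (y : Fin (r + 2) → HomElt 𝒢) :
    R.cobd (a + 1) 0 (ξ + tdeg X) (List.ofFn y) (R.tailSeq a ξ X i F) = 0 := by
  have hc : ∀ z : HomElt 𝒢, coef A ξ i.castSucc (Fin.snoc X z) =
      (-1) ^ (r + 1 - (i : ℕ)) * (A.ε.app ξ (tdeg (i.removeNth X)) * A.ε.app ξ z.deg) *
        (A.ε.app (X i).deg (∑ t ∈ Finset.Ioi i, (X t).deg) * A.ε.app (X i).deg z.deg) := by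
    intro z
    rw [coef, removeNth_castSucc_snoc, tdeg_snoc, sum_Ioi_castSucc_snoc, A.ε.add_right,
      A.ε.add_right]
    simp
  have h := R.rhoElt_snoc_brElt a (i.removeNth X) hA y (F 0 [X i])
  rw [hF.compat] at h
  rw [cobd_zero_ofFn, neg_add_eq_zero]
  simp only [tailSeq, List.getD_cons_zero, hc, map_smul, twTup_zero]
  have h1 : F 1 [A.twTup 1 X i] = F (0 + 1) ([X i].map A.twElt) := rfl
  rw [h1, h, Finset.smul_sum]
  refine Finset.sum_congr rfl fun k _ => ?_
  rw [smul_smul, smul_smul]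
  congr 1
  rw [coef, coef, brElt_deg, tdeg_eq_add_removeNth k y, tdeg_eq_add_removeNth i X]
  simp only [A.ε.add_right, A.ε.add_left]
  ring

/-- The twisted Lie derivatives satisfy the `ε`-Leibniz identity of fundamental objects. -/
theorem lie_lieSeq (hA : A.IsMultiplicative) (a : ℕ) (ξ : Γ) (X Y : Fin (r + 1) → HomElt 𝒢)
    (w : List (HomElt 𝒢)) (F : ℕ → List (HomElt 𝒢) → M) (hF : R.IsTwistedSeq w.length F) :
    A.ε.app (tdeg X) (tdeg Y) • R.lie (a + 1) (ξ + tdeg Y) X w (R.lieSeq a ξ Y F) =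
      R.lie (a + 1) (ξ + tdeg X) Y w (R.lieSeq a ξ X F) +
        A.evalAct X Y (fun U => R.lie a ξ U (w.map A.twElt) (shift 1 F)) := by
  have e1 : ∀ (b : ℕ) (η : Γ) (X Y : Fin (r + 1) → HomElt 𝒢),
      R.lie b η X w (R.lieSeq a ξ Y F) =
      A.ε.app η (tdeg X) • R.rhoElt b X (A.ε.app ξ (tdeg Y) • R.rhoElt a Y (F 0 w) -
        A.der M Y w (F 1)) - (A.ε.app ξ (tdeg Y) • R.rhoElt (a + 1) Y (A.der M X w (F 1)) -
          A.der M X w (fun w' => A.der M (A.twTup 1 Y) w' (F 2))) := by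
    intro b η X Y
    have e : R.lieSeq a ξ Y F 1 = A.ε.app ξ (tdeg Y) • (fun w' => R.rhoElt (a + 1) Y (F 1 w')) -
        fun w' => A.der M (A.twTup 1 Y) w' (F 2) := by
      funext w'
      rw [lieSeq_apply]
      rfl
    rw [lie_apply, lieSeq_apply, e, (A.der M X w).map_sub, (A.der M X w).map_smul, der_comp]
    rfl
  have e2 : A.evalAct X Y (fun U => R.lie a ξ U (w.map A.twElt) (shift 1 F)) =
      (A.ε.app ξ (tdeg X) * A.ε.app ξ (tdeg Y)) •
        A.evalAct X Y (fun U => R.rhoElt a U (F 1 (w.map A.twElt))) -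
      A.evalAct X Y (fun U => A.der M U (w.map A.twElt) (F 2)) := by
    rw [← evalAct_smul, ← evalAct_sub]
    refine evalAct_congr _ _ _ _ _ fun k => ?_
    rw [lie_apply, tdeg_act, A.ε.add_right]
    rfl
  have h1 := hA.der_der X Y w (F 2) (hF.linear 2)
  have h2 := R.rhoElt_rhoElt hA a X Y (F 0 w)
  rw [hF.compat, zero_add] at h2
  rw [e1, e1, e2]
  simp only [map_sub, map_smul, h1, h2, smul_sub, smul_add, smul_smul, A.ε.add_left]
  have h := A.ε.swap_mul (tdeg X) (tdeg Y)
  match_scalars <;> try ring1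
  · linear_combination (A.ε.app ξ (tdeg X) * A.ε.app ξ (tdeg Y)) * h
  · linear_combination
      (A.ε.app ξ (tdeg X) * A.ε.app ξ (tdeg Y) * A.ε.app (tdeg X) (tdeg Y)) * h
  · linear_combination (-A.ε.app ξ (tdeg X)) * h

/-- The contraction of a Lie derivative: `ε(X, Y) L_X ι_Y - ι_Y L_X` is the contraction with
`[X, Y]_α`. -/
theorem contr_lieSeq (hA : A.IsMultiplicative) (a : ℕ) (ξ : Γ) (X Y : Fin (r + 1) → HomElt 𝒢)
    (F : ℕ → List (HomElt 𝒢) → M) :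
    A.contr M Y (R.lieSeq a ξ X F) =
      A.ε.app (tdeg X) (tdeg Y) • R.lieSeq a (ξ + tdeg Y) X (A.contr M Y F) -
        A.evalAct X Y (fun U k w => A.contr M U (shift 1 F) k (w.map A.twElt)) := by
  funext k w
  have e1 : (A.evalAct X Y fun U k w => A.contr M U (shift 1 F) k (w.map A.twElt) :
      ℕ → List (HomElt 𝒢) → M) k w =
      A.evalAct X Y (fun U => F (1 + k) (List.ofFn (A.twTup k U) ++ w.map A.twElt)) := by
    simp [evalAct, contr_apply, shift]
  rw [contr_apply, lieSeq_apply, der_append, der_ofFn, Pi.sub_apply, Pi.sub_apply, e1,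
    Pi.smul_apply, Pi.smul_apply, lieSeq_apply, tdeg_twTup, wdeg_ofFn, tdeg_twTup,
    hA.evalAct_twTup, map_twElt_ofFn, twTup_twTup, add_comm 1 k, A.ε.add_left]
  simp only [contr_apply]
  have h := A.ε.swap_mul (tdeg X) (tdeg Y)
  rw [smul_sub, smul_smul, show A.ε.app (tdeg X) (tdeg Y) * (A.ε.app ξ (tdeg X) *
    A.ε.app (tdeg Y) (tdeg X)) = A.ε.app ξ (tdeg X) by
      linear_combination A.ε.app ξ (tdeg X) * h]
  have e2 : (A.der M (A.twTup k X) w fun v' => F (k + 1) (List.ofFn (A.twTup (k + 1) Y) ++ v')) =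
    A.der M (A.twTup k X) w (A.contr M Y F (k + 1)) := rfl
  rw [e2]
  abel

/-- The Lie derivative commutes with the coboundary. Contracted with a block `Y`, both sides are
expanded by Cartan's formula; the terms with two Lie derivatives agree by `lie_lieSeq`, those with
one by induction, and the remaining ones contain the contraction with `[X, Y]_α`. -/
theorem lie_cobdSeq (hA : A.IsMultiplicative) (a q : ℕ) (ξ : Γ) (X : Fin (r + 1) → HomElt 𝒢)
    (w : List (HomElt 𝒢)) (F : ℕ → List (HomElt 𝒢) → M)
    (hF : R.IsTwistedSeq (q * (r + 1) + 1) F) (hw : w.length = (q + 1) * (r + 1) + 1) :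
    R.lie (a + 1) ξ X w (R.cobdSeq a q ξ F) =
      R.cobd (a + 1) q (ξ + tdeg X) w (R.lieSeq a ξ X F) := by
  induction q generalizing ξ w F with
  | zero =>
    obtain ⟨y, rfl⟩ := exists_ofFn (m := r + 2) w (by rw [hw]; ring)
    exact R.lie_cobdSeq_zero hA a ξ X y F (by simpa using hF)
  | succ q ih =>
    obtain ⟨Y, w, rfl⟩ := exists_ofFn_append (m := r + 1) w (by rw [hw]; nlinarith)
    have hw' : w.length = (q + 1) * (r + 1) + 1 := by
      simp only [List.length_append, List.length_ofFn] at hw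
      linarith
    have hF' : R.IsTwistedSeq (r + 1 + (q * (r + 1) + 1)) F := by
      convert hF using 1
      ring
    have ih' := ih (ξ + tdeg Y) w (A.contr M Y F) (hF'.contr Y) hw'
    have hll := R.lie_lieSeq hA a ξ X Y w F (hw' ▸ hF)
    have e1 : R.lie (a + 1) ξ X (List.ofFn Y ++ w) (R.cobdSeq a (q + 1) ξ F) =
        A.ε.app (tdeg X) (tdeg Y) • R.lie (a + 1) (ξ + tdeg Y) X w
          (R.lieSeq a ξ Y F - R.cobdSeq a q (ξ + tdeg Y) (A.contr M Y F)) -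
        A.evalAct X Y (fun U => R.cobd a (q + 1) ξ (List.ofFn U ++ w.map A.twElt) (shift 1 F)) := by
      rw [← contr_cobdSeq_succ, lie_apply, lie_apply, der_append, der_ofFn, wdeg_ofFn,
        map_twElt_ofFn, A.ε.add_left, smul_sub, smul_smul]
      have h := A.ε.swap_mul (tdeg X) (tdeg Y)
      rw [show A.ε.app (tdeg X) (tdeg Y) * (A.ε.app ξ (tdeg X) *
        A.ε.app (tdeg Y) (tdeg X)) = A.ε.app ξ (tdeg X) by
          linear_combination A.ε.app ξ (tdeg X) * h]
      rw [contr_apply, twTup_zero]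
      have e2 : (A.der M X w fun v' => R.cobdSeq a (q + 1) ξ F 1
          (List.ofFn (A.twTup 1 Y) ++ v')) =
        A.der M X w (A.contr M Y (R.cobdSeq a (q + 1) ξ F) 1) := rfl
      rw [e2]
      simp only [cobdSeq]
      abel
    have e2 : A.evalAct X Y
          (fun U => R.cobd a (q + 1) ξ (List.ofFn U ++ w.map A.twElt) (shift 1 F)) =
        A.evalAct X Y (fun U => R.lie a ξ U (w.map A.twElt) (shift 1 F)) -
        A.evalAct X Y (fun U => R.cobd (a + 1) q (ξ + tdeg X + tdeg Y) w
          (fun k w' => A.contr M U (shift 1 F) k (w'.map A.twElt))) := by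
      rw [← evalAct_sub]
      refine evalAct_congr _ _ _ _ _ fun k => ?_
      rw [cobd_succ_append, cobd_map_twElt R hA _ _ _ _ _ hw', tdeg_act, add_assoc]
    rw [e1, e2, cobd_succ_append, contr_lieSeq R hA, map_sub, map_sub, map_smul, ← evalAct_map,
      smul_sub, hll, ih', show ξ + tdeg X + tdeg Y = ξ + tdeg Y + tdeg X by abel]
    abel

/-- The coboundary squares to zero. -/
theorem cobd_cobdSeq (hA : A.IsMultiplicative) (a q : ℕ) (ξ : Γ) (w : List (HomElt 𝒢))
    (F : ℕ → List (HomElt 𝒢) → M) (hF : R.IsTwistedSeq (q * (r + 1) + 1) F)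
    (hw : w.length = (q + 2) * (r + 1) + 1) :
    R.cobd (a + 1) (q + 1) ξ w (R.cobdSeq a q ξ F) = 0 := by
  induction q generalizing ξ w F with
  | zero =>
    obtain ⟨X, w, rfl⟩ := exists_ofFn_append (m := r + 1) w (by rw [hw]; nlinarith)
    have hw' : w.length = (0 + 1) * (r + 1) + 1 := by
      simp only [List.length_append, List.length_ofFn] at hw
      linarith
    rw [cobd_succ_append, lie_cobdSeq R hA a 0 ξ X w F hF hw', ← map_sub]
    have e : R.cobd (a + 1) 0 (ξ + tdeg X) w (R.lieSeq a ξ X F -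
        A.contr M X (R.cobdSeq a 0 ξ F)) =
        R.cobd (a + 1) 0 (ξ + tdeg X) w (-∑ i, R.tailSeq a ξ X i F) := by
      refine R.cobd_congr _ _ _ _ _ _ hw' fun k w' hw' => ?_
      obtain ⟨z, rfl⟩ := List.length_eq_one_iff.1 (by simpa using hw')
      rw [Pi.sub_apply, Pi.sub_apply, contr_cobdSeq_zero]
      simp
    rw [e, map_neg, map_sum, neg_eq_zero]
    refine Finset.sum_eq_zero fun i _ => ?_
    obtain ⟨y, rfl⟩ := exists_ofFn (m := r + 2) w (by rw [hw']; ring)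
    exact R.cobd_tailSeq hA a ξ X i F (by simpa using hF) y
  | succ q ih =>
    obtain ⟨X, w, rfl⟩ := exists_ofFn_append (m := r + 1) w (by rw [hw]; nlinarith)
    have hw' : w.length = (q + 2) * (r + 1) + 1 := by
      simp only [List.length_append, List.length_ofFn] at hw
      linarith
    have hF' : R.IsTwistedSeq (r + 1 + (q * (r + 1) + 1)) F := by
      convert hF using 1
      ring
    rw [cobd_succ_append, lie_cobdSeq R hA a (q + 1) ξ X w F hF hw', contr_cobdSeq_succ, map_sub,
      ih _ _ _ (hF'.contr X) hw']
    simp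

end Representation

/-! ### Linearity, twist and degree of the coboundary -/

theorem tup_insert {m : ℕ} (u v : List (HomElt 𝒢)) (h : u.length < m) (c d : HomElt 𝒢) :
    tup m (u ++ c :: v) = Function.update (tup m (u ++ d :: v)) ⟨u.length, h⟩ c := by
  funext i
  by_cases hi : (i : ℕ) = u.length
  · have : i = ⟨u.length, h⟩ := Fin.ext hi
    subst this
    simp [tup]
  · rw [Function.update_of_ne (fun h' => hi (congrArg Fin.val h'))]
    rcases Nat.lt_or_gt_of_ne hi with h' | h'
    · simp [tup, List.getElem?_append_left h']
    · obtain ⟨j, hj⟩ := Nat.exists_eq_add_of_lt h'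
      have e : (i : ℕ) - u.length = j + 1 := by omega
      simp [tup, List.getElem?_append_right h'.le, e]

theorem tup_swap {m : ℕ} (u v : List (HomElt 𝒢)) (i j : Fin m) (hi : (i : ℕ) = u.length)
    (hj : (j : ℕ) = u.length + 1) (a b : HomElt 𝒢) :
    tup m (u ++ b :: a :: v) = tup m (u ++ a :: b :: v) ∘ Equiv.swap i j := by
  have hij : i ≠ j := by
    intro h
    rw [h] at hi
    omega
  funext t
  rw [Function.comp_apply]
  by_cases h1 : t = i
  · subst h1
    simp [tup, hi, hj]
  by_cases h2 : t = j
  · subst h2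
    simp [tup, hi, hj]
  rw [Equiv.swap_apply_of_ne_of_ne h1 h2]
  have h1' : (t : ℕ) ≠ u.length := fun h => h1 (Fin.ext (h.trans hi.symm))
  have h2' : (t : ℕ) ≠ u.length + 1 := fun h => h2 (Fin.ext (h.trans hj.symm))
  rcases Nat.lt_or_gt_of_ne h1' with h' | h'
  · simp [tup, List.getElem?_append_left h']
  · obtain ⟨l, hl⟩ : ∃ l, (t : ℕ) - u.length = l + 2 := ⟨(t : ℕ) - u.length - 2, by omega⟩
    simp [tup, List.getElem?_append_right h'.le, hl]

theorem tdeg_update {m : ℕ} (X : Fin m → HomElt 𝒢) (i : Fin m) (a c : HomElt 𝒢)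
    (h : a.deg = c.deg) : tdeg (Function.update X i a) = tdeg (Function.update X i c) := by
  refine Finset.sum_congr rfl fun t _ => ?_
  by_cases ht : t = i
  · subst ht; simpa
  · simp [ht]

omit [AddCommGroup Γ] in
theorem vals_update {m : ℕ} (X : Fin m → HomElt 𝒢) (i : Fin m) (a : HomElt 𝒢) :
    vals (Function.update X i a) = Function.update (vals X) i a.val := by
  funext t
  by_cases ht : t = i
  · subst ht; simp [vals]
  · simp [vals, ht]

theorem twTup_update (k : ℕ) {m : ℕ} (X : Fin m → HomElt 𝒢) (i : Fin m) (a : HomElt 𝒢) :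
    A.twTup k (Function.update X i a) = Function.update (A.twTup k X) i (A.twElt^[k] a) := by
  funext t
  by_cases ht : t = i
  · subst ht; simp [twTup]
  · simp [twTup, ht]

theorem twElt_iterate_comb (k : ℕ) (s t : K) (a b c : HomElt 𝒢)
    (hc : c.val = s • a.val + t • b.val) :
    (A.twElt^[k] c).val = s • (A.twElt^[k] a).val + t • (A.twElt^[k] b).val := by
  induction k with
  | zero => exact hc
  | succ k ih => simp only [Function.iterate_succ_apply', twElt_val, ih, map_add, map_smul]

omit [AddCommGroup Γ] in
theorem ofFn_update_eq {m : ℕ} (X : Fin m → HomElt 𝒢) (i : Fin m) :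
    ∃ u v : List (HomElt 𝒢), u.length = i ∧ u.length + v.length + 1 = m ∧
      ∀ c, List.ofFn (Function.update X i c) = u ++ c :: v := by
  refine ⟨(List.ofFn X).take i, (List.ofFn X).drop (i + 1), by simp, by simp; omega, fun c => ?_⟩
  have h : List.ofFn (Function.update X i c) = (List.ofFn X).set i c := by
    refine List.ext_getElem (by simp) fun j h1 h2 => ?_
    simp [List.getElem_set, Function.update_apply, Fin.ext_iff, eq_comm]
  rw [h, List.set_eq_take_append_cons_drop, if_pos (by simp)]

theorem adElt_update_comb (X : Fin (r + 1) → HomElt 𝒢) (i : Fin (r + 1)) (y : HomElt 𝒢) (s t : K)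
    (a b c : HomElt 𝒢) (hc : c.val = s • a.val + t • b.val) :
    (A.adElt (Function.update X i c) y).val = s • (A.adElt (Function.update X i a) y).val +
      t • (A.adElt (Function.update X i b) y).val := by
  simp only [adElt_val, ad, vals_update, hc]
  simp only [Fin.snoc_update, MultilinearMap.map_update_add, MultilinearMap.map_update_smul]

theorem adElt_comb (X : Fin (r + 1) → HomElt 𝒢) (s t : K)
    (a b c : HomElt 𝒢) (hc : c.val = s • a.val + t • b.val) :
    (A.adElt X c).val = s • (A.adElt X a).val + t • (A.adElt X b).val := by
  have h : ∀ z, (Fin.snoc (vals X) z : Fin (r + 2) → g) =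
      Function.update (Fin.snoc (vals X) 0) (Fin.last (r + 1)) z := by
    intro z
    rw [Fin.update_snoc_last]
  simp only [adElt_val, ad]
  rw [h c.val, h a.val, h b.val, hc]
  simp only [MultilinearMap.map_update_add, MultilinearMap.map_update_smul]

theorem der_wordLinear (X : Fin (r + 1) → HomElt 𝒢) {N : ℕ} {G : List (HomElt 𝒢) → M}
    (hG : WordLinear N G) : WordLinear N (fun w => A.der M X w G) := by
  refine WordLinear.of_comb fun u v s t a b c hl ha hb hc => ?_
  have h1 : ∀ u' : List (HomElt 𝒢), u'.length = u.length →
      G (u' ++ (c :: v).map A.twElt) =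
        s • G (u' ++ (a :: v).map A.twElt) + t • G (u' ++ (b :: v).map A.twElt) := by
    intro u' hu'
    exact hG.comb u' (v.map A.twElt) (by simpa [hu'] using hl) s t _ _ _ ha hb
      (twElt_iterate_comb 1 s t a b c hc)
  have h2 := hG.comb (u.map A.twElt) (v.map A.twElt) (by simpa using hl) s t (A.adElt X a)
    (A.adElt X b) (A.adElt X c) (by simp [ha]) (by simp [hb]) (adElt_comb X s t a b c hc)
  have h3 : ∀ v' : List (HomElt 𝒢), v'.length = v.length →
      G (u.map A.twElt ++ A.twElt c :: v') =
        s • G (u.map A.twElt ++ A.twElt a :: v') + t • G (u.map A.twElt ++ A.twElt b :: v') := by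
    intro v' hv'
    exact hG.comb _ v' (by simpa [hv'] using hl) s t _ _ _ ha hb
      (twElt_iterate_comb 1 s t a b c hc)
  simp only [der_append, der_cons]
  rw [A.der_congr X u _ (s • (fun u' => G (u' ++ (a :: v).map A.twElt)) +
      t • (fun u' => G (u' ++ (b :: v).map A.twElt))) fun u' hu' => h1 u' hu',
    A.der_congr X v (fun w' => G (u.map A.twElt ++ A.twElt c :: w'))
      (s • (fun v' => G (u.map A.twElt ++ A.twElt a :: v')) +
      t • (fun v' => G (u.map A.twElt ++ A.twElt b :: v'))) fun u' hu' => h3 u' hu', h2]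
  simp only [map_add, map_smul, ha, hb]
  module

theorem der_update_comb (X : Fin (r + 1) → HomElt 𝒢) (i : Fin (r + 1)) (w : List (HomElt 𝒢))
    {G : List (HomElt 𝒢) → M} (hG : WordLinear w.length G) (s t : K) (a b c : HomElt 𝒢)
    (ha : a.deg = c.deg) (hb : b.deg = c.deg) (hc : c.val = s • a.val + t • b.val) :
    A.der M (Function.update X i c) w G =
      s • A.der M (Function.update X i a) w G + t • A.der M (Function.update X i b) w G := by
  induction w generalizing G with
  | nil => simp [der_nil]
  | cons y w ih =>
    have hG' : WordLinear w.length (fun w' => G ([A.twElt y] ++ w')) :=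
      WordLinear.append (by simpa [add_comm] using hG)
    have h := hG.comb [] (w.map A.twElt) (by simp) s t (A.adElt (Function.update X i a) y)
      (A.adElt (Function.update X i b) y) (A.adElt (Function.update X i c) y)
      (by simp [tdeg_update X i a c ha]) (by simp [tdeg_update X i b c hb])
      (adElt_update_comb X i y s t a b c hc)
    have ih' := ih hG'
    simp only [List.nil_append, List.singleton_append] at h ih'
    rw [der_cons, der_cons, der_cons, h, ih', tdeg_update X i a c ha, tdeg_update X i b c hb]
    module

namespace Representation

variable (R : A.Representation ℳ)

theorem rhoElt_update_comb (k : ℕ) (X : Fin (r + 1) → HomElt 𝒢) (i : Fin (r + 1)) (s t : K)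
    (a b c : HomElt 𝒢) (hc : c.val = s • a.val + t • b.val) (m : M) :
    R.rhoElt k (Function.update X i c) m =
      s • R.rhoElt k (Function.update X i a) m + t • R.rhoElt k (Function.update X i b) m := by
  simp only [rhoElt_eq, twTup_update, vals_update, twElt_iterate_comb k s t a b c hc]
  simp only [MultilinearMap.map_update_add, MultilinearMap.map_update_smul, LinearMap.add_apply,
    LinearMap.smul_apply]

/-- The coboundary preserves linearity in every letter. -/
theorem cobd_wordLinear (a q : ℕ) (ξ : Γ) (F : ℕ → List (HomElt 𝒢) → M)
    (hF : ∀ k, WordLinear (q * (r + 1) + 1) (F k)) :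
    WordLinear ((q + 1) * (r + 1) + 1) (fun w => R.cobd a q ξ w F) := by
  induction q generalizing ξ F with
  | zero =>
    refine WordLinear.of_comb fun u v s t x y z hl hx hy hz => ?_
    have hlt : u.length < r + 2 := by omega
    obtain ⟨Y, p, hY⟩ : ∃ (Y : Fin (r + 2) → HomElt 𝒢) (p : Fin (r + 2)), ∀ c,
        tup (r + 2) (u ++ c :: v) = Function.update Y p c :=
      ⟨_, _, fun c => tup_insert u v hlt c default⟩
    have e : ∀ c, R.cobd a 0 ξ (u ++ c :: v) F = -F 1 [A.brElt (Function.update Y p c)] +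
        ∑ k : Fin (r + 2), coef A ξ k (Function.update Y p c) •
          R.rhoElt a (k.removeNth (Function.update Y p c)) (F 0 [Function.update Y p c k]) := by
      intro c
      rw [← hY, ← cobd_zero_ofFn]
      congr 1
      obtain ⟨W, hW⟩ := exists_ofFn (m := r + 2) (u ++ c :: v) (by simp; omega)
      rw [hW, tup_ofFn]
    have h1 := (hF 1).comb [] [] (by simp) s t (A.brElt (Function.update Y p x))
      (A.brElt (Function.update Y p y)) (A.brElt (Function.update Y p z))
      (by simp [tdeg_update Y p x z hx]) (by simp [tdeg_update Y p y z hy])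
      (by simp only [brElt_val, vals_update, hz, MultilinearMap.map_update_add,
            MultilinearMap.map_update_smul])
    have hd : ∀ c, c.deg = z.deg → ∀ l, (Function.update Y p c l).deg =
        (Function.update Y p z l).deg := by
      intro c hc l
      by_cases hl : l = p
      · subst hl; simpa
      · simp [hl]
    have hcoef : ∀ c, c.deg = z.deg → ∀ k, coef A ξ k (Function.update Y p c) =
        coef A ξ k (Function.update Y p z) := by
      intro c hc k
      simp only [coef, tdeg, Fin.removeNth, hd c hc]
    have h2 : ∀ k : Fin (r + 2),
        R.rhoElt a (k.removeNth (Function.update Y p z)) (F 0 [Function.update Y p z k]) =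
        s • R.rhoElt a (k.removeNth (Function.update Y p x)) (F 0 [Function.update Y p x k]) +
        t • R.rhoElt a (k.removeNth (Function.update Y p y)) (F 0 [Function.update Y p y k]) := by
      intro k
      rcases eq_or_ne p k with rfl | hk
      · have h := (hF 0).comb [] [] (by simp) s t x y z hx hy hz
        simp only [List.nil_append] at h
        simp only [Fin.removeNth_update, Function.update_self, h, map_add, map_smul]
      · obtain ⟨p, rfl⟩ := Fin.exists_succAbove_eq hk
        simp only [Fin.removeNth_update_succAbove, Function.update_of_ne hk.symm]
        exact R.rhoElt_update_comb a _ p s t x y z hz _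
    simp only [List.nil_append] at h1
    rw [e, e, e, h1, Finset.sum_congr rfl fun k _ => by rw [h2 k]]
    simp only [hcoef x hx, hcoef y hy, smul_add, smul_neg, Finset.smul_sum,
      Finset.sum_add_distrib, smul_comm s, smul_comm t]
    module
  | succ q ih =>
    refine WordLinear.of_comb fun u v s t x y z hl hx hy hz => ?_
    have hN : r + 1 + (q * (r + 1) + 1) = (q + 1) * (r + 1) + 1 := by ring
    rcases Nat.lt_or_ge u.length (r + 1) with hu | hu
    · obtain ⟨X, p, hX⟩ : ∃ (X : Fin (r + 1) → HomElt 𝒢) (p : Fin (r + 1)), ∀ c,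
          tup (r + 1) (u ++ c :: v) = Function.update X p c :=
        ⟨_, _, fun c => tup_insert u v hu c default⟩
      obtain ⟨w, hw⟩ : ∃ w, ∀ c, (u ++ c :: v).drop (r + 1) = w := by
        refine ⟨v.drop (r - u.length), fun c => ?_⟩
        rw [List.drop_append, List.drop_eq_nil_of_le hu.le, List.nil_append,
          show r + 1 - u.length = r - u.length + 1 by omega, List.drop_succ_cons]
      have hwl : w.length = (q + 1) * (r + 1) + 1 := by
        rw [← hw z]
        simp only [List.length_drop, List.length_append, List.length_cons]
        have : (q + 1 + 1) * (r + 1) + 1 = (q + 1) * (r + 1) + 1 + (r + 1) := by ring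
        omega
      simp only [cobd, LinearMap.sub_apply, LinearMap.comp_apply, hX, hw, lie_apply]
      rw [R.rhoElt_update_comb a X p s t x y z hz,
        der_update_comb X p w (hwl ▸ hF 1) s t x y z hx hy hz,
        R.cobd_congr a q _ w (A.contr M (Function.update X p z) F)
          (s • A.contr M (Function.update X p x) F + t • A.contr M (Function.update X p y) F) hwl,
        tdeg_update X p x z hx, tdeg_update X p y z hy, map_add, map_smul, map_smul]
      · module
      · intro k w' hw'
        obtain ⟨u', v', -, hl', hc'⟩ := ofFn_update_eq (A.twTup k X) p
        simp only [Pi.add_apply, Pi.smul_apply, contr_apply, twTup_update, hc', List.append_assoc,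
          List.cons_append]
        exact (hF k).comb u' (v' ++ w') (by simp [hw']; linarith) s t _ _ _ (by simpa) (by simpa)
          (twElt_iterate_comb k s t x y z hz)
    · obtain ⟨X, u, rfl⟩ := exists_ofFn_append (m := r + 1) u hu
      have hul : u.length + v.length + 1 = (q + 1) * (r + 1) + 1 := by
        simp only [List.length_append, List.length_ofFn] at hl
        linarith
      have h1 := (hF 0).comb u v hul s t x y z hx hy hz
      have h2 := (der_wordLinear (A := A) X (hF 1)).comb u v hul s t x y z hx hy hz
      have h3 := (ih (ξ + tdeg X) (A.contr M X F)
        fun k => WordLinear.append (by simpa [hN] using hF k)).comb u v hul s t x y z hx hy hz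
      simp only [List.append_assoc, cobd_succ_append, lie_apply, h1, h2, h3, map_add, map_smul]
      module

/-- The coboundary preserves compatibility with the twist maps. -/
theorem mu_cobd (hA : A.IsMultiplicative) (a q : ℕ) (ξ : Γ) (F : ℕ → List (HomElt 𝒢) → M)
    (hF : ∀ k w, R.μ (F k w) = F (k + 1) (w.map A.twElt)) (w : List (HomElt 𝒢))
    (hw : w.length = (q + 1) * (r + 1) + 1) :
    R.μ (R.cobd a q ξ w F) = R.cobd a q ξ (w.map A.twElt) (shift 1 F) := by
  induction q generalizing ξ F w with
  | zero =>
    obtain ⟨y, rfl⟩ := exists_ofFn (m := r + 2) w (by rw [hw]; ring)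
    rw [map_twElt_ofFn, cobd_zero_ofFn, cobd_zero_ofFn, map_add, map_neg, map_sum, hF]
    congr 1
    · simp only [List.map_cons, List.map_nil, hA.twElt_brElt, shift]
    · refine Finset.sum_congr rfl fun k _ => ?_
      rw [map_smul, mu_rhoElt, hF]
      have e : k.removeNth (A.twTup 1 y) = A.twTup 1 (k.removeNth y) := rfl
      rw [e, rhoElt_twTup]
      rfl
  | succ q ih =>
    obtain ⟨X, w, rfl⟩ := exists_ofFn_append (m := r + 1) w (by rw [hw]; nlinarith)
    have hw' : w.length = (q + 1) * (r + 1) + 1 := by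
      simp only [List.length_append, List.length_ofFn] at hw
      linarith
    rw [List.map_append, map_twElt_ofFn, cobd_succ_append, cobd_succ_append, lie_apply, lie_apply,
      map_sub, map_sub, map_smul, mu_rhoElt, hF, ← der_comp, hA.der_twTup, tdeg_twTup,
      rhoElt_twTup, ih _ _ _ _ hw']
    · simp only [hF]
      congr 2
      funext k w'
      simp only [contr_apply, shift, twTup_twTup, add_comm k 1]
    · intro k w'
      rw [contr_apply, hF, List.map_append, map_twElt_ofFn, twTup_twTup, add_comm 1 k]
      rfl

theorem der_mem {N : ℕ} (ξ : Γ) (G : List (HomElt 𝒢) → M)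
    (X : Fin (r + 1) → HomElt 𝒢) (w : List (HomElt 𝒢)) (hw : w.length = N)
    (hG : ∀ w, w.length = N → G w ∈ ℳ (ξ + wdeg w)) :
    A.der M X w G ∈ ℳ (ξ + tdeg X + wdeg w) := by
  induction w generalizing N G ξ with
  | nil => simp [der_nil]
  | cons y w ih =>
    rw [der_cons]
    refine add_mem ?_ (Submodule.smul_mem _ _ ?_)
    · have h := hG (A.adElt X y :: w.map A.twElt) (by simpa using hw)
      rw [wdeg_cons, wdeg_map_twElt, adElt_deg] at h
      rwa [wdeg_cons, add_assoc ξ, ← add_assoc (tdeg X)]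
    · have h := ih (N := w.length) (ξ + y.deg) (fun w' => G (A.twElt y :: w')) rfl fun w' hw' => by
        have h := hG (A.twElt y :: w') (by simpa [hw'] using hw)
        rwa [wdeg_cons, twElt_deg, ← add_assoc] at h
      rw [wdeg_cons]
      convert h using 2
      abel

/-- The coboundary preserves the degree. -/
theorem cobd_mem (a q : ℕ) (ξ : Γ) (F : ℕ → List (HomElt 𝒢) → M)
    (hF : ∀ k w, w.length = q * (r + 1) + 1 → F k w ∈ ℳ (ξ + wdeg w)) (w : List (HomElt 𝒢))
    (hw : w.length = (q + 1) * (r + 1) + 1) : R.cobd a q ξ w F ∈ ℳ (ξ + wdeg w) := by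
  have hrho : ∀ (X : Fin (r + 1) → HomElt 𝒢) (γ : Γ) (m : M), m ∈ ℳ γ →
      R.rhoElt a X m ∈ ℳ (tdeg X + γ) := by
    intro X γ m hm
    rw [rhoElt_eq, ← A.tdeg_twTup a]
    exact R.ρ_mem _ _ _ _ (fun t => (A.twTup a X t).mem) hm
  induction q generalizing ξ F w with
  | zero =>
    obtain ⟨y, rfl⟩ := exists_ofFn (m := r + 2) w (by rw [hw]; ring)
    rw [cobd_zero_ofFn, wdeg_ofFn]
    refine add_mem (neg_mem ?_) (Submodule.sum_mem _ fun k _ => Submodule.smul_mem _ _ ?_)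
    · simpa using hF 1 [A.brElt y] (by simp)
    · have h := hrho (k.removeNth y) _ _ (hF 0 [y k] (by simp))
      rw [tdeg_eq_add_removeNth k y]
      convert h using 2
      simp only [wdeg_cons, wdeg_nil]
      abel
  | succ q ih =>
    obtain ⟨X, w, rfl⟩ := exists_ofFn_append (m := r + 1) w (by rw [hw]; nlinarith)
    have hw' : w.length = (q + 1) * (r + 1) + 1 := by
      simp only [List.length_append, List.length_ofFn] at hw
      linarith
    rw [cobd_succ_append, lie_apply, wdeg_append, wdeg_ofFn, ← add_assoc]
    refine sub_mem (sub_mem (Submodule.smul_mem _ _ ?_) ?_) ?_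
    · have h := hrho X _ _ (hF 0 w hw')
      convert h using 2
      abel
    · exact der_mem ξ (F 1) X w hw' (hF 1)
    · refine ih _ _ (fun k w' hw' => ?_) _ hw'
      have h := hF k (List.ofFn (A.twTup k X) ++ w') (by
        simp only [List.length_append, List.length_ofFn, hw']
        ring)
      rwa [wdeg_append, wdeg_ofFn, tdeg_twTup, ← add_assoc] at h

end Representation

/-! ### Skew-symmetry of the coboundary -/

/-- `G` is `ε`-skew-symmetric in the letters `t` and `t + 1` (counted from `0`) of words of
length `N`. -/
def SkewAt (ε : Bicharacter Γ K) (N t : ℕ) (G : List (HomElt 𝒢) → M) : Prop :=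
  ∀ (u v : List (HomElt 𝒢)) (a b : HomElt 𝒢), u.length = t → u.length + v.length + 2 = N →
    G (u ++ a :: b :: v) = -(ε.app a.deg b.deg • G (u ++ b :: a :: v))

/-- The letters `t` and `t + 1` of a word of `q` blocks of length `r + 1` and a further letter are
two entries of the same block, or two of the last `r + 2` letters. -/
def SkewPos (r : ℕ) : ℕ → ℕ → Prop
  | 0, _ => False
  | 1, t => t < r + 1
  | q + 2, t => t < r ∨ ∃ s, t = s + (r + 1) ∧ SkewPos r (q + 1) s

theorem ofFn_tup {m : ℕ} (w : List (HomElt 𝒢)) (h : w.length = m) : List.ofFn (tup m w) = w := by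
  obtain ⟨Y, rfl⟩ := exists_ofFn w h
  rw [tup_ofFn]

/-- The words of a tuple before and after an interchange of two adjacent entries. -/
theorem ofFn_swap {m : ℕ} (Y : Fin m → HomElt 𝒢) (i j : Fin m) (h : (j : ℕ) = i + 1) :
    ∃ u v : List (HomElt 𝒢), u.length = i ∧ u.length + v.length + 2 = m ∧
      List.ofFn Y = u ++ Y i :: Y j :: v ∧
      List.ofFn (Y ∘ Equiv.swap i j) = u ++ Y j :: Y i :: v := by
  have hj := j.2
  have hsplit : List.ofFn Y = (List.ofFn Y).take i ++ Y i :: Y j :: (List.ofFn Y).drop (i + 2) := by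
    conv_lhs => rw [← List.take_append_drop i (List.ofFn Y)]
    rw [List.drop_eq_getElem_cons (by simp), List.drop_eq_getElem_cons (by simp; omega)]
    simp [← h]
    omega
  have hlen : ((List.ofFn Y).take i).length = i := by simp
  refine ⟨_, _, hlen, by simp; omega, hsplit, ?_⟩
  have h1 := tup_swap ((List.ofFn Y).take i) ((List.ofFn Y).drop (i + 2)) i j hlen.symm
    (by rw [hlen, h]) (Y i) (Y j)
  rw [← hsplit, tup_ofFn] at h1
  rw [← h1, ofFn_tup]
  simp
  omega

theorem der_skewAt (X : Fin (r + 1) → HomElt 𝒢) {N t : ℕ} {G : List (HomElt 𝒢) → M}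
    (hG : SkewAt A.ε N t G) : SkewAt A.ε N t (fun w => A.der M X w G) := by
  intro u v a b hu hl
  have h1 : ∀ u' : List (HomElt 𝒢), u'.length = u.length →
      G (u' ++ (a :: b :: v).map A.twElt) =
        -(A.ε.app a.deg b.deg • G (u' ++ (b :: a :: v).map A.twElt)) := fun u' hu' =>
    hG u' (v.map A.twElt) _ _ (hu'.trans hu) (by simpa [hu'] using hl)
  have h2 : ∀ v' : List (HomElt 𝒢), v'.length = v.length → ∀ c d : HomElt 𝒢,
      G (u.map A.twElt ++ c :: d :: v') =
        -(A.ε.app c.deg d.deg • G (u.map A.twElt ++ d :: c :: v')) := fun v' hv' c d =>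
    hG _ v' _ _ (by simpa using hu) (by simpa [hv'] using hl)
  simp only [der_append, der_cons]
  rw [A.der_congr X u _ (-(A.ε.app a.deg b.deg •
      fun u' => G (u' ++ (b :: a :: v).map A.twElt))) fun u' hu' => h1 u' hu',
    A.der_congr X v (fun w' => G (u.map A.twElt ++ A.twElt a :: A.twElt b :: w'))
      (-(A.ε.app a.deg b.deg •
        fun w' => G (u.map A.twElt ++ A.twElt b :: A.twElt a :: w'))) fun v' hv' => h2 v' hv' _ _]
  simp only [List.map_cons]
  rw [h2 _ (by simp) _ (A.twElt b), h2 _ (by simp) _ (A.adElt X b)]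
  simp only [map_neg, map_smul, twElt_deg, adElt_deg, A.ε.add_left, A.ε.add_right]
  have h := A.ε.swap_mul a.deg (tdeg X)
  match_scalars <;> try ring1
  linear_combination (-A.ε.app (tdeg X) (wdeg u) * A.ε.app a.deg b.deg) * h

theorem tdeg_comp_swap {m : ℕ} (X : Fin m → HomElt 𝒢) (σ : Equiv.Perm (Fin m)) :
    tdeg (X ∘ σ) = tdeg X := Equiv.sum_comp σ fun t => (X t).deg

theorem brElt_swap (y : Fin (r + 2) → HomElt 𝒢) (i j : Fin (r + 2)) (h : (j : ℕ) = i + 1) :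
    (A.brElt y).val = (-A.ε.app (y i).deg (y j).deg) • (A.brElt (y ∘ Equiv.swap i j)).val := by
  rw [brElt_val, brElt_val, neg_smul]
  exact colorSkew_vals A.skew y i j h

theorem adElt_swap (X : Fin (r + 1) → HomElt 𝒢) (i j : Fin (r + 1)) (h : (j : ℕ) = i + 1)
    (y : HomElt 𝒢) : (A.adElt X y).val =
      (-A.ε.app (X i).deg (X j).deg) • (A.adElt (X ∘ Equiv.swap i j) y).val := by
  have e : (Fin.snoc X y : Fin (r + 2) → HomElt 𝒢) ∘ Equiv.swap i.castSucc j.castSucc =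
      Fin.snoc (X ∘ Equiv.swap i j) y := by
    funext t
    refine Fin.lastCases ?_ (fun t => ?_) t
    · rw [Function.comp_apply, Equiv.swap_apply_of_ne_of_ne (Fin.castSucc_lt_last i).ne'
        (Fin.castSucc_lt_last j).ne']
      simp
    · rw [Function.comp_apply, (Fin.castSucc_injective (r + 1)).swap_apply]
      simp
  have h' := brElt_swap (A := A) (Fin.snoc X y) i.castSucc j.castSucc (by simpa using h)
  rw [e, brElt_snoc, brElt_snoc] at h'
  simpa using h'

theorem der_swap (X : Fin (r + 1) → HomElt 𝒢) (i j : Fin (r + 1)) (h : (j : ℕ) = i + 1)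
    (w : List (HomElt 𝒢)) {G : List (HomElt 𝒢) → M} (hG : WordLinear w.length G) :
    A.der M X w G =
      (-A.ε.app (X i).deg (X j).deg) • A.der M (X ∘ Equiv.swap i j) w G := by
  induction w generalizing G with
  | nil => simp [der_nil]
  | cons y w ih =>
    have hG' : WordLinear w.length (fun w' => G ([A.twElt y] ++ w')) :=
      WordLinear.append (by simpa [add_comm] using hG)
    have h1 := hG.smul [] (w.map A.twElt) _ (A.adElt (X ∘ Equiv.swap i j) y) (A.adElt X y)
      (by simp) (by simp [tdeg_comp_swap]) (adElt_swap X i j h y)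
    have ih' := ih hG'
    simp only [List.nil_append, List.singleton_append] at h1 ih'
    rw [der_cons, der_cons, h1, ih', tdeg_comp_swap]
    module

namespace Representation

variable (R : A.Representation ℳ)

theorem rhoElt_swap (a : ℕ) (X : Fin (r + 1) → HomElt 𝒢) (i j : Fin (r + 1))
    (h : (j : ℕ) = i + 1) (m : M) : R.rhoElt a X m =
      (-A.ε.app (X i).deg (X j).deg) • R.rhoElt a (X ∘ Equiv.swap i j) m := by
  have h' := LinearMap.congr_fun (colorSkew_vals R.skew (A.twTup a X) i j h) m
  rw [rhoElt_eq, rhoElt_eq, neg_smul]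
  simp only [twTup_apply_deg] at h'
  exact h'

/-- The coboundary of a map in one variable is `ε`-skew-symmetric: interchanging the arguments
`i` and `i + 1` interchanges the corresponding summands and changes the sign of all the others. -/
theorem cobd_zero_swap (a : ℕ) (ξ : Γ) (F : ℕ → List (HomElt 𝒢) → M)
    (hF : ∀ k, WordLinear 1 (F k)) (y : Fin (r + 2) → HomElt 𝒢) (κ : Fin (r + 1)) :
    R.cobd a 0 ξ (List.ofFn y) F = -(A.ε.app (y κ.castSucc).deg (y κ.succ).deg •
      R.cobd a 0 ξ (List.ofFn (y ∘ Equiv.swap κ.castSucc κ.succ)) F) := by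
  have hS : ∀ f : Fin (r + 2) → Γ, ∑ t ∈ Finset.Ioi κ.castSucc, f t =
      f κ.succ + ∑ t ∈ Finset.Ioi κ.succ, f t := by
    intro f
    have e : Finset.Ioi κ.castSucc = Finset.cons κ.succ (Finset.Ioi κ.succ) (by simp) := by
      ext t
      simp only [Finset.mem_Ioi, Finset.mem_cons, Fin.lt_def, Fin.ext_iff, Fin.val_castSucc,
        Fin.val_succ]
      omega
    rw [e, Finset.sum_cons]
  -- the two summands whose omitted argument is moved by the interchange
  have key : ∀ y : Fin (r + 2) → HomElt 𝒢, κ.succ.removeNth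
      (y ∘ Equiv.swap κ.castSucc κ.succ) = κ.castSucc.removeNth y := by
    intro y
    funext t
    rw [Fin.removeNth_apply, Function.comp_apply, swap_succAbove_succ]
    rfl
  have hyy : (y ∘ Equiv.swap κ.castSucc κ.succ) ∘ Equiv.swap κ.castSucc κ.succ = y := by
    funext t
    simp
  have hgt : ∀ f : Fin (r + 2) → Γ, ∑ t ∈ Finset.Ioi κ.succ,
      f (Equiv.swap κ.castSucc κ.succ t) = ∑ t ∈ Finset.Ioi κ.succ, f t := by
    intro f
    refine Finset.sum_congr rfl fun t ht => ?_
    have ht := Finset.mem_Ioi.1 ht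
    rw [Equiv.swap_apply_of_ne_of_ne ((Fin.castSucc_lt_succ).trans ht).ne' ht.ne']
  have hpow : (-1 : K) ^ (r + 1 - (κ : ℕ)) = -(-1) ^ (r + 1 - ((κ : ℕ) + 1)) := by
    rw [show r + 1 - (κ : ℕ) = r + 1 - ((κ : ℕ) + 1) + 1 by omega, pow_succ]
    ring
  have hterm : ∀ k : Fin (r + 2), coef A ξ k y • R.rhoElt a (k.removeNth y) (F 0 [y k]) =
      (-A.ε.app (y κ.castSucc).deg (y κ.succ).deg) •
        (coef A ξ (Equiv.swap κ.castSucc κ.succ k) (y ∘ Equiv.swap κ.castSucc κ.succ) •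
          R.rhoElt a ((Equiv.swap κ.castSucc κ.succ k).removeNth
            (y ∘ Equiv.swap κ.castSucc κ.succ))
            (F 0 [(y ∘ Equiv.swap κ.castSucc κ.succ) (Equiv.swap κ.castSucc κ.succ k)])) := by
    intro k
    rw [Function.comp_apply, Equiv.swap_apply_self]
    rcases eq_or_ne k κ.castSucc with rfl | h1
    · rw [Equiv.swap_apply_left, key, smul_smul]
      congr 1
      rw [coef, coef, key, Function.comp_apply, Equiv.swap_apply_right, hS,
        ← hgt (fun t => (y t).deg), A.ε.add_right]
      simp only [Fin.val_castSucc, Fin.val_succ, hpow, Function.comp_apply]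
      ring
    rcases eq_or_ne k κ.succ with rfl | h2
    · have key' := key (y ∘ Equiv.swap κ.castSucc κ.succ)
      rw [hyy] at key'
      rw [Equiv.swap_apply_right, ← key', smul_smul]
      congr 1
      rw [coef, coef, ← key', Function.comp_apply, Equiv.swap_apply_left, hS]
      simp only [Function.comp_apply, Equiv.swap_apply_right]
      rw [hgt (fun t => (y t).deg), A.ε.add_right]
      have h := A.ε.swap_mul (y κ.castSucc).deg (y κ.succ).deg
      simp only [Fin.val_castSucc, Fin.val_succ, hpow]
      linear_combination (-(-1) ^ (r + 1 - ((κ : ℕ) + 1)) *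
        A.ε.app ξ (tdeg (κ.succ.removeNth y)) *
        A.ε.app (y κ.succ).deg (∑ t ∈ Finset.Ioi κ.succ, (y t).deg)) * h
    · obtain ⟨i, hi⟩ := Fin.exists_succAbove_eq h1.symm
      obtain ⟨j, hj⟩ := Fin.exists_succAbove_eq h2.symm
      have hij : (j : ℕ) = i + 1 := by
        have e1 := congrArg Fin.val hi
        have e2 := congrArg Fin.val hj
        have h1' : (k : ℕ) ≠ κ := fun h => h1 (Fin.ext h)
        have h2' : (k : ℕ) ≠ κ + 1 := fun h => h2 (Fin.ext h)
        simp only [Fin.succAbove, Fin.lt_def] at e1 e2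
        split_ifs at e1 e2 <;> simp only [Fin.val_castSucc, Fin.val_succ] at * <;> omega
      have hrem : k.removeNth (y ∘ Equiv.swap κ.castSucc κ.succ) =
          k.removeNth y ∘ Equiv.swap i j := by
        funext t
        simp only [Fin.removeNth_apply, Function.comp_apply, ← hi, ← hj]
        rw [(Fin.succAbove_right_injective (p := k)).swap_apply]
      have hsum : ∑ t ∈ Finset.Ioi k, ((y ∘ Equiv.swap κ.castSucc κ.succ) t).deg =
          ∑ t ∈ Finset.Ioi k, (y t).deg := by
        refine Finset.sum_equiv (Equiv.swap κ.castSucc κ.succ) (fun t => ?_) fun t _ => rfl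
        have h1' : (k : ℕ) ≠ κ := fun h => h1 (Fin.ext h)
        have h2' : (k : ℕ) ≠ κ + 1 := fun h => h2 (Fin.ext h)
        simp only [Finset.mem_Ioi, Equiv.swap_apply_def, Fin.lt_def]
        split_ifs with h3 h4
        · subst h3; simp only [Fin.val_castSucc, Fin.val_succ]; omega
        · subst h4; simp only [Fin.val_castSucc, Fin.val_succ]; omega
        · rfl
      rw [Equiv.swap_apply_of_ne_of_ne h1 h2, coef, coef, hsum, hrem, tdeg_comp_swap,
        Function.comp_apply, Equiv.swap_apply_of_ne_of_ne h1 h2,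
        R.rhoElt_swap a (k.removeNth y) i j hij, Fin.removeNth_apply, Fin.removeNth_apply, hi, hj]
      simp only [smul_smul]
      congr 1
      ring
  have hbr := (hF 1).smul [] [] (-A.ε.app (y κ.castSucc).deg (y κ.succ).deg)
    (A.brElt (y ∘ Equiv.swap κ.castSucc κ.succ)) (A.brElt y) rfl
    (by simp [tdeg_comp_swap]) (brElt_swap y κ.castSucc κ.succ (by simp))
  simp only [List.nil_append] at hbr
  rw [cobd_zero_ofFn, cobd_zero_ofFn, hbr, Finset.sum_congr rfl fun k _ => hterm k,
    ← Finset.smul_sum, Equiv.sum_comp (Equiv.swap κ.castSucc κ.succ) fun k =>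
      coef A ξ k (y ∘ Equiv.swap κ.castSucc κ.succ) •
          R.rhoElt a (k.removeNth (y ∘ Equiv.swap κ.castSucc κ.succ))
            (F 0 [(y ∘ Equiv.swap κ.castSucc κ.succ) k])]
  module

/-- The coboundary preserves `ε`-skew-symmetry. -/
theorem cobd_skewAt (a q : ℕ) (ξ : Γ) (F : ℕ → List (HomElt 𝒢) → M)
    (hF : ∀ k, WordLinear (q * (r + 1) + 1) (F k))
    (hs : ∀ k t, SkewPos r q t → SkewAt A.ε (q * (r + 1) + 1) t (F k)) (t : ℕ)
    (ht : SkewPos r (q + 1) t) :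
    SkewAt A.ε ((q + 1) * (r + 1) + 1) t (fun w => R.cobd a q ξ w F) := by
  induction q generalizing ξ F t with
  | zero =>
    intro u v x y hu hl
    have ht' : t < r + 1 := ht
    obtain ⟨Y, hY⟩ := exists_ofFn (m := r + 2) (u ++ x :: y :: v) (by simp; omega)
    obtain ⟨Y', hY'⟩ := exists_ofFn (m := r + 2) (u ++ y :: x :: v) (by simp; omega)
    have h1 := tup_swap u v (⟨t, ht'⟩ : Fin (r + 1)).castSucc (⟨t, ht'⟩ : Fin (r + 1)).succ
      hu.symm (by simp [hu]) x y
    have h2 : (Y (⟨t, ht'⟩ : Fin (r + 1)).castSucc) = x := by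
      rw [← tup_ofFn Y, ← hY]
      simp [tup, ← hu]
    have h3 : (Y (⟨t, ht'⟩ : Fin (r + 1)).succ) = y := by
      rw [← tup_ofFn Y, ← hY]
      simp [tup, ← hu]
    rw [hY, hY', tup_ofFn, tup_ofFn] at h1
    have h := R.cobd_zero_swap a ξ F (by simpa using hF) Y ⟨t, ht'⟩
    rw [← h1, h2, h3] at h
    simp only [hY, hY', h]
  | succ q ih =>
    intro u v x y hu hl
    have hN : r + 1 + (q * (r + 1) + 1) = (q + 1) * (r + 1) + 1 := by ring
    -- both letters belong to the first block, or both come after it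
    rcases ht with ht | ⟨s, rfl, hs'⟩
    · obtain ⟨X, hX⟩ : ∃ X, X = tup (r + 1) (u ++ x :: y :: v) := ⟨_, rfl⟩
      have h1 := tup_swap u v (⟨t, by omega⟩ : Fin (r + 1)) ⟨t + 1, by omega⟩ hu.symm
        (by simp [hu]) x y
      have h2 : X ⟨t, by omega⟩ = x := by
        rw [hX]
        simp [tup, ← hu]
      have h3 : X ⟨t + 1, by omega⟩ = y := by
        rw [hX]
        simp [tup, ← hu]
      obtain ⟨w, hw⟩ : ∃ w, ∀ c d, (u ++ c :: d :: v).drop (r + 1) = w := by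
        refine ⟨v.drop (r - 1 - u.length), fun c d => ?_⟩
        rw [List.drop_append, List.drop_eq_nil_of_le (by omega), List.nil_append,
          show r + 1 - u.length = r - 1 - u.length + 1 + 1 by omega, List.drop_succ_cons,
          List.drop_succ_cons]
      have hwl : w.length = (q + 1) * (r + 1) + 1 := by
        rw [← hw x y]
        simp only [List.length_drop, List.length_append, List.length_cons]
        have : (q + 1 + 1) * (r + 1) + 1 = (q + 1) * (r + 1) + 1 + (r + 1) := by ring
        omega
      have hpos : SkewPos r (q + 1) t := by
        cases q with
        | zero => exact Nat.lt_succ_of_lt ht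
        | succ q => exact Or.inl ht
      simp only [cobd, LinearMap.sub_apply, LinearMap.comp_apply, h1, hw, ← hX, lie_apply]
      rw [R.rhoElt_swap a X ⟨t, by omega⟩ ⟨t + 1, by omega⟩ rfl,
        der_swap X ⟨t, by omega⟩ ⟨t + 1, by omega⟩ rfl w (hwl ▸ hF 1), tdeg_comp_swap, h2, h3,
        R.cobd_congr a q _ w (A.contr M X F) (-(A.ε.app x.deg y.deg •
          A.contr M (X ∘ Equiv.swap ⟨t, by omega⟩ ⟨t + 1, by omega⟩) F)) hwl]
      · rw [map_neg, map_smul]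
        module
      · intro k w' hw'
        obtain ⟨u', v', hu', hl', hc, hc'⟩ :=
          ofFn_swap (A.twTup k X) ⟨t, by omega⟩ ⟨t + 1, by omega⟩ rfl
        have h := hs k t hpos u' (v' ++ w') (A.twTup k X ⟨t, by omega⟩)
          (A.twTup k X ⟨t + 1, by omega⟩) hu' (by simp [hw']; linarith)
        rw [← List.cons_append, ← List.cons_append, ← List.append_assoc, ← hc,
          ← List.cons_append, ← List.cons_append, ← List.append_assoc, ← hc', twTup_apply_deg,
          twTup_apply_deg, h2, h3] at h
        exact h
    · obtain ⟨X, u, rfl⟩ := exists_ofFn_append (m := r + 1) u (by omega)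
      have hul : u.length = s := by
        simp only [List.length_append, List.length_ofFn] at hu
        omega
      have hl' : u.length + v.length + 2 = (q + 1) * (r + 1) + 1 := by
        simp only [List.length_append, List.length_ofFn] at hl
        linarith
      have h1 := hs 0 s hs' u v x y hul hl'
      have h2 := der_skewAt (A := A) X (hs 1 s hs') u v x y hul hl'
      have h3 := ih (ξ + tdeg X) (A.contr M X F)
        (fun k => WordLinear.append (by simpa [hN] using hF k)) (fun k t' ht' => by
          intro u' v' x' y' hu' hl'
          have hpos : SkewPos r (q + 1) (t' + (r + 1)) := by
            cases q with
            | zero => exact ht'.elim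
            | succ q => exact Or.inr ⟨t', rfl, ht'⟩
          have h := hs k _ hpos (List.ofFn (A.twTup k X) ++ u') v' x' y'
            (by simp [hu']; omega) (by simp; linarith)
          simpa only [contr_apply, List.append_assoc] using h) s hs' u v x y hul hl'
      simp only [List.append_assoc, cobd_succ_append, lie_apply] at h1 h2 h3 ⊢
      rw [h1, h2, h3]
      simp only [map_neg, map_smul]
      module

end Representation

/-! ### The formula of the coboundary on homogeneous arguments -/

/-- The word `X_1 ⋯ X_q z` of `q` blocks and a letter. -/
def wordOf {r : ℕ} : (q : ℕ) → (Fin q → Fin (r + 1) → HomElt 𝒢) → HomElt 𝒢 → List (HomElt 𝒢)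
  | 0, _, z => [z]
  | q + 1, X, z => List.ofFn (X 0) ++ wordOf q (Fin.tail X) z

/-- The map on words which is given by `φ`: the first `q` blocks of the word and the letter after
them are the arguments of `φ`; words that are too short are padded by `0`. -/
def toWord : (q : ℕ) → Pre g M r q → List (HomElt 𝒢) → M
  | 0, φ, w => φ Fin.elim0 (w.getD 0 default).val
  | q + 1, φ, w =>
      toWord q (fun X z => φ (Fin.cons (vals (tup (r + 1) w)) X) z) (w.drop (r + 1))

omit [AddCommGroup Γ] in
theorem length_wordOf (q : ℕ) (X : Fin q → Fin (r + 1) → HomElt 𝒢) (z : HomElt 𝒢) :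
    (wordOf q X z).length = q * (r + 1) + 1 := by
  induction q with
  | zero => simp [wordOf]
  | succ q ih =>
    rw [wordOf, List.length_append, List.length_ofFn, ih]
    ring

theorem wdeg_wordOf (q : ℕ) (X : Fin q → Fin (r + 1) → HomElt 𝒢) (z : HomElt 𝒢) :
    wdeg (wordOf q X z) = ∑ i, tdeg (X i) + z.deg := by
  induction q with
  | zero => simp [wordOf]
  | succ q ih =>
    rw [wordOf, wdeg_append, wdeg_ofFn, ih, Fin.sum_univ_succ, add_assoc]
    rfl

theorem map_twElt_wordOf (q : ℕ) (X : Fin q → Fin (r + 1) → HomElt 𝒢) (z : HomElt 𝒢) :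
    (wordOf q X z).map A.twElt = wordOf q (fun i => A.twTup 1 (X i)) (A.twElt z) := by
  induction q with
  | zero => rfl
  | succ q ih =>
    rw [wordOf, List.map_append, ih, map_twElt_ofFn]
    rfl

omit [AddCommGroup M] [Module K M] in
theorem toWord_succ_append (q : ℕ) (φ : Pre g M r (q + 1)) (X : Fin (r + 1) → HomElt 𝒢)
    (w : List (HomElt 𝒢)) :
    toWord (q + 1) φ (List.ofFn X ++ w) = toWord q (fun Y z => φ (Fin.cons (vals X) Y) z) w := by
  rw [toWord, tup_append, drop_ofFn_append]

omit [AddCommGroup M] [Module K M] in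
theorem toWord_wordOf (q : ℕ) (φ : Pre g M r q) (X : Fin q → Fin (r + 1) → HomElt 𝒢)
    (z : HomElt 𝒢) : toWord q φ (wordOf q X z) = φ (fun i => vals (X i)) z.val := by
  induction q with
  | zero =>
    rw [toWord, wordOf, List.getD_cons_zero]
    congr 1
    exact funext fun i => i.elim0
  | succ q ih =>
    rw [wordOf, toWord_succ_append, ih]
    congr 1
    funext i
    refine Fin.cases ?_ (fun i => ?_) i <;> rfl

omit [AddCommGroup Γ] in
theorem exists_wordOf (q : ℕ) (w : List (HomElt 𝒢)) (hw : w.length = q * (r + 1) + 1) :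
    ∃ (X : Fin q → Fin (r + 1) → HomElt 𝒢) (z : HomElt 𝒢), w = wordOf q X z := by
  induction q generalizing w with
  | zero =>
    obtain ⟨z, rfl⟩ := List.length_eq_one_iff.1 (by simpa using hw)
    exact ⟨Fin.elim0, z, rfl⟩
  | succ q ih =>
    obtain ⟨Y, w, rfl⟩ := exists_ofFn_append (m := r + 1) w (by rw [hw]; nlinarith)
    obtain ⟨X, z, rfl⟩ := ih w (by
      simp only [List.length_append, List.length_ofFn] at hw
      linarith)
    exact ⟨Fin.cons Y X, z, by rw [wordOf, Fin.cons_zero, Fin.tail_cons]⟩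

theorem Ioi_succ_eq {q : ℕ} (i : Fin q) :
    Finset.Ioi i.succ = (Finset.Ioi i).map (Fin.succEmb q) := by
  ext t
  refine Fin.cases ?_ (fun i => ?_) t <;> simp

theorem Ioi_zero_eq {q : ℕ} :
    Finset.Ioi (0 : Fin (q + 1)) = Finset.univ.map (Fin.succEmb q) := by
  ext t
  refine Fin.cases ?_ (fun i => ?_) t <;> simp

theorem Ioo_succ_eq {q : ℕ} (i j : Fin q) :
    Finset.Ioo i.succ j.succ = (Finset.Ioo i j).map (Fin.succEmb q) := by
  ext t
  refine Fin.cases ?_ (fun i => ?_) t <;> simp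

theorem Ioo_zero_succ_eq {q : ℕ} (j : Fin q) :
    Finset.Ioo 0 j.succ = (Finset.Iio j).map (Fin.succEmb q) := by
  ext t
  refine Fin.cases ?_ (fun i => ?_) t <;> simp

theorem removeNth_succ_eq {α : Type*} {q : ℕ} (i : Fin (q + 1)) (f : Fin (q + 2) → α) :
    i.succ.removeNth f = Fin.cons (f 0) (i.removeNth (Fin.tail f)) := by
  funext t
  refine Fin.cases ?_ (fun t => ?_) t <;> simp [Fin.removeNth, Fin.tail]

/-- The derivation of a word that consists of blocks, block by block. -/
theorem der_wordOf (X : Fin (r + 1) → HomElt 𝒢) (q : ℕ) (Y : Fin q → Fin (r + 1) → HomElt 𝒢)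
    (z : HomElt 𝒢) (G : List (HomElt 𝒢) → M) :
    A.der M X (wordOf q Y z) G =
      ∑ j, A.ε.app (tdeg X) (∑ k ∈ Finset.Iio j, tdeg (Y k)) •
        A.evalAct X (Y j) (fun U =>
          G (wordOf q (Function.update (fun k => A.twTup 1 (Y k)) j U) (A.twElt z))) +
      A.ε.app (tdeg X) (∑ k, tdeg (Y k)) •
        G (wordOf q (fun k => A.twTup 1 (Y k)) (A.adElt X z)) := by
  induction q generalizing G with
  | zero => simp [wordOf, der_cons, der_nil, Bicharacter.zero_right]
  | succ q ih =>
    rw [wordOf, der_append, der_ofFn, ih, map_twElt_wordOf, map_twElt_ofFn, Fin.sum_univ_succ,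
      Fin.sum_univ_succ, wdeg_ofFn, A.ε.add_right, smul_add, smul_smul, Finset.smul_sum,
      show Finset.Iio (0 : Fin (q + 1)) = ∅ from by ext; simp, Finset.sum_empty,
      Bicharacter.zero_right, one_smul, add_assoc]
    congr 1
    congr 1
    refine Finset.sum_congr rfl fun j _ => ?_
    have h3 : ∀ U, wordOf (q + 1) (Function.update (fun k => A.twTup 1 (Y k)) j.succ U)
        (A.twElt z) = List.ofFn (A.twTup 1 (Y 0)) ++
          wordOf q (Function.update (fun k => A.twTup 1 (Fin.tail Y k)) j U) (A.twElt z) := by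
      intro U
      rw [wordOf, Fin.tail_update_succ, Function.update_of_ne (Fin.succ_ne_zero j).symm]
      rfl
    rw [Iio_succ_eq, Finset.sum_cons, Finset.sum_map, A.ε.add_right, smul_smul]
    simp only [h3]
    rfl

namespace Representation

variable (R : A.Representation ℳ)

/-- The terms of the coboundary with a bracket of two fundamental objects. -/
def bracketTerm (A : NHomLieColorAlgebra K 𝒢 r) (q : ℕ) (φ : Pre g M r q)
    (X : Fin (q + 1) → Fin (r + 1) → HomElt 𝒢) (z : HomElt 𝒢) : M :=
  ∑ i : Fin (q + 1), ∑ j ∈ Finset.Ioi i,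
    ((-1 : K) ^ ((i : ℕ) + 1) * A.ε.app (tdeg (X i)) (∑ k ∈ Finset.Ioo i j, tdeg (X k))) •
      A.evalAct (X i) (X j) (fun U => φ (i.removeNth
        (Function.update (fun k => vals (A.twTup 1 (X k))) j (vals U))) (A.twElt z).val)

/-- The terms of the coboundary in which a fundamental object acts on the last argument. -/
def adTerm (A : NHomLieColorAlgebra K 𝒢 r) (q : ℕ) (φ : Pre g M r q)
    (X : Fin (q + 1) → Fin (r + 1) → HomElt 𝒢) (z : HomElt 𝒢) : M :=
  ∑ i : Fin (q + 1),
    ((-1 : K) ^ ((i : ℕ) + 1) * A.ε.app (tdeg (X i)) (∑ k ∈ Finset.Ioi i, tdeg (X k))) •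
      φ (i.removeNth (fun k => vals (A.twTup 1 (X k)))) (A.adElt (X i) z).val

/-- The terms of the coboundary in which `ρ` is applied to a fundamental object; `ρ` is twisted by
`α̃^a`. -/
def rhoTerm (a q : ℕ) (ξ : Γ) (φ : Pre g M r q) (X : Fin (q + 1) → Fin (r + 1) → HomElt 𝒢)
    (z : HomElt 𝒢) : M :=
  ∑ i : Fin (q + 1),
    ((-1 : K) ^ (i : ℕ) * A.ε.app (ξ + ∑ k ∈ Finset.Iio i, tdeg (X k)) (tdeg (X i))) •
      R.rhoElt a (X i) (φ (i.removeNth (fun k => vals (X k))) z.val)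

/-- The terms of the coboundary in which `ρ` is applied to the last argument and all but one entry
of the last fundamental object; `ρ` is twisted by `α̃^a`. -/
def lastTerm (a q : ℕ) (ξ : Γ) (φ : Pre g M r q) (X : Fin (q + 1) → Fin (r + 1) → HomElt 𝒢)
    (z : HomElt 𝒢) : M :=
  (-1 : K) ^ q • ∑ k : Fin (r + 1),
    coef A (ξ + ∑ i : Fin q, tdeg (X i.castSucc)) k.castSucc (Fin.snoc (X (Fin.last q)) z) •
      R.rhoElt a (Fin.snoc (k.removeNth (X (Fin.last q))) z)
        (φ (Fin.init fun k => vals (X k)) (X (Fin.last q) k).val)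

theorem coboundaryFormula_eq (q : ℕ) (ξ : Γ) (φ : Pre g M r q)
    (X : Fin (q + 1) → Fin (r + 1) → HomElt 𝒢) (z : HomElt 𝒢) :
    coboundaryFormula R q ξ φ (fun i t => (X i t).deg) z.deg (fun i => vals (X i)) z.val =
      bracketTerm A q φ X z + adTerm A q φ X z + R.rhoTerm q q ξ φ X z +
        R.lastTerm q q ξ φ X z := by
  have htw : ∀ X : Fin (r + 1) → HomElt 𝒢, A.tw (vals X) = vals (A.twTup 1 X) := fun X => by
    rw [vals_twTup]
    rfl
  rw [coboundaryFormula]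
  congr 1
  · congr 1
    congr 1
    refine Finset.sum_congr rfl fun i _ => Finset.sum_congr rfl fun j _ => ?_
    rw [evalBracket_vals]
    simp only [htw]
    rfl
  · rw [lastTerm]
    congr 1
    refine Finset.sum_congr rfl fun k _ => ?_
    have e2 : tdeg (k.castSucc.removeNth (Fin.snoc (X (Fin.last q)) z : Fin (r + 2) → HomElt 𝒢)) =
        ∑ t ∈ Finset.univ.erase k, (X (Fin.last q) t).deg + z.deg := by
      rw [removeNth_castSucc_snoc, tdeg_snoc]
      congr 1
      have h1 := tdeg_eq_add_removeNth k (X (Fin.last q))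
      rw [tdeg, ← Finset.add_sum_erase _ _ (Finset.mem_univ k)] at h1
      exact (add_left_cancel h1).symm
    rw [coef, sum_Ioi_castSucc_snoc, e2, rhoElt, vals_snoc]
    simp only [Fin.snoc_castSucc, Fin.val_castSucc]
    rfl

section recursion

variable (q : ℕ) (φ : Pre g M r (q + 1)) (X : Fin (q + 2) → Fin (r + 1) → HomElt 𝒢) (z : HomElt 𝒢)

theorem bracketTerm_succ :
    bracketTerm A (q + 1) φ X z =
      -∑ j, A.ε.app (tdeg (X 0)) (∑ k ∈ Finset.Iio j, tdeg (Fin.tail X k)) •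
        A.evalAct (X 0) (Fin.tail X j) (fun U =>
          φ (fun i => vals (Function.update (fun k => A.twTup 1 (Fin.tail X k)) j U i))
            (A.twElt z).val) -
      bracketTerm A q (fun Y z => φ (Fin.cons (vals (A.twTup 1 (X 0))) Y) z) (Fin.tail X) z := by
  rw [bracketTerm, Fin.sum_univ_succ, Ioi_zero_eq, Finset.sum_map, sub_eq_add_neg]
  congr 1
  · rw [← Finset.sum_neg_distrib]
    refine Finset.sum_congr rfl fun j _ => ?_
    rw [Fin.coe_succEmb, Ioo_zero_succ_eq, Finset.sum_map, ← neg_smul]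
    congr 1
    · simp [Fin.tail]
    · refine evalAct_congr _ _ _ _ _ fun k => ?_
      rw [Fin.removeNth_zero, Fin.tail_update_succ]
      congr 1
      funext i
      by_cases h : i = j
      · subst h; simp
      · simp [h, Fin.tail]
  · rw [bracketTerm, ← Finset.sum_neg_distrib]
    refine Finset.sum_congr rfl fun i _ => ?_
    rw [Ioi_succ_eq, Finset.sum_map, ← Finset.sum_neg_distrib]
    refine Finset.sum_congr rfl fun j _ => ?_
    rw [Fin.coe_succEmb, Ioo_succ_eq, Finset.sum_map, ← neg_smul]
    congr 1
    · simp [Fin.tail, pow_succ]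
    · refine evalAct_congr _ _ _ _ _ fun k => ?_
      rw [removeNth_succ_eq, Fin.tail_update_succ,
        Function.update_of_ne (Fin.succ_ne_zero j).symm]
      rfl

theorem adTerm_succ :
    adTerm A (q + 1) φ X z =
      -(A.ε.app (tdeg (X 0)) (∑ k, tdeg (Fin.tail X k)) •
        φ (fun i => vals (A.twTup 1 (Fin.tail X i))) (A.adElt (X 0) z).val) -
      adTerm A q (fun Y z => φ (Fin.cons (vals (A.twTup 1 (X 0))) Y) z) (Fin.tail X) z := by
  rw [adTerm, Fin.sum_univ_succ, sub_eq_add_neg]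
  congr 1
  · rw [Ioi_zero_eq, Finset.sum_map, ← neg_smul]
    congr 1
    simp [Fin.tail]
  · rw [adTerm, ← Finset.sum_neg_distrib]
    refine Finset.sum_congr rfl fun i _ => ?_
    rw [Ioi_succ_eq, Finset.sum_map, ← neg_smul, removeNth_succ_eq]
    congr 1
    simp [Fin.tail, pow_succ]

theorem rhoTerm_succ (a : ℕ) (ξ : Γ) :
    R.rhoTerm a (q + 1) ξ φ X z =
      A.ε.app ξ (tdeg (X 0)) • R.rhoElt a (X 0) (φ (fun i => vals (Fin.tail X i)) z.val) -
      R.rhoTerm a q (ξ + tdeg (X 0)) (fun Y z => φ (Fin.cons (vals (X 0)) Y) z)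
        (Fin.tail X) z := by
  rw [rhoTerm, Fin.sum_univ_succ, sub_eq_add_neg]
  congr 1
  · rw [show Finset.Iio (0 : Fin (q + 2)) = ∅ from by ext; simp, Finset.sum_empty, add_zero]
    congr 1
    simp
  · rw [rhoTerm, ← Finset.sum_neg_distrib]
    refine Finset.sum_congr rfl fun i _ => ?_
    rw [Iio_succ_eq, Finset.sum_cons, Finset.sum_map, ← neg_smul, removeNth_succ_eq]
    congr 1
    simp [Fin.tail, pow_succ, add_assoc]

theorem lastTerm_succ (a : ℕ) (ξ : Γ) :
    R.lastTerm a (q + 1) ξ φ X z =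
      -R.lastTerm a q (ξ + tdeg (X 0)) (fun Y z => φ (Fin.cons (vals (X 0)) Y) z)
        (Fin.tail X) z := by
  rw [lastTerm, lastTerm, pow_succ, mul_neg_one, neg_smul]
  congr 2
  refine Finset.sum_congr rfl fun k _ => ?_
  rw [Fin.sum_univ_succ, ← add_assoc]
  congr 3
  funext i
  refine Fin.cases ?_ (fun i => ?_) i <;> rfl

end recursion

/-- On homogeneous arguments, the formula of the coboundary satisfies the recursion which defines
the coboundary on words. For the induction, the terms with a bracket and those with the
representation belong to independent maps `φ₁` and `φ₀`, since contraction with `X_1` replaces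
them by `φ₁(α̃ X_1, ⋯)` and `φ₀(X_1, ⋯)`. -/
theorem terms_eq_cobd (a q : ℕ) (ξ : Γ) (φ₀ φ₁ : Pre g M r q) (F : ℕ → List (HomElt 𝒢) → M)
    (h0 : ∀ X z, F 0 (wordOf q X z) = φ₀ (fun i => vals (X i)) z.val)
    (h1 : ∀ X z, F 1 (wordOf q X z) = φ₁ (fun i => vals (X i)) z.val)
    (X : Fin (q + 1) → Fin (r + 1) → HomElt 𝒢) (z : HomElt 𝒢) :
    bracketTerm A q φ₁ X z + adTerm A q φ₁ X z + R.rhoTerm a q ξ φ₀ X z +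
      R.lastTerm a q ξ φ₀ X z = R.cobd a q ξ (wordOf (q + 1) X z) F := by
  induction q generalizing ξ F with
  | zero =>
    have h0' : ∀ Y z, F 0 [z] = φ₀ Y z.val := fun Y z => by
      rw [Subsingleton.elim Y fun i => vals ((Fin.elim0 : Fin 0 → Fin (r + 1) → HomElt 𝒢) i)]
      exact h0 _ _
    have h1' : ∀ Y z, F 1 [z] = φ₁ Y z.val := fun Y z => by
      rw [Subsingleton.elim Y fun i => vals ((Fin.elim0 : Fin 0 → Fin (r + 1) → HomElt 𝒢) i)]
      exact h1 _ _
    rw [wordOf, wordOf, ofFn_append_singleton, cobd_zero_ofFn, Fin.sum_univ_castSucc,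
      coef_last_snoc]
    simp only [bracketTerm, adTerm, rhoTerm, lastTerm, removeNth_castSucc_snoc, brElt_snoc,
      Fin.snoc_castSucc, Fin.snoc_last, Fin.removeNth_last, Fin.init_snoc, ← h0', ← h1']
    have hI : Finset.Iio (0 : Fin (0 + 1)) = ∅ := by ext; simp
    simp [Bicharacter.zero_right, hI]
    abel
  | succ q ih =>
    have ih' := ih (ξ + tdeg (X 0)) (fun Y z => φ₀ (Fin.cons (vals (X 0)) Y) z)
      (fun Y z => φ₁ (Fin.cons (vals (A.twTup 1 (X 0))) Y) z) (A.contr M (X 0) F)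
      (fun Y z => by
        have h := h0 (Fin.cons (X 0) Y) z
        rw [wordOf, Fin.cons_zero, Fin.tail_cons] at h
        rw [contr_apply, twTup_zero, h]
        congr 1
        funext i
        refine Fin.cases ?_ (fun i => ?_) i <;> rfl)
      (fun Y z => by
        have h := h1 (Fin.cons (A.twTup 1 (X 0)) Y) z
        rw [wordOf, Fin.cons_zero, Fin.tail_cons] at h
        rw [contr_apply, h]
        congr 1
        funext i
        refine Fin.cases ?_ (fun i => ?_) i <;> rfl) (Fin.tail X)
    rw [wordOf, cobd_succ_append, ← ih', lie_apply, h0, der_wordOf, bracketTerm_succ,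
      adTerm_succ, rhoTerm_succ, lastTerm_succ]
    simp only [h1]
    abel

/-- The formula of the coboundary of `φ` on homogeneous arguments, as the coboundary of the
constant sequence of `φ`. -/
theorem coboundaryFormula_eq_cobd (q : ℕ) (ξ : Γ) (φ : Pre g M r q)
    (X : Fin (q + 1) → Fin (r + 1) → HomElt 𝒢) (z : HomElt 𝒢) :
    coboundaryFormula R q ξ φ (fun i t => (X i t).deg) z.deg (fun i => vals (X i)) z.val =
      R.cobd q q ξ (wordOf (q + 1) X z) (fun _ => toWord q φ) := by
  rw [coboundaryFormula_eq]
  exact R.terms_eq_cobd q q ξ φ φ _ (toWord_wordOf q φ) (toWord_wordOf q φ) X z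

end Representation

/-! ### Cochains as maps on words -/

/-- `φ` is linear in each of its arguments. -/
structure PreLinear (K : Type*) {g M : Type*} [Field K] [AddCommGroup g] [Module K g]
    [AddCommGroup M] [Module K M] {r q : ℕ} (φ : Pre g M r q) : Prop where
  block : ∀ (X : Fin q → Fin (r + 1) → g) (i : Fin q) (j : Fin (r + 1)) (z : g),
    IsLinearMap K fun x : g => φ (Function.update X i (Function.update (X i) j x)) z
  last : ∀ X : Fin q → Fin (r + 1) → g, IsLinearMap K (φ X)

/-- `φ` is `ε`-skew-symmetric in the entries of each block, and in its last `r + 2` arguments. -/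
structure PreSkew {Γ K g M : Type*} [AddCommGroup Γ] [Field K] [AddCommGroup g] [Module K g]
    [AddCommGroup M] [Module K M] (ε : Bicharacter Γ K) (𝒢 : Γ → Submodule K g) {r q : ℕ}
    (φ : Pre g M r q) : Prop where
  block : ∀ (X : Fin q → Fin (r + 1) → g) (i : Fin q) (z : g),
    IsColorSkew ε 𝒢 fun Y : Fin (r + 1) → g => φ (Function.update X i Y) z
  last : ∀ (X : Fin q → Fin (r + 1) → g) (i : Fin q), (i : ℕ) + 1 = q →
    IsColorSkew ε 𝒢 fun y : Fin (r + 2) → g =>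
      φ (Function.update X i (Fin.init y)) (y (Fin.last (r + 1)))

theorem PreLinear.cons {q : ℕ} {φ : Pre g M r (q + 1)} (h : PreLinear K φ) (Y : Fin (r + 1) → g) :
    PreLinear K (fun X z => φ (Fin.cons Y X) z) where
  block X i j z := by
    have h1 := h.block (Fin.cons Y X) i.succ j z
    simpa only [Fin.cons_succ, ← Fin.cons_update] using h1
  last X := h.last _

theorem PreSkew.cons {q : ℕ} {ε : Bicharacter Γ K} {φ : Pre g M r (q + 1)} (h : PreSkew ε 𝒢 φ)
    (Y : Fin (r + 1) → g) : PreSkew ε 𝒢 (fun X z => φ (Fin.cons Y X) z) where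
  block X i z := by
    have h1 := h.block (Fin.cons Y X) i.succ z
    simpa only [← Fin.cons_update] using h1
  last X i hi := by
    have h1 := h.last (Fin.cons Y X) i.succ (by simpa using hi)
    simpa only [← Fin.cons_update] using h1

omit [AddCommGroup M] [Module K M] in
/-- The arguments at which `toWord` evaluates `φ` depend on the word only. -/
theorem exists_toWord_eq (q : ℕ) (w : List (HomElt 𝒢)) :
    ∃ (Y : Fin q → Fin (r + 1) → g) (z : g), ∀ φ : Pre g M r q, toWord q φ w = φ Y z := by
  induction q generalizing w with
  | zero => exact ⟨_, _, fun φ => rfl⟩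
  | succ q ih =>
    obtain ⟨Y, z, h⟩ := ih (w.drop (r + 1))
    exact ⟨_, _, fun φ => h _⟩

theorem toWord_wordLinear (q : ℕ) (φ : Pre g M r q) (hφ : PreLinear K φ) :
    WordLinear (q * (r + 1) + 1) (toWord (𝒢 := 𝒢) q φ) := by
  refine WordLinear.of_comb fun u v s t a b c hl _ _ hc => ?_
  induction q generalizing u with
  | zero =>
    obtain rfl : u = [] := List.eq_nil_of_length_eq_zero (by omega)
    simp only [toWord, List.nil_append, List.getD_cons_zero, hc, (hφ.last _).map_add,
      (hφ.last _).map_smul]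
  | succ q ih =>
    by_cases hu : u.length < r + 1
    · obtain ⟨Y, z, h⟩ := exists_toWord_eq (M := M) (r := r) q (v.drop (r - u.length))
      have hd : ∀ x : HomElt 𝒢, (u ++ x :: v).drop (r + 1) = v.drop (r - u.length) := fun x => by
        rw [List.drop_append, List.drop_eq_nil_of_le (by omega), List.nil_append,
          show r + 1 - u.length = r - u.length + 1 by omega, List.drop_succ_cons]
      have h1 := hφ.block (Fin.cons (vals (tup (r + 1) (u ++ c :: v))) Y) 0 ⟨u.length, hu⟩ z
      simp only [Fin.cons_zero, Fin.update_cons_zero] at h1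
      have h2 : ∀ x : HomElt 𝒢, toWord (q + 1) φ (u ++ x :: v) = φ (Fin.cons (Function.update
          (vals (tup (r + 1) (u ++ c :: v))) ⟨u.length, hu⟩ x.val) Y) z := fun x => by
        rw [toWord, hd, h, tup_insert u v hu x c, vals_update]
      rw [h2, h2, h2, hc, h1.map_add, h1.map_smul, h1.map_smul]
    · obtain ⟨X, u, rfl⟩ := exists_ofFn_append (m := r + 1) u (by omega)
      simp only [List.append_assoc, toWord_succ_append]
      refine ih _ (hφ.cons _) u ?_
      simp only [List.length_append, List.length_ofFn] at hl
      linarith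

/-- Compatibility with the twist maps, for words. A second map `ψ` is needed for the induction,
since `φ(X, ⋯)` is mapped to `φ(α̃ X, ⋯)`. -/
theorem map_toWord (T : M →ₗ[K] M) (q : ℕ) (φ ψ : Pre g M r q)
    (h : ∀ X z, T (φ X z) = ψ (fun i => A.tw (X i)) (A.α z)) (w : List (HomElt 𝒢)) :
    T (toWord q φ w) = toWord q ψ (w.map A.twElt) := by
  have hd : A.twElt (default : HomElt 𝒢) = default := HomElt.ext rfl (map_zero A.α)
  have hg : ∀ n, (w.map A.twElt).getD n default = A.twElt (w.getD n default) := fun n => by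
    conv_lhs => rw [← hd]
    rw [List.getD_map]
  induction q generalizing w with
  | zero =>
    rw [toWord, toWord, hg, h]
    congr 1
    exact funext fun i => i.elim0
  | succ q ih =>
    rw [toWord, toWord, ← List.map_drop]
    refine ih _ _ (fun X z => ?_) _ fun n => ?_
    · rw [h]
      congr 1
      funext i
      refine Fin.cases ?_ (fun i => ?_) i
      · funext t
        simp only [Fin.cons_zero, vals, tup, hg]
        rfl
      · rfl
    · conv_lhs => rw [← hd]
      rw [List.getD_map]

/-- Two words which differ by an interchange of adjacent letters, as words of tuples. -/
theorem exists_ofFn_swap {m : ℕ} (u v : List (HomElt 𝒢)) (a b : HomElt 𝒢)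
    (h : u.length + v.length + 2 = m) :
    ∃ (Y : Fin m → HomElt 𝒢) (i j : Fin m), (j : ℕ) = i + 1 ∧ Y i = a ∧ Y j = b ∧
      u ++ a :: b :: v = List.ofFn Y ∧ u ++ b :: a :: v = List.ofFn (Y ∘ Equiv.swap i j) := by
  refine ⟨tup m (u ++ a :: b :: v), ⟨u.length, by omega⟩, ⟨u.length + 1, by omega⟩, rfl, ?_, ?_,
    ?_, ?_⟩
  · simp [tup]
  · simp [tup]
  · rw [ofFn_tup _ (by simp; omega)]
  · rw [← tup_swap u v _ _ rfl rfl, ofFn_tup _ (by simp; omega)]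

theorem toWord_skewAt (q : ℕ) (φ : Pre g M r q) (hφ : PreSkew A.ε 𝒢 φ) (t : ℕ)
    (ht : SkewPos r q t) : SkewAt A.ε (q * (r + 1) + 1) t (toWord (𝒢 := 𝒢) q φ) := by
  intro u v a b hu hl
  match q, ht with
  | 1, ht =>
    obtain ⟨Y, i, j, hij, rfl, rfl, h1, h2⟩ := exists_ofFn_swap (m := r + 2) u v a b (by omega)
    have h := colorSkew_vals (hφ.last (fun _ _ => 0) 0 rfl) Y i j hij
    have h3 : ∀ Y : Fin (r + 2) → HomElt 𝒢, toWord 1 φ (List.ofFn Y) =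
        φ (Function.update (fun _ _ => 0) 0 (Fin.init (vals Y))) (vals Y (Fin.last (r + 1))) := by
      intro Y
      obtain ⟨X, z, rfl⟩ : ∃ (X : Fin (r + 1) → HomElt 𝒢) (z : HomElt 𝒢), Y = Fin.snoc X z :=
        ⟨Fin.init Y, Y (Fin.last _), (Fin.snoc_init_self Y).symm⟩
      rw [← ofFn_append_singleton, toWord_succ_append, toWord, List.getD_cons_zero]
      rw [vals_snoc, Fin.init_snoc, Fin.snoc_last]
      congr 1
      funext i
      rw [Subsingleton.elim (α := Fin 1) i 0, Fin.cons_zero, Function.update_self]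
    rw [h1, h2, h3, h3]
    exact h
  | q + 2, Or.inl ht =>
    obtain ⟨v1, v2, rfl, hv⟩ : ∃ v1 v2, v = v1 ++ v2 ∧ u.length + v1.length + 2 = r + 1 := by
      refine ⟨v.take (r - 1 - u.length), v.drop (r - 1 - u.length),
        (List.take_append_drop _ _).symm, ?_⟩
      have : (q + 2) * (r + 1) = (q + 1) * (r + 1) + (r + 1) := by ring
      simp only [List.length_take]
      omega
    obtain ⟨Y, i, j, hij, rfl, rfl, h1, h2⟩ := exists_ofFn_swap u v1 a b hv
    obtain ⟨X, z, hX⟩ := exists_toWord_eq (M := M) (r := r) (q + 1) v2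
    have h := colorSkew_vals (hφ.block (Fin.cons 0 X) 0 z) Y i j hij
    simp only [Fin.update_cons_zero] at h
    have h3 : ∀ a b : HomElt 𝒢, u ++ a :: b :: (v1 ++ v2) = (u ++ a :: b :: v1) ++ v2 := by simp
    rw [h3, h3, h1, h2, toWord_succ_append, toWord_succ_append, hX, hX, h]
  | q + 2, Or.inr ⟨s, hs, hpos⟩ =>
    obtain ⟨X, u, rfl⟩ := exists_ofFn_append (m := r + 1) u (by omega)
    simp only [List.append_assoc, toWord_succ_append]
    simp only [List.length_append, List.length_ofFn] at hl hu
    refine toWord_skewAt (q + 1) _ (hφ.cons _) s hpos u v a b (by omega) ?_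
    linarith

section

variable {R : A.Representation ℳ} {q : ℕ} {ξ : Γ} {φ : Pre g M r q}

theorem IsCochain.preLinear (h : IsCochain R q ξ φ) : PreLinear K φ :=
  ⟨h.linear_block, h.linear_last⟩

theorem IsCochain.preSkew (h : IsCochain R q ξ φ) : PreSkew A.ε 𝒢 φ := ⟨h.skew_block, h.skew_last⟩

theorem IsCochain.isTwistedSeq (h : IsCochain R q ξ φ) :
    R.IsTwistedSeq (q * (r + 1) + 1) (fun _ => toWord q φ) where
  linear _ := toWord_wordLinear q φ h.preLinear
  compat _ := map_toWord R.μ q φ φ h.compat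

theorem IsCochain.toWord_mem (h : IsCochain R q ξ φ) (w : List (HomElt 𝒢))
    (hw : w.length = q * (r + 1) + 1) : toWord q φ w ∈ ℳ (ξ + wdeg w) := by
  obtain ⟨X, z, rfl⟩ := exists_wordOf q w hw
  rw [toWord_wordOf, wdeg_wordOf, ← add_assoc]
  exact h.degree (fun i t => (X i t).deg) z.deg _ _ (fun i t => (X i t).mem) z.mem

end

/-! ### From homogeneous to arbitrary arguments -/

omit [AddCommGroup Γ] in
theorem wordOf_eq_append (q : ℕ) (X : Fin q → Fin (r + 1) → HomElt 𝒢) :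
    ∃ u : List (HomElt 𝒢), u.length = q * (r + 1) ∧ ∀ z, wordOf q X z = u ++ [z] := by
  induction q with
  | zero => exact ⟨[], by simp, fun z => rfl⟩
  | succ q ih =>
    obtain ⟨u, hu, h⟩ := ih (Fin.tail X)
    refine ⟨List.ofFn (X 0) ++ u, ?_, fun z => by rw [wordOf, h, List.append_assoc]⟩
    rw [List.length_append, List.length_ofFn, hu]
    ring

omit [AddCommGroup Γ] in
theorem wordOf_update_eq (q : ℕ) (X : Fin q → Fin (r + 1) → HomElt 𝒢) (i : Fin q)
    (j : Fin (r + 1)) (z : HomElt 𝒢) :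
    ∃ u v : List (HomElt 𝒢), u.length + v.length + 1 = q * (r + 1) + 1 ∧
      ∀ c, wordOf q (Function.update X i (Function.update (X i) j c)) z = u ++ c :: v := by
  induction q with
  | zero => exact i.elim0
  | succ q ih =>
    refine Fin.cases ?_ (fun i => ?_) i
    · obtain ⟨u, v, -, hl, h⟩ := ofFn_update_eq (X 0) j
      refine ⟨u, v ++ wordOf q (Fin.tail X) z, ?_, fun c => ?_⟩
      · rw [List.length_append, length_wordOf]
        linarith
      · rw [wordOf, Function.update_self, h, Fin.tail_update_zero, List.append_assoc,
          List.cons_append]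
    · obtain ⟨u, v, hl, h⟩ := ih (Fin.tail X) i
      refine ⟨List.ofFn (X 0) ++ u, v, ?_, fun c => ?_⟩
      · rw [List.length_append, List.length_ofFn]
        linarith
      · rw [wordOf, Function.update_of_ne (Fin.succ_ne_zero i).symm, Fin.tail_update_succ,
          List.append_assoc, ← h c]
        rfl

section

variable [DecidableEq Γ] [DirectSum.Decomposition 𝒢]

/-- A property of tuples which is additive in every entry holds if it holds for tuples of
homogeneous elements. -/
theorem homogeneous_induction {ι : Type*} [Finite ι] [DecidableEq ι] {P : (ι → g) → Prop}
    (hom : ∀ X : ι → HomElt 𝒢, P fun i => (X i).val)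
    (add : ∀ (X : ι → g) (i : ι) (a b : g), P (Function.update X i a) →
      P (Function.update X i b) → P (Function.update X i (a + b))) (X : ι → g) : P X := by
  have key : ∀ (s : Finset ι) (X : ι → g), (∀ i ∉ s, ∃ y : HomElt 𝒢, y.val = X i) → P X := by
    intro s
    induction s using Finset.induction_on with
    | empty =>
      intro X hX
      choose Y hY using fun i => hX i (Finset.notMem_empty i)
      simpa only [hY] using hom Y
    | insert i s _ ih =>
      intro X hX
      have hi : ∀ x : g, P (Function.update X i x) := by
        intro x
        have hh : ∀ y : HomElt 𝒢, P (Function.update X i y.val) := by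
          intro y
          refine ih _ fun t ht => ?_
          by_cases h : t = i
          · subst h
            exact ⟨y, by simp⟩
          · obtain ⟨y', hy'⟩ := hX t (by simp [h, ht])
            exact ⟨y', by simp [h, hy']⟩
        exact DirectSum.Decomposition.inductionOn 𝒢 (hh ⟨0, 0, zero_mem _⟩)
          (fun {γ} m => hh ⟨γ, m, m.2⟩) (fun a b => add X i a b) x
      simpa using hi (X i)
  cases nonempty_fintype ι
  exact key Finset.univ X fun i hi => (hi (Finset.mem_univ i)).elim

/-- The form of `homogeneous_induction` for the arguments of cochains. -/
theorem pre_induction {q : ℕ} {P : (Fin q → Fin (r + 1) → g) → g → Prop}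
    (hom : ∀ (X : Fin q → Fin (r + 1) → HomElt 𝒢) (z : HomElt 𝒢),
      P (fun i => vals (X i)) z.val)
    (block : ∀ (X : Fin q → Fin (r + 1) → g) (i : Fin q) (j : Fin (r + 1)) (z a b : g),
      P (Function.update X i (Function.update (X i) j a)) z →
      P (Function.update X i (Function.update (X i) j b)) z →
      P (Function.update X i (Function.update (X i) j (a + b))) z)
    (last : ∀ (X : Fin q → Fin (r + 1) → g) (a b : g), P X a → P X b → P X (a + b))
    (X : Fin q → Fin (r + 1) → g) (z : g) : P X z := by
  have h1 : ∀ (Y : Option (Fin q × Fin (r + 1)) → g) (i : Fin q) (j : Fin (r + 1)) (a : g),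
      (fun i' j' => Function.update Y (some (i, j)) a (some (i', j'))) =
        Function.update (fun i j => Y (some (i, j))) i
          (Function.update (fun j => Y (some (i, j))) j a) := by
    intro Y i j a
    funext i' j'
    by_cases hi : i' = i
    · subst hi
      by_cases hj : j' = j
      · subst hj; simp
      · simp [hj]
    · simp [hi]
  refine homogeneous_induction (𝒢 := 𝒢) (ι := Option (Fin q × Fin (r + 1)))
    (P := fun Y => P (fun i j => Y (some (i, j))) (Y none))
    (fun Y => hom (fun i j => Y (some (i, j))) (Y none)) (fun Y t a b ha hb => ?_)
    (fun t => t.elim z fun ij => X ij.1 ij.2)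
  cases t with
  | none => simpa using last _ a b (by simpa using ha) (by simpa using hb)
  | some ij =>
    simp only [h1 Y ij.1 ij.2, Function.update_of_ne (Option.some_ne_none _).symm] at ha hb ⊢
    exact block _ _ _ _ _ _ ha hb

omit [AddCommGroup Γ] in
theorem mem_degrees (x : g) (γ : Γ) : γ ∈ degrees 𝒢 x ↔ comp 𝒢 γ x ≠ 0 := by
  classical
  rw [degrees, DFinsupp.mem_support_iff, comp, Ne, Ne, Submodule.coe_eq_zero]

omit [AddCommGroup Γ] in
theorem degrees_subset (y : HomElt 𝒢) : degrees 𝒢 y.val ⊆ {y.deg} := by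
  intro γ hγ
  rw [mem_degrees, comp] at hγ
  by_contra h
  exact hγ (DirectSum.decompose_of_mem_ne 𝒢 y.mem fun h' => h (by simp [h']))

omit [AddCommGroup Γ] in
theorem comp_deg (y : HomElt 𝒢) : comp 𝒢 y.deg y.val = y.val :=
  DirectSum.decompose_of_mem_same 𝒢 y.mem

/-- The homogeneous component of degree `γ` of `x`, as a homogeneous element. -/
def compElt (𝒢 : Γ → Submodule K g) [DirectSum.Decomposition 𝒢] (γ : Γ) (x : g) : HomElt 𝒢 :=
  ⟨γ, comp 𝒢 γ x, SetLike.coe_mem _⟩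

omit [AddCommGroup Γ] in
theorem compElt_comb (γ : Γ) (s t : K) (x y : g) : (compElt 𝒢 γ (s • x + t • y)).val =
    s • (compElt 𝒢 γ x).val + t • (compElt 𝒢 γ y).val := by
  simp only [compElt, comp, DirectSum.decompose_add, DirectSum.decompose_smul]
  rfl

variable {q : ℕ} {φ : Pre g M r q}

/-- The summands of the coboundary on arbitrary arguments, as values of the coboundary on words. -/
theorem coboundaryFormula_comp (R : A.Representation ℳ) (ξ : Γ)
    (D : Fin (q + 1) → Fin (r + 1) → Γ) (e : Γ) (X : Fin (q + 1) → Fin (r + 1) → g) (z : g) :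
    coboundaryFormula R q ξ φ D e (fun i t => comp 𝒢 (D i t) (X i t)) (comp 𝒢 e z) =
      R.cobd q q ξ (wordOf (q + 1) (fun i t => compElt 𝒢 (D i t) (X i t)) (compElt 𝒢 e z))
        (fun _ => toWord q φ) :=
  R.coboundaryFormula_eq_cobd q ξ φ (fun i t => compElt 𝒢 (D i t) (X i t)) (compElt 𝒢 e z)

/-- The sum over the homogeneous components may be taken over any larger sets of degrees, since the
summands vanish if one of the components is `0`. -/
theorem homCoboundary_eq_sum (R : A.Representation ℳ) (ξ : Γ) (hφ : PreLinear K φ)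
    (X : Fin (q + 1) → Fin (r + 1) → g) (z : g) (S : Fin (q + 1) → Fin (r + 1) → Finset Γ)
    (S' : Finset Γ) (hX : ∀ i t, degrees 𝒢 (X i t) ⊆ S i t) (hz : degrees 𝒢 z ⊆ S') :
    homCoboundary R q ξ φ X z = ∑ D ∈ Fintype.piFinset fun i => Fintype.piFinset fun t => S i t,
      ∑ e ∈ S', R.cobd q q ξ (wordOf (q + 1) (fun i t => compElt 𝒢 (D i t) (X i t))
        (compElt 𝒢 e z)) (fun _ => toWord q φ) := by
  have hlin := R.cobd_wordLinear q q ξ (fun _ => toWord q φ) fun _ => toWord_wordLinear q φ hφ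
  have h1 : ∀ D : Fin (q + 1) → Fin (r + 1) → Γ, ∀ e,
      ¬(∀ i t, D i t ∈ degrees 𝒢 (X i t)) → R.cobd q q ξ (wordOf (q + 1)
        (fun i t => compElt 𝒢 (D i t) (X i t)) (compElt 𝒢 e z)) (fun _ => toWord q φ) = 0 := by
    intro D e h
    push Not at h
    obtain ⟨i, t, h⟩ := h
    obtain ⟨u, v, hl, hw⟩ := wordOf_update_eq (q + 1)
      (fun i t => compElt 𝒢 (D i t) (X i t)) i t (compElt 𝒢 e z)
    have hw' := hw (compElt 𝒢 (D i t) (X i t))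
    rw [Function.update_eq_self, Function.update_eq_self] at hw'
    rw [hw']
    rw [mem_degrees, not_not] at h
    exact hlin.eq_zero u v _ hl h
  have h2 : ∀ D : Fin (q + 1) → Fin (r + 1) → Γ, ∀ e, e ∉ degrees 𝒢 z →
      R.cobd q q ξ (wordOf (q + 1) (fun i t => compElt 𝒢 (D i t) (X i t)) (compElt 𝒢 e z))
        (fun _ => toWord q φ) = 0 := by
    intro D e h
    obtain ⟨u, hl, hw⟩ := wordOf_eq_append (q + 1) (fun i t => compElt 𝒢 (D i t) (X i t))
    rw [mem_degrees, not_not] at h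
    rw [hw]
    exact hlin.eq_zero u [] _ (by simp [hl]) h
  have h3 : homCoboundary R q ξ φ X z =
      ∑ D ∈ Fintype.piFinset fun i => Fintype.piFinset fun t => degrees 𝒢 (X i t),
        ∑ e ∈ degrees 𝒢 z,
          coboundaryFormula R q ξ φ D e (fun i t => comp 𝒢 (D i t) (X i t)) (comp 𝒢 e z) := rfl
  rw [h3]
  simp only [coboundaryFormula_comp]
  have h4 : ∀ D : Fin (q + 1) → Fin (r + 1) → Γ,
      ∑ e ∈ degrees 𝒢 z, R.cobd q q ξ (wordOf (q + 1) (fun i t => compElt 𝒢 (D i t) (X i t))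
        (compElt 𝒢 e z)) (fun _ => toWord q φ) =
      ∑ e ∈ S', R.cobd q q ξ (wordOf (q + 1) (fun i t => compElt 𝒢 (D i t) (X i t))
        (compElt 𝒢 e z)) (fun _ => toWord q φ) := fun D =>
    Finset.sum_subset hz fun e _ he => h2 D e he
  simp only [h4]
  refine Finset.sum_subset (Fintype.piFinset_subset _ _ fun i =>
    Fintype.piFinset_subset _ _ fun t => hX i t) fun D _ hD =>
      Finset.sum_eq_zero fun e _ => h1 D e ?_
  simpa only [Fintype.mem_piFinset] using hD

/-- On homogeneous arguments, the coboundary is the coboundary on words. -/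
theorem homCoboundary_vals (R : A.Representation ℳ) (ξ : Γ) (hφ : PreLinear K φ)
    (X : Fin (q + 1) → Fin (r + 1) → HomElt 𝒢) (z : HomElt 𝒢) :
    homCoboundary R q ξ φ (fun i => vals (X i)) z.val =
      R.cobd q q ξ (wordOf (q + 1) X z) (fun _ => toWord q φ) := by
  have h : ∀ y : HomElt 𝒢, compElt 𝒢 y.deg y.val = y := fun y => HomElt.ext rfl (comp_deg y)
  rw [homCoboundary_eq_sum R ξ hφ (fun i => vals (X i)) z.val (fun i t => {(X i t).deg}) {z.deg}
    (fun i t => degrees_subset _) (degrees_subset z)]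
  simp only [Fintype.piFinset_singleton, Finset.sum_singleton, vals, h]

theorem toWord_homCoboundary (R : A.Representation ℳ) (ξ : Γ) (hφ : PreLinear K φ)
    (w : List (HomElt 𝒢)) (hw : w.length = (q + 1) * (r + 1) + 1) :
    toWord (q + 1) (homCoboundary R q ξ φ) w = R.cobd q q ξ w (fun _ => toWord q φ) := by
  obtain ⟨X, z, rfl⟩ := exists_wordOf (q + 1) w hw
  rw [toWord_wordOf, homCoboundary_vals R ξ hφ]

theorem homCoboundary_preLinear (R : A.Representation ℳ) (ξ : Γ) (hφ : PreLinear K φ) :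
    PreLinear K (homCoboundary R q ξ φ) := by
  have hlin := R.cobd_wordLinear q q ξ (fun _ => toWord q φ) fun _ => toWord_wordLinear q φ hφ
  have of_comb : ∀ f : g → M, (∀ (s t : K) (x y : g), f (s • x + t • y) = s • f x + t • f y) →
      IsLinearMap K f := fun f hf =>
    ⟨fun x y => by simpa using hf 1 1 x y, fun s x => by simpa using hf s 0 x 0⟩
  refine ⟨fun X i j z => of_comb _ fun s t x y => ?_, fun X => of_comb _ fun s t x y => ?_⟩
  -- common sets of degrees for the arguments with `x`, with `y` and with `s • x + t • y`
  · let S : Fin (q + 1) → Fin (r + 1) → Finset Γ := fun i' t' => degrees 𝒢 (X i' t') ∪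
      (degrees 𝒢 x ∪ (degrees 𝒢 y ∪ degrees 𝒢 (s • x + t • y)))
    have hS : ∀ a : g, degrees 𝒢 a ⊆ degrees 𝒢 x ∪ (degrees 𝒢 y ∪ degrees 𝒢 (s • x + t • y)) →
        homCoboundary R q ξ φ (Function.update X i (Function.update (X i) j a)) z =
          ∑ D ∈ Fintype.piFinset fun i => Fintype.piFinset fun t => S i t, ∑ e ∈ degrees 𝒢 z,
            R.cobd q q ξ (wordOf (q + 1) (Function.update (fun i t => compElt 𝒢 (D i t) (X i t)) i
              (Function.update (fun t => compElt 𝒢 (D i t) (X i t)) j (compElt 𝒢 (D i j) a)))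
              (compElt 𝒢 e z)) (fun _ => toWord q φ) := by
      intro a ha
      rw [homCoboundary_eq_sum R ξ hφ _ z S _ (fun i' t' => ?_) subset_rfl]
      · refine Finset.sum_congr rfl fun D _ => Finset.sum_congr rfl fun e _ => ?_
        congr 3
        funext i' t'
        by_cases hi : i' = i
        · subst hi
          by_cases ht : t' = j
          · subst ht; simp
          · simp [ht]
        · simp [hi]
      · by_cases hi : i' = i
        · subst hi
          by_cases ht : t' = j
          · subst ht
            rw [Function.update_self, Function.update_self]
            exact ha.trans Finset.subset_union_right
          · rw [Function.update_self, Function.update_of_ne ht]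
            exact Finset.subset_union_left
        · rw [Function.update_of_ne hi]
          exact Finset.subset_union_left
    rw [hS x (by grind), hS y (by grind), hS _ (by grind)]
    simp only [Finset.smul_sum, ← Finset.sum_add_distrib]
    refine Finset.sum_congr rfl fun D _ => Finset.sum_congr rfl fun e _ => ?_
    obtain ⟨u, v, hl, hw⟩ := wordOf_update_eq (q + 1)
      (fun i t => compElt 𝒢 (D i t) (X i t)) i j (compElt 𝒢 e z)
    rw [hw, hw, hw]
    exact hlin.comb u v hl s t _ _ _ rfl rfl (compElt_comb _ s t x y)
  · have hS := fun a ha => homCoboundary_eq_sum R ξ hφ X a _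
      (degrees 𝒢 x ∪ (degrees 𝒢 y ∪ degrees 𝒢 (s • x + t • y))) (fun i t => subset_rfl) ha
    rw [hS x (by grind), hS y (by grind), hS _ (by grind)]
    simp only [Finset.smul_sum, ← Finset.sum_add_distrib]
    refine Finset.sum_congr rfl fun D _ => Finset.sum_congr rfl fun e _ => ?_
    obtain ⟨u, hl, hw⟩ := wordOf_eq_append (q + 1) (fun i t => compElt 𝒢 (D i t) (X i t))
    rw [hw, hw, hw]
    exact hlin.comb u [] (by simp [hl]) s t _ _ _ rfl rfl (compElt_comb _ s t x y)

end

/-! ### The complex of cochains -/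

theorem skewPos_block {q i t : ℕ} (hi : i < q) (ht : t < r) : SkewPos r q (i * (r + 1) + t) := by
  induction q generalizing i with
  | zero => omega
  | succ q ih =>
    cases q with
    | zero =>
      obtain rfl : i = 0 := by omega
      show 0 * (r + 1) + t < r + 1
      omega
    | succ q =>
      cases i with
      | zero => exact Or.inl (by omega)
      | succ i => exact Or.inr ⟨_, by ring, ih (i := i) (by omega)⟩

theorem skewPos_last {q t : ℕ} (ht : t < r + 1) : SkewPos r (q + 1) (q * (r + 1) + t) := by
  induction q with
  | zero =>
    show 0 * (r + 1) + t < r + 1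
    omega
  | succ q ih => exact Or.inr ⟨_, by ring, ih⟩

omit [AddCommGroup Γ] in
theorem wordOf_update_block (q : ℕ) (X : Fin q → Fin (r + 1) → HomElt 𝒢) (i : Fin q)
    (z : HomElt 𝒢) :
    ∃ u v : List (HomElt 𝒢), u.length = i * (r + 1) ∧
      u.length + (r + 1) + v.length = q * (r + 1) + 1 ∧
      ∀ Y, wordOf q (Function.update X i Y) z = u ++ (List.ofFn Y ++ v) := by
  induction q with
  | zero => exact i.elim0
  | succ q ih =>
    refine Fin.cases ?_ (fun i => ?_) i
    · refine ⟨[], wordOf q (Fin.tail X) z, by simp, ?_, fun Y => ?_⟩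
      · rw [length_wordOf]
        simp
        ring
      · rw [wordOf, Function.update_self, Fin.tail_update_zero, List.nil_append]
    · obtain ⟨u, v, hu, hl, h⟩ := ih (Fin.tail X) i
      refine ⟨List.ofFn (X 0) ++ u, v, ?_, ?_, fun Y => ?_⟩
      · rw [List.length_append, List.length_ofFn, hu, Fin.val_succ]
        ring
      · rw [List.length_append, List.length_ofFn]
        linarith
      · rw [wordOf, Function.update_of_ne (Fin.succ_ne_zero i).symm, Fin.tail_update_succ,
          List.append_assoc, ← h Y]

omit [AddCommGroup Γ] in
theorem wordOf_update_last (q : ℕ) (X : Fin (q + 1) → Fin (r + 1) → HomElt 𝒢) :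
    ∃ u : List (HomElt 𝒢), u.length = q * (r + 1) ∧ ∀ y : Fin (r + 2) → HomElt 𝒢,
      wordOf (q + 1) (Function.update X (Fin.last q) (Fin.init y)) (y (Fin.last (r + 1))) =
        u ++ List.ofFn y := by
  induction q with
  | zero =>
    refine ⟨[], by simp, fun y => ?_⟩
    rw [wordOf, wordOf, ofFn_append_singleton, show Fin.last 0 = 0 from rfl, Function.update_self,
      Fin.snoc_init_self, List.nil_append]
  | succ q ih =>
    obtain ⟨u, hu, h⟩ := ih (Fin.tail X)
    refine ⟨List.ofFn (X 0) ++ u, ?_, fun y => ?_⟩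
    · rw [List.length_append, List.length_ofFn, hu]
      ring
    · rw [wordOf, ← Fin.succ_last, Function.update_of_ne (Fin.succ_ne_zero _).symm,
        Fin.tail_update_succ, List.append_assoc, ← h y]

section

variable [DecidableEq Γ] [DirectSum.Decomposition 𝒢] {q : ℕ} {φ : Pre g M r q}

/-- `ε`-skew-symmetry of `φ` can be tested on words of homogeneous elements. -/
theorem preSkew_of_skewAt {ε : Bicharacter Γ K} (hφ : PreLinear K φ)
    (h : ∀ t, SkewPos r q t → SkewAt ε (q * (r + 1) + 1) t (toWord (𝒢 := 𝒢) q φ)) :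
    PreSkew ε 𝒢 φ := by
  -- blocks of homogeneous elements may be replaced before or after passing to the values
  have hvu : ∀ (X : Fin q → Fin (r + 1) → HomElt 𝒢) (i : Fin q) (Y : Fin (r + 1) → HomElt 𝒢),
      Function.update (fun i => vals (X i)) i (vals Y) =
        fun k => vals (Function.update X i Y k) := by
    intro X i Y
    funext k
    by_cases hk : k = i
    · subst hk; simp
    · simp [hk]
  refine ⟨fun X i z a b hab d x hx => ?_, fun X i hi a b hab d x hx => ?_⟩
  · let x' : Fin (r + 1) → HomElt 𝒢 := fun t => ⟨d t, x t, hx t⟩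
    refine pre_induction (𝒢 := 𝒢) (P := fun X z => φ (Function.update X i x) z =
      -(ε.app (d a) (d b) • φ (Function.update X i (x ∘ Equiv.swap a b)) z))
      (fun X z => ?_) (fun X i' j z c e hc he => ?_) (fun X c e hc he => ?_) X z
    · obtain ⟨u, v, hu, hl, hw⟩ := wordOf_update_block q X i z
      obtain ⟨u', v', hu', hl', h1, h2⟩ := ofFn_swap x' a b hab
      have h3 := h _ (skewPos_block (r := r) (t := a) i.2 (by omega)) (u ++ u') (v' ++ v)
        (x' a) (x' b) (by rw [List.length_append, hu, hu'])
        (by simp only [List.length_append]; omega)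
      have e1 : (u ++ u') ++ x' a :: x' b :: (v' ++ v) = u ++ (List.ofFn x' ++ v) := by
        rw [h1]
        simp
      have e2 : (u ++ u') ++ x' b :: x' a :: (v' ++ v) =
        u ++ (List.ofFn (x' ∘ Equiv.swap a b) ++ v) := by
        rw [h2]
        simp
      rw [e1, e2, ← hw, ← hw, toWord_wordOf, toWord_wordOf, ← hvu, ← hvu] at h3
      exact h3
    · by_cases hii : i' = i
      · subst hii
        simpa only [Function.update_idem] using hc
      · simp only [Function.update_comm hii] at hc he ⊢
        have h3 := fun w : Fin (r + 1) → g => hφ.block (Function.update X i w) i' j z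
        simp only [Function.update_of_ne hii] at h3
        rw [(h3 _).map_add, hc, he, (h3 _).map_add, smul_add, neg_add]
    · rw [(hφ.last _).map_add, hc, he, (hφ.last _).map_add, smul_add, neg_add]
  · obtain ⟨q, rfl⟩ : ∃ q', q = q' + 1 := ⟨i, hi.symm⟩
    obtain rfl : i = Fin.last q := Fin.ext (by simpa using hi)
    let x' : Fin (r + 2) → HomElt 𝒢 := fun t => ⟨d t, x t, hx t⟩
    refine pre_induction (𝒢 := 𝒢) (P := fun X z =>
      φ (Function.update X (Fin.last q) (Fin.init x)) (x (Fin.last (r + 1))) =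
      -(ε.app (d a) (d b) • φ (Function.update X (Fin.last q) (Fin.init (x ∘ Equiv.swap a b)))
        ((x ∘ Equiv.swap a b) (Fin.last (r + 1)))))
      (fun X _ => ?_) (fun X i' j z c e hc he => ?_) (fun X c e hc _ => hc) X 0
    · obtain ⟨u, hu, hw⟩ := wordOf_update_last q X
      obtain ⟨u', v', hu', hl', h1, h2⟩ := ofFn_swap x' a b hab
      have h3 := h _ (skewPos_last (r := r) (t := a) (by omega)) (u ++ u') v'
        (x' a) (x' b) (by rw [List.length_append, hu, hu'])
        (by simp only [List.length_append, hu]; linarith)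
      rw [List.append_assoc, List.append_assoc, ← h1, ← h2, ← hw, ← hw, toWord_wordOf,
        toWord_wordOf, ← hvu, ← hvu] at h3
      exact h3
    · by_cases hii : i' = Fin.last q
      · subst hii
        simpa only [Function.update_idem] using hc
      · simp only [Function.update_comm hii] at hc he ⊢
        have h3 := fun (w : Fin (r + 1) → g) z =>
          hφ.block (Function.update X (Fin.last q) w) i' j z
        simp only [Function.update_of_ne hii] at h3
        rw [(h3 _ _).map_add, hc, he, (h3 _ _).map_add, smul_add, neg_add]

variable {R : A.Representation ℳ} {ξ : Γ}

/-- The coboundary of a cochain is a cochain of the same degree. -/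
theorem IsCochain.homCoboundary (hA : A.IsMultiplicative) (h : IsCochain R q ξ φ) :
    IsCochain R (q + 1) ξ (homCoboundary R q ξ φ) := by
  have hlin := homCoboundary_preLinear R ξ h.preLinear
  have hskew : PreSkew A.ε 𝒢 (NHomLieColorAlgebra.homCoboundary R q ξ φ) := by
    refine preSkew_of_skewAt hlin fun t ht u v a b hu hl => ?_
    rw [toWord_homCoboundary R ξ h.preLinear _ (by simp; omega),
      toWord_homCoboundary R ξ h.preLinear _ (by simp; omega)]
    exact R.cobd_skewAt q q ξ _ (fun _ => toWord_wordLinear q φ h.preLinear)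
      (fun _ t ht => toWord_skewAt q φ h.preSkew t ht) t ht u v a b hu hl
  refine ⟨hlin.block, hlin.last, fun D e X z hX hz => ?_, hskew.block, hskew.last, fun X z => ?_⟩
  · have h1 := homCoboundary_vals R ξ h.preLinear
      (fun i t => (⟨D i t, X i t, hX i t⟩ : HomElt 𝒢)) ⟨e, z, hz⟩
    have h2 := R.cobd_mem q q ξ (fun _ => toWord q φ) (fun _ w hw => h.toWord_mem w hw)
      (wordOf (q + 1) (fun i t => (⟨D i t, X i t, hX i t⟩ : HomElt 𝒢)) ⟨e, z, hz⟩)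
      (length_wordOf _ _ _)
    rw [← h1, wdeg_wordOf, ← add_assoc] at h2
    exact h2
  · refine pre_induction (𝒢 := 𝒢) (P := fun X z =>
      R.μ (NHomLieColorAlgebra.homCoboundary R q ξ φ X z) =
        NHomLieColorAlgebra.homCoboundary R q ξ φ (fun i => A.tw (X i)) (A.α z))
      (fun X z => ?_) (fun X i j z a b ha hb => ?_) (fun X a b ha hb => ?_) X z
    · have htw : (fun i => A.tw (vals (X i))) = fun i => vals (A.twTup 1 (X i)) :=
        funext fun i => by rw [vals_twTup]; rfl
      rw [homCoboundary_vals R ξ h.preLinear, R.mu_cobd hA q q ξ _ h.isTwistedSeq.compat _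
        (length_wordOf _ _ _), map_twElt_wordOf, htw, ← twElt_val,
        homCoboundary_vals R ξ h.preLinear]
      rfl
    · have htw : ∀ x, (fun k => A.tw (Function.update X i (Function.update (X i) j x) k)) =
          Function.update (fun k => A.tw (X k)) i (Function.update (A.tw (X i)) j (A.α x)) := by
        intro x
        funext k t
        by_cases hk : k = i
        · subst hk
          by_cases ht : t = j
          · subst ht; simp [tw]
          · simp [tw, ht]
        · simp [hk]
      rw [htw] at ha hb ⊢
      rw [(hlin.block X i j z).map_add, map_add, ha, hb, map_add,
        (hlin.block (fun k => A.tw (X k)) i j _).map_add]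
    · rw [(hlin.last _).map_add, map_add, ha, hb, map_add, (hlin.last _).map_add]

/-- The coboundary of a coboundary vanishes. -/
theorem IsCochain.homCoboundary_homCoboundary (hA : A.IsMultiplicative) (h : IsCochain R q ξ φ) :
    NHomLieColorAlgebra.homCoboundary R (q + 1) ξ
      (NHomLieColorAlgebra.homCoboundary R q ξ φ) = 0 := by
  funext X z
  rw [homCoboundary_eq_sum R ξ (homCoboundary_preLinear R ξ h.preLinear) X z _ _
    (fun i t => subset_rfl) subset_rfl]
  refine Finset.sum_eq_zero fun D _ => Finset.sum_eq_zero fun e _ => ?_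
  rw [R.cobd_congr (q + 1) (q + 1) ξ _ _ (R.cobdSeq q q ξ fun _ => toWord q φ)
    (length_wordOf _ _ _) fun k w hw => toWord_homCoboundary R ξ h.preLinear w hw]
  exact R.cobd_cobdSeq hA q q ξ _ _ h.isTwistedSeq (length_wordOf _ _ _)

theorem coboundary_apply (φ : ⨁ _ξ : Γ, Pre g M r q) :
    coboundary R q φ ξ = NHomLieColorAlgebra.homCoboundary R q ξ (φ ξ) := by
  simp [coboundary]

theorem coboundary_mem_cochains (hA : A.IsMultiplicative) (φ : ⨁ _ξ : Γ, Pre g M r q)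
    (hφ : φ ∈ cochains R q) : coboundary R q φ ∈ cochains R (q + 1) := fun ξ => by
  rw [coboundary_apply]
  exact IsCochain.homCoboundary hA (hφ ξ)

theorem coboundary_coboundary (hA : A.IsMultiplicative) (φ : ⨁ _ξ : Γ, Pre g M r q)
    (hφ : φ ∈ cochains R q) : coboundary R (q + 1) (coboundary R q φ) = 0 := by
  refine DFinsupp.ext fun ξ => ?_
  rw [coboundary_apply, coboundary_apply]
  exact IsCochain.homCoboundary_homCoboundary hA (hφ ξ)

end

end NHomLieColorAlgebra

theorem mainTheorem1 {Γ K g M : Type*} [AddCommGroup Γ] [DecidableEq Γ] [Field K] [CharZero K]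
    [AddCommGroup g] [Module K g] [AddCommGroup M] [Module K M]
    (𝒢 : Γ → Submodule K g) [DirectSum.Decomposition 𝒢]
    (ℳ : Γ → Submodule K M) [DirectSum.Decomposition ℳ]
    (r : ℕ) (A : NHomLieColorAlgebra K 𝒢 r) (hA : A.IsMultiplicative)
    (R : A.Representation ℳ) (q : ℕ) :
    (∀ φ ∈ NHomLieColorAlgebra.cochains R q,
      NHomLieColorAlgebra.coboundary R q φ ∈ NHomLieColorAlgebra.cochains R (q + 1)) ∧
    (∀ φ ∈ NHomLieColorAlgebra.cochains R q,
      NHomLieColorAlgebra.coboundary R (q + 1) (NHomLieColorAlgebra.coboundary R q φ) = 0) ∧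
    NHomLieColorAlgebra.coboundaries R q ≤ NHomLieColorAlgebra.cocycles R q := by
  refine ⟨NHomLieColorAlgebra.coboundary_mem_cochains hA,
    NHomLieColorAlgebra.coboundary_coboundary hA, ?_⟩
  cases q with
  | zero => exact bot_le
  | succ q =>
    rintro _ ⟨φ, hφ, rfl⟩
    exact ⟨NHomLieColorAlgebra.coboundary_mem_cochains hA φ hφ,
      NHomLieColorAlgebra.coboundary_coboundary hA φ hφ⟩
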